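/- Consider an $n\times n$ input-queued switch in discrete time with $q_{ij}(t+1)=[q_{ij}(t)+a_{ij}(t)-s_{ij}(t)]^+$, where a schedule $s(t)\in\{0,1\}^{n\times n}$ is feasible if all its row and column sums are at most $1$, and maximal if they all equal $1$. A scheduling policy picks a feasible schedule $s(t)$ in every slot, possibly at random, from the past and the current queue lengths $q(t)$, before the arrivals $a(t)$ are known. The MaxWeight policy picks, on the basis of $q(t)$ only, a maximal schedule that maximizes $\sum_{ij}q_{ij}(t)s_{ij}$ over all feasible schedules, with ties broken by an arbitrary (possibly random) rule. Let $0\le n_1,n_2<n$. For $0<\epsilon<1$ let the arrivals $a_{ij}(t)$ be independent over $i,j,t$, the arrivals of slot $t$ being independent of the past and of $s(t)$, and let $a_{ij}(t)$ be Bernoulli with mean $\lambda^{(\epsilon)}_{ij}=(1-\epsilon)/(2n)$ if $i>n_1$ and $j>n_2$, and $\lambda^{(\epsilon)}_{ij}=(1-\epsilon)/n$ otherwise. (a) Under MaxWeight, for every $\epsilon\in(0,1)$ the queue length process has a stationary law to which it converges in distribution from every initial law; let $\bar q^{(\epsilon)}$ denote a random matrix with this law. Then $$\lim_{\epsilon\downarrow0}\epsilon\,\mathbb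 E\Big[\sum_{ij}\bar q^{(\epsilon)}_{ij}\Big]=\frac{n_1+n_2}{2}\Big(1-\frac1n\Big).$$ (b) Consider any policy (which may depend on $\epsilon$) under which, for every $\epsilon\in(0,1)$, the switch is stable in the sense that the queue length process, from some initial law, converges in distribution to a (finite) random matrix $\hat q^{(\epsilon)}$. Then, with expectations in $[0,\infty]$, $$\liminf_{\epsilon\downarrow0}\epsilon\,\mathbb E\Big[\sum_{ij}\hat q^{(\epsilon)}_{ij}\Big]\ \ge\ \frac{\max\{n_1,n_2\}}{2}\Big(1-\frac1n\Big).$$ (c) Hence MaxWeight is within a factor of two of optimal in heavy traffic: for every policy as in (b), $$\limsup_{\epsilon\downarrow0}\epsilon\,\mathbb E\Big[\sum_{ij}\bar q^{(\epsilon)}_{ij}\Big]\ \le\ 2\,\liminf_{\epsilon\downarrow0}\epsilon\,\mathbb E\Big[\sum_{ij}\hat q^{(\epsilon)}_{ij}\Big].$$ -/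

import Mathlib

open Filter Topology MeasureTheory
open scoped ENNReal

namespace SwitchModel

noncomputable section

/-- Queue lengths (number of packets) of an `n × n` switch; entry `(i, j)` is the queue of packets
at input port `i` destined for output port `j`. -/
abbrev QueueMatrix (n : ℕ) : Type := Fin n → Fin n → ℕ

/-- A feasible schedule: in one slot every input and every output takes part in at most one
transfer. (The constraints force all entries into `{0, 1}`.) -/
def Schedule (n : ℕ) : Type :=
  {s : Fin n → Fin n → ℕ // (∀ i, ∑ j, s i j ≤ 1) ∧ ∀ j, ∑ i, s i j ≤ 1}

/-- A maximal schedule: every input and every output is matched. -/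
def Schedule.IsMaximal {n : ℕ} (s : Schedule n) : Prop :=
  (∀ i, ∑ j, s.1 i j = 1) ∧ ∀ j, ∑ i, s.1 i j = 1

/-- The weight `⟨q, s⟩` of a schedule at queue lengths `q`. -/
def Schedule.weight {n : ℕ} (q : QueueMatrix n) (s : Schedule n) : ℕ :=
  ∑ i, ∑ j, q i j * s.1 i j

/-- `min 1 (max 0 x)` as an extended nonnegative real; it is `x` itself when `0 ≤ x ≤ 1`. -/
def prob (x : ℝ) : ℝ≥0∞ := min 1 (ENNReal.ofReal x)

theorem sum_bernoulli_weights {n : ℕ} (lam : Fin n → Fin n → ℝ) :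
    ∑ a : Fin n → Fin n → Bool,
      ∏ i, ∏ j, (if a i j then prob (lam i j) else 1 - prob (lam i j)) = 1 := by
  have h : ∀ i : Fin n, ∑ r : Fin n → Bool,
      ∏ j, (if r j then prob (lam i j) else 1 - prob (lam i j)) = 1 := by
    intro i
    rw [← Fintype.prod_sum (fun (j : Fin n) (b : Bool) =>
      if b then prob (lam i j) else 1 - prob (lam i j))]
    refine Finset.prod_eq_one fun j _ => ?_
    simp [prob, add_tsub_cancel_of_le]
  rw [← Fintype.prod_sum (fun (i : Fin n) (r : Fin n → Bool) =>
    ∏ j, if r j then prob (lam i j) else 1 - prob (lam i j))]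
  exact Finset.prod_eq_one fun i _ => h i

/-- The arrivals of one slot: independent Bernoulli variables, the one of queue `(i, j)` having
mean `lam i j` (`true` means that one packet arrives). -/
def arrivalLaw {n : ℕ} (lam : Fin n → Fin n → ℝ) : PMF (Fin n → Fin n → Bool) :=
  PMF.ofFintype
    (fun a => ∏ i, ∏ j, (if a i j then prob (lam i j) else 1 - prob (lam i j)))
    (sum_bernoulli_weights lam)

/-- The queue evolution `q(t+1) = [q(t) + a(t) - s(t)]⁺` (truncated subtraction). -/
def nextQueue {n : ℕ} (q : QueueMatrix n) (a : Fin n → Fin n → Bool) (s : Schedule n) :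
    QueueMatrix n :=
  fun i j => q i j + (a i j).toNat - s.1 i j

/-- The past of the switch, most recent slot first: for every past slot the queue lengths at its
beginning, the schedule used, and the arrivals. -/
abbrev History (n : ℕ) : Type :=
  List (QueueMatrix n × Schedule n × (Fin n → Fin n → Bool))

/-- A scheduling policy: it picks the schedule of the current slot, possibly at random, from the
past and the current queue lengths, before the arrivals of the slot are known. -/
abbrev Policy (n : ℕ) : Type := History n → QueueMatrix n → PMF (Schedule n)

/-- One slot: the policy picks a schedule, then the arrivals are drawn independently of everything
before, then the queues are served and updated. -/
def step {n : ℕ} (P : Policy n) (lam : Fin n → Fin n → ℝ) (x : History n × QueueMatrix n) :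
    PMF (History n × QueueMatrix n) :=
  (P x.1 x.2).bind fun s =>
    (arrivalLaw lam).map fun a => ((x.2, s, a) :: x.1, nextQueue x.2 a s)

/-- Joint law of the past and the queue lengths at the beginning of slot `t`, when the initial
queue lengths have law `init`. -/
def trajectoryLaw {n : ℕ} (P : Policy n) (lam : Fin n → Fin n → ℝ) (init : PMF (QueueMatrix n)) :
    ℕ → PMF (History n × QueueMatrix n)
  | 0 => init.map fun q => ([], q)
  | t + 1 => (trajectoryLaw P lam init t).bind (step P lam)

/-- The law of the queue lengths `q(t)`. -/
def queueLaw {n : ℕ} (P : Policy n) (lam : Fin n → Fin n → ℝ) (init : PMF (QueueMatrix n))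
    (t : ℕ) : PMF (QueueMatrix n) :=
  (trajectoryLaw P lam init t).map Prod.snd

/-- A law on queue matrices as an element of Mathlib's space of probability measures, which carries
the topology of convergence in distribution. -/
def toProbabilityMeasure {n : ℕ} (p : PMF (QueueMatrix n)) : ProbabilityMeasure (QueueMatrix n) :=
  ⟨p.toMeasure, inferInstance⟩

/-- The queue length process converges in distribution to a (finite) random matrix of law `π`. -/
def ConvergesInLaw {n : ℕ} (P : Policy n) (lam : Fin n → Fin n → ℝ) (init π : PMF (QueueMatrix n)) :
    Prop :=
  Tendsto (fun t => toProbabilityMeasure (queueLaw P lam init t)) atTop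
    (𝓝 (toProbabilityMeasure π))

/-- MaxWeight: in every slot, on the basis of the current queue lengths only, a maximal schedule is
picked whose weight is largest among all feasible schedules; ties are broken by an arbitrary,
possibly random, rule (for example uniformly at random). -/
def IsMaxWeight {n : ℕ} (P : Policy n) : Prop :=
  ∃ rule : QueueMatrix n → PMF (Schedule n), (∀ h q, P h q = rule q) ∧
    ∀ q, ∀ s ∈ (rule q).support, s.IsMaximal ∧ ∀ s' : Schedule n, s'.weight q ≤ s.weight q

/-- The expected total queue length `E[∑ᵢⱼ qᵢⱼ] ∈ [0, ∞]` when `q` has law `π`. -/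
def meanTotal {n : ℕ} (π : PMF (QueueMatrix n)) : ℝ≥0∞ :=
  ∫⁻ q, ∑ i, ∑ j, (q i j : ℝ≥0∞) ∂π.toMeasure

/-- Arrival rates: `(1 - ε) / (2n)` for an unsaturated input and an unsaturated output, `(1 - ε) / n`
otherwise; the saturated ports are the first `n₁` inputs and the first `n₂` outputs. -/
def rate (n n₁ n₂ : ℕ) (ε : ℝ) (i j : Fin n) : ℝ :=
  if n₁ ≤ i.val ∧ n₂ ≤ j.val then (1 - ε) / (2 * n) else (1 - ε) / n

end

end SwitchModel

open SwitchModel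

/-! Lower bound for every policy. A port serves at most one packet per slot, so a saturated port
holds at least as many packets as a single-server queue `r ↦ [r + A - 1]⁺` fed by the same arrivals
`A`, of mean `1 - ε`. That queue has stationary mean `(Var A - ε (1 - ε)) / (2 ε)`. Different rows
share no queue, nor do different columns, so the bounds add up over the saturated inputs or over the
saturated outputs; a row and a column do intersect, whence only a maximum
(`lindley_iterate_le_mean`, `exists_lindley_iterate_gt`).

MaxWeight. Let `P` be the orthogonal projection to the span of the indicator matrices of the
saturated ports, which has dimension `n₁ + n₂`. Maximal schedules and the critical rates have the
same projection, so in steady state a vanishing drift of `‖P q‖²` reads `(2 ε / n) E ∑ q = E ‖P (a -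
s)‖² + error`, and the right-hand mean tends to (trace of `P`) times the variance `(1/n) (1 - 1/n)`
(`abs_drift_norm_portProj_sq_le`, `arrivalMean_norm_portProj_net_sq`).

The error comes from replacing `P q` by `q` and from the unused service `u`. Both are controlled by
state space collapse: the distance from `q` to the cone of nonnegative matrices in the span has a
second moment bounded uniformly in `ε`. Indeed, by Birkhoff's theorem a MaxWeight schedule outweighs
every doubly substochastic matrix, in particular the critical rates tilted in the direction in which
`q` leaves the cone (`inner_rateVec_add_le`). Since `u` vanishes where the next queue `q⁺` is
nonzero, `⟨P q⁺, u⟩` sees only `q⁺ - P q⁺`; and the mean of `u` at saturated ports is of order `ε`.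
Young's inequality with weight `√ε` then makes the cross term vanish.

Steady state. The drift of `‖q‖²` gives an invariant law as a limit of time averages. Two
independent copies return to small queues and can empty during slots without arrivals, so they meet
almost surely, which gives convergence from every initial law (`exists_steadyState`). The factor two
is `n₁ + n₂ ≤ 2 max n₁ n₂`. -/

namespace SwitchModel

noncomputable section

/-! ### Expectations under discrete laws -/

section Mean

variable {X Y : Type*}

/-- The expectation of an extended nonnegative function under a discrete law. -/
def mean (p : PMF X) (f : X → ℝ≥0∞) : ℝ≥0∞ := ∑' x, p x * f x

theorem mean_pure (x : X) (f : X → ℝ≥0∞) : mean (PMF.pure x) f = f x := by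
  classical
  unfold mean
  rw [tsum_eq_single x]
  · simp
  · intro y hy; simp [hy]

theorem mean_bind (p : PMF X) (K : X → PMF Y) (f : Y → ℝ≥0∞) :
    mean (p.bind K) f = mean p fun x => mean (K x) f := by
  simp only [mean, PMF.bind_apply, ← ENNReal.tsum_mul_left, ← ENNReal.tsum_mul_right]
  rw [ENNReal.tsum_comm]
  simp only [mul_assoc]

theorem mean_map (p : PMF X) (g : X → Y) (f : Y → ℝ≥0∞) :
    mean (p.map g) f = mean p fun x => f (g x) := by
  rw [← PMF.bind_pure_comp, mean_bind]
  simp only [Function.comp_apply, mean_pure]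

theorem mean_const (p : PMF X) (c : ℝ≥0∞) : mean p (fun _ => c) = c := by
  simp [mean, ENNReal.tsum_mul_right]

theorem mean_add (p : PMF X) (f g : X → ℝ≥0∞) :
    mean p (fun x => f x + g x) = mean p f + mean p g := by
  simp only [mean, mul_add, ENNReal.tsum_add]

theorem mean_const_mul (p : PMF X) (c : ℝ≥0∞) (f : X → ℝ≥0∞) :
    mean p (fun x => c * f x) = c * mean p f := by
  simp only [mean, ← ENNReal.tsum_mul_left]
  exact tsum_congr fun x => by ring

theorem mean_mono_support {p : PMF X} {f g : X → ℝ≥0∞} (h : ∀ x ∈ p.support, f x ≤ g x) :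
    mean p f ≤ mean p g := by
  refine ENNReal.tsum_le_tsum fun x => ?_
  by_cases hx : p x = 0
  · simp [hx]
  · gcongr; exact h x ((p.mem_support_iff x).2 hx)

theorem mean_mono {p : PMF X} {f g : X → ℝ≥0∞} (h : ∀ x, f x ≤ g x) : mean p f ≤ mean p g :=
  mean_mono_support fun x _ => h x

theorem mean_finset_sum {ι : Type*} (p : PMF X) (s : Finset ι) (f : ι → X → ℝ≥0∞) :
    mean p (fun x => ∑ i ∈ s, f i x) = ∑ i ∈ s, mean p (f i) := by
  classical
  induction s using Finset.induction_on with
  | empty => simp [mean]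
  | insert a s ha ih => simp only [Finset.sum_insert ha, mean_add, ih]

theorem lintegral_toMeasure_eq_mean [MeasurableSpace X] [MeasurableSingletonClass X] [Countable X]
    (p : PMF X) (f : X → ℝ≥0∞) : ∫⁻ x, f x ∂p.toMeasure = mean p f := by
  rw [lintegral_countable']
  refine tsum_congr fun x => ?_
  rw [PMF.toMeasure_apply_singleton p x (measurableSet_singleton x), mul_comm]

/-- Dominated convergence for the counting measure, with `p` itself as the dominating function; the
discrete σ-algebra removes all measurability questions. -/
theorem tendsto_mean_of_le_one (p : PMF X) (f : ℕ → X → ℝ≥0∞) (h1 : ∀ t x, f t x ≤ 1)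
    (h0 : ∀ x, Tendsto (fun t => f t x) atTop (𝓝 0)) :
    Tendsto (fun t => mean p (f t)) atTop (𝓝 0) := by
  let _ : MeasurableSpace X := ⊤
  have key : ∀ g : X → ℝ≥0∞, mean p g = ∫⁻ x, p x * g x ∂Measure.count := by
    intro g; rw [lintegral_count]; rfl
  simp only [key]
  have := tendsto_lintegral_of_dominated_convergence (μ := (Measure.count : Measure X))
    (F := fun t x => p x * f t x) (f := fun _ => 0) (fun x => p x)
    (fun t => measurable_from_top)
    (fun t => Eventually.of_forall fun x => by
      simpa using mul_le_mul_right (h1 t x) (p x))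
    (by rw [lintegral_count, p.tsum_coe]; simp)
    (Eventually.of_forall fun x => by
      simpa using ENNReal.Tendsto.const_mul (h0 x) (Or.inr (p.apply_ne_top x)))
  simpa using this

end Mean

/-! ### Markov chains: drift, invariant laws and coupling -/

section Chain

variable {X : Type*} (K : X → PMF X)

/-- The law after `t` steps of the Markov chain with transition law `K`, started at `x`. -/
def kernelPow : ℕ → X → PMF X
  | 0, x => PMF.pure x
  | t + 1, x => (K x).bind (kernelPow t)

theorem kernelPow_bind (t : ℕ) (x : X) : (kernelPow K t x).bind K = kernelPow K (t + 1) x := by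
  induction t generalizing x with
  | zero => simp [kernelPow, PMF.pure_bind, PMF.bind_pure]
  | succ t ih =>
    rw [kernelPow, PMF.bind_bind]
    conv_rhs => rw [kernelPow]
    congr 1
    funext y
    exact ih y

theorem bind_kernelPow_of_invariant {π : PMF X} (h : π.bind K = π) (t : ℕ) :
    π.bind (kernelPow K t) = π := by
  induction t with
  | zero =>
    have : kernelPow K 0 = PMF.pure := by funext x; rfl
    rw [this, PMF.bind_pure]
  | succ t ih =>
    have : kernelPow K (t + 1) = fun x => (K x).bind (kernelPow K t) := by funext x; rfl
    rw [this, ← PMF.bind_bind, h, ih]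

/-- The drift inequality telescopes. The term `mean V` at the final time is kept during the
induction because nothing may be subtracted in `[0, ∞]`. -/
theorem sum_mean_kernelPow_le {V f : X → ℝ≥0∞} {b : ℝ≥0∞}
    (h : ∀ x, mean (K x) V + f x ≤ V x + b) (T : ℕ) (x : X) :
    ∑ t ∈ Finset.range T, mean (kernelPow K t x) f ≤ V x + T * b := by
  suffices H : mean (kernelPow K T x) V + ∑ t ∈ Finset.range T, mean (kernelPow K t x) f
      ≤ V x + T * b from le_add_self.trans H
  induction T with
  | zero => simp [kernelPow, mean_pure]
  | succ T ih =>
    rw [Finset.sum_range_succ, ← kernelPow_bind, mean_bind]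
    have h1 : mean (kernelPow K T x) (fun y => mean (K y) V) + mean (kernelPow K T x) f
        ≤ mean (kernelPow K T x) V + b := by
      rw [← mean_add]
      refine (mean_mono h).trans ?_
      rw [mean_add, mean_const]
    calc _ = mean (kernelPow K T x) (fun y => mean (K y) V) + mean (kernelPow K T x) f
          + ∑ t ∈ Finset.range T, mean (kernelPow K t x) f := by ring
      _ ≤ mean (kernelPow K T x) V + b + ∑ t ∈ Finset.range T, mean (kernelPow K t x) f := by gcongr
      _ = (mean (kernelPow K T x) V + ∑ t ∈ Finset.range T, mean (kernelPow K t x) f) + b := by ring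
      _ ≤ V x + T * b + b := by gcongr
      _ = _ := by push_cast; ring

open Classical in
/-- The probability that two chains, moving independently until they meet, have not met by
time `t`. -/
def uncoupled : ℕ → X → X → ℝ≥0∞
  | 0, x, y => if x = y then 0 else 1
  | t + 1, x, y =>
    if x = y then 0 else mean (K x) fun x' => mean (K y) fun y' => uncoupled t x' y'

theorem uncoupled_self (t : ℕ) (x : X) : uncoupled K t x x = 0 := by
  cases t <;> simp [uncoupled]

theorem uncoupled_le_one (t : ℕ) (x y : X) : uncoupled K t x y ≤ 1 := by
  induction t generalizing x y with
  | zero => unfold uncoupled; split_ifs <;> simp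
  | succ t ih =>
    unfold uncoupled
    split_ifs
    · simp
    · refine (mean_mono fun x' => mean_mono fun y' => ih x' y').trans ?_
      simp [mean_const]

theorem uncoupled_succ_le (t : ℕ) (x y : X) : uncoupled K (t + 1) x y ≤ uncoupled K t x y := by
  induction t generalizing x y with
  | zero =>
    by_cases hxy : x = y
    · subst hxy; simp [uncoupled_self]
    · refine (uncoupled_le_one K _ x y).trans ?_
      simp [uncoupled, hxy]
  | succ t ih =>
    rw [uncoupled]
    conv_rhs => rw [uncoupled]
    split_ifs
    · exact le_rfl
    · exact mean_mono fun x' => mean_mono fun y' => ih x' y'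

/-- Coupling inequality: let the chains move independently until they meet and together afterwards.
The values of `f` can differ only if they have not met. -/
theorem mean_kernelPow_le_add_uncoupled {f : X → ℝ≥0∞} (hf : ∀ x, f x ≤ 1) (t : ℕ) (x y : X) :
    mean (kernelPow K t x) f ≤ mean (kernelPow K t y) f + uncoupled K t x y := by
  induction t generalizing x y with
  | zero =>
    by_cases hxy : x = y
    · subst hxy; simp
    · simp only [kernelPow, mean_pure, uncoupled, hxy, if_false]
      exact (hf x).trans le_add_self
  | succ t ih =>
    by_cases hxy : x = y
    · subst hxy; simp
    · simp only [kernelPow, mean_bind, uncoupled, hxy, if_false]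
      calc mean (K x) (fun x' => mean (kernelPow K t x') f)
          = mean (K x) fun x' => mean (K y) fun _ => mean (kernelPow K t x') f := by
            simp only [mean_const]
        _ ≤ mean (K x) fun x' => mean (K y) fun y' =>
              mean (kernelPow K t y') f + uncoupled K t x' y' :=
            mean_mono fun x' => mean_mono fun y' => ih x' y'
        _ = _ := by simp only [mean_add, mean_const]

/-- The sum of the probabilities of not having met is a truncated mean meeting time, and `W` pays
one unit for every step before the meeting. -/
theorem sum_uncoupled_le {W : X → X → ℝ≥0∞}
    (hW : ∀ x y, x ≠ y → (mean (K x) fun x' => mean (K y) fun y' => W x' y') + 1 ≤ W x y)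
    (T : ℕ) (x y : X) : ∑ t ∈ Finset.range T, uncoupled K t x y ≤ W x y := by
  induction T generalizing x y with
  | zero => simp
  | succ T ih =>
    by_cases hxy : x = y
    · subst hxy; simp [uncoupled_self]
    · rw [Finset.sum_range_succ']
      simp only [uncoupled, hxy, if_false]
      rw [← mean_finset_sum]
      simp only [← mean_finset_sum]
      refine le_trans ?_ (hW x y hxy)
      gcongr
      exact mean_mono fun x' => mean_mono fun y' => ih x' y'

/-- The probabilities decrease in `t` and their sums stay below `W`, so the `t`-th is at most `W /
t`. -/
theorem tendsto_uncoupled {W : X → X → ℝ≥0∞}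
    (hW : ∀ x y, x ≠ y → (mean (K x) fun x' => mean (K y) fun y' => W x' y') + 1 ≤ W x y)
    (hW' : ∀ x y, W x y ≠ ∞) (x y : X) :
    Tendsto (fun t => uncoupled K t x y) atTop (𝓝 0) := by
  have hanti : Antitone fun t => uncoupled K t x y :=
    antitone_nat_of_succ_le fun t => uncoupled_succ_le K t x y
  have hle : ∀ t : ℕ, uncoupled K t x y ≤ W x y / (t : ℝ≥0∞) := by
    intro t
    rcases Nat.eq_zero_or_pos t with rfl | ht
    · by_cases hxy : x = y
      · subst hxy; simp [uncoupled_self]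
      · have : W x y ≠ 0 := by
          intro h
          have := hW x y hxy
          rw [h] at this
          simp at this
        simp [ENNReal.div_zero this]
    · rw [ENNReal.le_div_iff_mul_le (Or.inl (by simp; omega)) (Or.inl (by simp))]
      calc uncoupled K t x y * t = ∑ _s ∈ Finset.range t, uncoupled K t x y := by
            simp [mul_comm]
        _ ≤ ∑ s ∈ Finset.range t, uncoupled K s x y :=
            Finset.sum_le_sum fun s hs => hanti (Finset.mem_range.1 hs).le
        _ ≤ W x y := sum_uncoupled_le K hW t x y
  refine tendsto_of_tendsto_of_tendsto_of_le_of_le tendsto_const_nhds ?_ (fun _ => zero_le) hle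
  exact ENNReal.Tendsto.const_div ENNReal.tendsto_nat_nhds_top (Or.inr (hW' x y)) |>.trans (by simp)

/-- If two chains meet almost surely, an invariant law attracts every initial law. -/
theorem mean_le_liminf_of_uncoupled {π : PMF X} (hπ : π.bind K = π)
    (hu : ∀ x y, Tendsto (fun t => uncoupled K t x y) atTop (𝓝 0)) (ν : PMF X)
    {f : X → ℝ≥0∞} (hf : ∀ x, f x ≤ 1) :
    mean π f ≤ liminf (fun t => mean (ν.bind (kernelPow K t)) f) atTop := by
  set e : ℕ → ℝ≥0∞ := fun t => mean π fun x => mean ν fun y => uncoupled K t x y with he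
  have he0 : Tendsto e atTop (𝓝 0) := by
    refine tendsto_mean_of_le_one π _ (fun t x => ?_) fun x => ?_
    · refine (mean_mono fun y => uncoupled_le_one K t x y).trans ?_
      simp [mean_const]
    · exact tendsto_mean_of_le_one ν _ (fun t y => uncoupled_le_one K t x y) (hu x)
  have hle : ∀ t, mean π f ≤ mean (ν.bind (kernelPow K t)) f + e t := by
    intro t
    calc mean π f = mean (π.bind (kernelPow K t)) f := by
          rw [bind_kernelPow_of_invariant K hπ]
      _ = mean π fun x => mean ν fun _ => mean (kernelPow K t x) f := by
          simp only [mean_bind, mean_const]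
      _ ≤ mean π fun x => mean ν fun y => mean (kernelPow K t y) f + uncoupled K t x y :=
          mean_mono fun x => mean_mono fun y => mean_kernelPow_le_add_uncoupled K hf t x y
      _ = _ := by simp only [mean_add, mean_const, mean_bind, he]
  have hsub : Tendsto (fun t => mean π f - e t) atTop (𝓝 (mean π f)) := by
    have h1 : mean π f ≠ ∞ :=
      ((mean_mono hf).trans_lt (by simp [mean_const])).ne
    simpa using ENNReal.Tendsto.sub (tendsto_const_nhds (x := mean π f)) he0 (Or.inl h1)
  rw [← hsub.liminf_eq]
  exact liminf_le_liminf (Eventually.of_forall fun t => tsub_le_iff_right.2 (hle t))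

/-- Both total masses are one, so no inequality can be strict. Invariance thus only needs to be
checked in one direction. -/
theorem PMF_eq_of_le {p q : PMF X} (h : ∀ x, p x ≤ q x) : p = q := by
  by_contra hne
  obtain ⟨x, hx⟩ : ∃ x, p x ≠ q x := by
    by_contra! hall
    exact hne (PMF.ext hall)
  have := ENNReal.tsum_lt_tsum (by rw [p.tsum_coe]; simp) h (lt_of_le_of_ne (h x) hx)
  rw [p.tsum_coe, q.tsum_coe] at this
  exact lt_irrefl _ this

/-- The average law over the first `T + 1` slots of the chain started at `x`. -/
def cesaro (x : X) (T : ℕ) (y : X) : ℝ≥0∞ :=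
  ((T : ℝ≥0∞) + 1)⁻¹ * ∑ t ∈ Finset.range (T + 1), kernelPow K t x y

theorem tsum_cesaro_mul (x : X) (T : ℕ) (f : X → ℝ≥0∞) :
    ∑' y, cesaro K x T y * f y
      = ((T : ℝ≥0∞) + 1)⁻¹ * ∑ t ∈ Finset.range (T + 1), mean (kernelPow K t x) f := by
  simp only [cesaro, mul_assoc, ENNReal.tsum_mul_left, Finset.sum_mul, mean]
  congr 1
  exact Summable.tsum_finsetSum fun _ _ => ENNReal.summable

theorem cesaro_weight_mul (T : ℕ) : ((T : ℝ≥0∞) + 1)⁻¹ * ((T + 1 : ℕ) : ℝ≥0∞) = 1 := by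
  push_cast
  exact ENNReal.inv_mul_cancel (by simp) (by simp)

theorem tsum_cesaro (x : X) (T : ℕ) : ∑' y, cesaro K x T y = 1 := by
  have := tsum_cesaro_mul K x T fun _ => 1
  simp only [mul_one, mean_const] at this
  rw [this]
  simp only [Finset.sum_const, Finset.card_range, nsmul_eq_mul, mul_one]
  exact cesaro_weight_mul T

theorem tsum_cesaro_mul_le {V f : X → ℝ≥0∞} {b : ℝ≥0∞}
    (h : ∀ x, mean (K x) V + f x ≤ V x + b) (x : X) (T : ℕ) :
    ∑' y, cesaro K x T y * f y ≤ ((T : ℝ≥0∞) + 1)⁻¹ * V x + b := by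
  rw [tsum_cesaro_mul]
  refine (mul_le_mul_right (sum_mean_kernelPow_le K h (T + 1) x) _).trans ?_
  rw [mul_add, ← mul_assoc, cesaro_weight_mul, one_mul]

/-- Fatou's lemma along an arbitrary filter: finite partial sums pass to the limit. Finiteness of
`f` makes multiplication by it continuous. -/
theorem tsum_mul_le_of_tendsto {ι : Type*} {l : Filter ι} [l.NeBot] {c : ι → X → ℝ≥0∞}
    {p f : X → ℝ≥0∞} {B : ι → ℝ≥0∞} {C : ℝ≥0∞} (hc : ∀ x, Tendsto (fun i => c i x) l (𝓝 (p x)))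
    (hf : ∀ x, f x ≠ ∞) (hB : ∀ i, ∑' x, c i x * f x ≤ B i) (hC : Tendsto B l (𝓝 C)) :
    ∑' x, p x * f x ≤ C := by
  rw [ENNReal.tsum_eq_iSup_sum]
  refine iSup_le fun F => le_of_tendsto_of_tendsto ?_ hC
    (Eventually.of_forall fun i => (ENNReal.sum_le_tsum F).trans (hB i))
  exact tendsto_finsetSum F fun x _ => ENNReal.Tendsto.mul_const (hc x) (Or.inr (hf x))

theorem tendsto_cesaro_weight_mul {c : ℝ≥0∞} (hc : c ≠ ∞) :
    Tendsto (fun T : ℕ => ((T : ℝ≥0∞) + 1)⁻¹ * c) atTop (𝓝 0) := by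
  have h1 : Tendsto (fun T : ℕ => ((T + 1 : ℕ) : ℝ≥0∞)⁻¹) atTop (𝓝 0) :=
    ENNReal.tendsto_inv_nat_nhds_zero.comp (tendsto_add_atTop_nat 1)
  have := ENNReal.Tendsto.mul_const (b := c) h1 (Or.inr hc)
  simpa using this

/-- Existence of an invariant law under a drift condition, together with the moment bounds that
drift conditions give for it. -/
theorem exists_invariant_of_drift {V f : X → ℝ≥0∞} {b : ℝ≥0∞} (hb : b ≠ ∞) (x₀ : X)
    (hV : V x₀ ≠ ∞) (h : ∀ x, mean (K x) V + f x ≤ V x + b)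
    (hfin : ∀ r : ℕ, {x | f x ≤ r}.Finite) :
    ∃ π : PMF X, π.bind K = π ∧
      ∀ (V' f' : X → ℝ≥0∞) (b' : ℝ≥0∞), V' x₀ ≠ ∞ → (∀ x, f' x ≠ ∞) →
        (∀ x, mean (K x) V' + f' x ≤ V' x + b') → mean π f' ≤ b' := by
  set c : ℕ → X → ℝ≥0∞ := cesaro K x₀ with hc
  -- Along an ultrafilter the time averages converge pointwise, because `X → ℝ≥0∞` is compact.
  set l : Filter ℕ := (hyperfilter ℕ : Filter ℕ) with hl
  have hl' : l ≤ atTop := Nat.hyperfilter_le_atTop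
  obtain ⟨p, hp⟩ : ∃ p : X → ℝ≥0∞, Tendsto c l (𝓝 p) :=
    ⟨_, ((hyperfilter ℕ).map c).le_nhds_lim⟩
  have hpx : ∀ x, Tendsto (fun T => c T x) l (𝓝 (p x)) := tendsto_pi_nhds.1 hp
  have hle : ∑' x, p x ≤ 1 := by
    have := tsum_mul_le_of_tendsto hpx (f := fun _ => 1) (B := fun _ => 1) (C := 1) (by simp)
      (fun T => by simp [hc, tsum_cesaro]) tendsto_const_nhds
    simpa using this
  have hge : 1 ≤ ∑' x, p x := by
    -- Tightness: by Markov's inequality the mass outside the finite set where `f ≤ r + 1` is at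
    -- most `(V x₀ + b) / (r + 1)`, uniformly in `T`, so no mass is lost in the limit.
    have hr : ∀ r : ℕ, 1 ≤ ∑' x, p x + ((r : ℝ≥0∞) + 1)⁻¹ * (V x₀ + b) := by
      intro r
      set F : Finset X := (hfin (r + 1)).toFinset with hF
      have h1 : ∀ T, 1 ≤ ∑ x ∈ F, c T x + ((r : ℝ≥0∞) + 1)⁻¹ * (V x₀ + b) := by
        classical
        intro T
        calc (1 : ℝ≥0∞) = ∑' x, c T x := (tsum_cesaro K x₀ T).symm
          _ ≤ ∑' x, ((if x ∈ F then c T x else 0) + ((r : ℝ≥0∞) + 1)⁻¹ * (c T x * f x)) := by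
              refine ENNReal.tsum_le_tsum fun x => ?_
              by_cases hx : x ∈ F
              · simp [hx]
              · have hx' : (r : ℝ≥0∞) + 1 ≤ f x := by
                  have : ¬ f x ≤ ((r + 1 : ℕ) : ℝ≥0∞) := by simpa [hF] using hx
                  push_cast at this
                  exact (not_le.1 this).le
                simp only [hx, if_false, zero_add]
                calc c T x = ((r : ℝ≥0∞) + 1)⁻¹ * (c T x * ((r : ℝ≥0∞) + 1)) := by
                      rw [mul_comm (c T x), ← mul_assoc,
                        ENNReal.inv_mul_cancel (by simp) (by simp), one_mul]
                  _ ≤ _ := by gcongr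
          _ = ∑ x ∈ F, c T x + ((r : ℝ≥0∞) + 1)⁻¹ * ∑' x, c T x * f x := by
              rw [ENNReal.tsum_add, ENNReal.tsum_mul_left]
              congr 1
              rw [tsum_eq_sum (s := F) (fun x hx => by simp [hx])]
              exact Finset.sum_congr rfl fun x hx => by simp [hx]
          _ ≤ _ := by
              gcongr
              refine (tsum_cesaro_mul_le K h x₀ T).trans ?_
              gcongr
              refine (mul_le_mul_left (ENNReal.inv_le_one.2 (by simp)) _).trans ?_
              simp
      refine (ge_of_tendsto ((tendsto_finsetSum F fun x _ => hpx x).add tendsto_const_nhds)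
        (Eventually.of_forall h1)).trans ?_
      gcongr
      exact ENNReal.sum_le_tsum F
    have ht := (tendsto_const_nhds (x := ∑' x, p x)).add
      (tendsto_cesaro_weight_mul (ENNReal.add_ne_top.2 ⟨hV, hb⟩))
    rw [add_zero] at ht
    exact ge_of_tendsto ht (Eventually.of_forall hr)
  set π : PMF X := ⟨p, (le_antisymm hle hge) ▸ ENNReal.summable.hasSum⟩ with hπ
  refine ⟨π, PMF_eq_of_le fun y => ?_, fun V' f' b' hV' hf' h' => ?_⟩
  · rw [PMF.bind_apply]
    -- One step of the chain shifts the time average by one slot, at the cost of a boundary term of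
    -- at most `1 / (T + 1)`.
    refine tsum_mul_le_of_tendsto (B := fun T => c T y + ((T : ℝ≥0∞) + 1)⁻¹ * 1) hpx
      (fun x => (K x).apply_ne_top y) (fun T => ?_) ?_
    · rw [hc, tsum_cesaro_mul, cesaro, ← mul_add]
      gcongr
      have : ∀ t, mean (kernelPow K t x₀) (fun x => K x y) = kernelPow K (t + 1) x₀ y := by
        intro t
        rw [← kernelPow_bind, PMF.bind_apply, mean]
      simp only [this]
      rw [Finset.sum_range_succ, Finset.sum_range_succ']
      calc _ ≤ ∑ t ∈ Finset.range T, kernelPow K (t + 1) x₀ y + 1 := by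
            gcongr; exact PMF.coe_le_one _ _
        _ ≤ _ := by gcongr; exact le_self_add
    · have := (hpx y).add ((tendsto_cesaro_weight_mul ENNReal.one_ne_top).mono_left hl')
      change Tendsto _ l (𝓝 (p y))
      simpa using this
  · refine tsum_mul_le_of_tendsto hpx hf' (fun T => tsum_cesaro_mul_le K h' x₀ T) ?_
    have := ((tendsto_cesaro_weight_mul hV').mono_left hl').add (tendsto_const_nhds (x := b'))
    simpa using this

/-- Auxiliary weights for the coupling of two chains: `couplingWeight D σ j` bounds the cost of the
last `j` levels when each level is left downwards with probability `σ`. -/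
def couplingWeight (D σ : ℝ) : ℕ → ℝ
  | 0 => 0
  | j + 1 => (couplingWeight D σ j + D) / σ

theorem couplingWeight_nonneg {D σ : ℝ} (hD : 0 ≤ D) (hσ : 0 < σ) (j : ℕ) :
    0 ≤ couplingWeight D σ j := by
  induction j with
  | zero => exact le_rfl
  | succ j ih => unfold couplingWeight; positivity

theorem couplingWeight_mono {D σ : ℝ} (hD : 0 ≤ D) (hσ : 0 < σ) (hσ1 : σ ≤ 1) :
    Monotone (couplingWeight D σ) := by
  refine monotone_nat_of_le_succ fun j => ?_
  rw [couplingWeight, le_div_iff₀ hσ]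
  nlinarith [couplingWeight_nonneg hD hσ j]

/-- Two chains meet almost surely if a drift function controls the level `ℓ` and from every state
the level drops with probability at least `ρ`, the state of level zero being unique. -/
theorem tendsto_uncoupled_of_drift {V f : X → ℝ≥0∞} {b : ℝ} {ℓ : X → ℕ} {ρ : ℝ}
    (hV : ∀ x, V x ≠ ∞) (h : ∀ x, mean (K x) V + f x ≤ V x + ENNReal.ofReal b)
    (hb : 0 ≤ b) {R : ℕ} (hR : ∀ x, ℓ x ≤ R ∨ ENNReal.ofReal (2 * b + 1) ≤ f x)
    (hρ : 0 < ρ) (hρ1 : ρ ≤ 1)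
    (hdown : ∀ x, ENNReal.ofReal ρ ≤ mean (K x) fun x' => if ℓ x' ≤ ℓ x - 1 then 1 else 0)
    (hzero : ∀ x y, ℓ x = 0 → ℓ y = 0 → x = y) (x y : X) :
    Tendsto (fun t => uncoupled K t x y) atTop (𝓝 0) := by
  set D : ℝ := 2 * b + 1 with hD
  set σ : ℝ := ρ * ρ with hσ
  have hD0 : 0 ≤ D := by positivity
  have hσ0 : 0 < σ := by positivity
  have hσ1 : σ ≤ 1 := mul_le_one₀ hρ1 hρ.le hρ1
  set χ := couplingWeight D σ with hχ
  have hmono : Monotone χ := couplingWeight_mono hD0 hσ0 hσ1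
  set S : ℝ := χ R with hS
  -- A penalty for the larger of the two levels: nondecreasing, and equal to `S` from level `R` on
  -- because `χ 0 = 0`.
  set Z : ℕ → ℝ≥0∞ := fun k => ENNReal.ofReal (S - χ (R - k)) with hZ
  have hZS : ∀ k, Z k ≤ ENNReal.ofReal S := fun k => ENNReal.ofReal_le_ofReal (by
    linarith [couplingWeight_nonneg hD0 hσ0 (R - k)])
  have hZmono : Monotone Z := fun j k hjk => ENNReal.ofReal_le_ofReal (by
    linarith [hmono (Nat.sub_le_sub_left hjk R)])
  have hmm : ∀ (x y : X) (c : X → X → ℝ≥0∞) (B : ℝ≥0∞), (∀ x' y', c x' y' ≤ B) →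
      (mean (K x) fun x' => mean (K y) fun y' => c x' y') ≤ B := by
    intro x y c B hc
    refine (mean_mono fun x' => mean_mono fun y' => hc x' y').trans ?_
    simp [mean_const]
  set W : X → X → ℝ≥0∞ := fun x y => V x + V y + Z (max (ℓ x) (ℓ y)) with hW
  refine tendsto_uncoupled K (W := W) (fun x y hxy => ?_) (fun x y => ?_) x y
  · have hVV : (mean (K x) fun x' => mean (K y) fun y' => W x' y')
        = mean (K x) V + mean (K y) V
          + mean (K x) fun x' => mean (K y) fun y' => Z (max (ℓ x') (ℓ y')) := by
      simp only [hW, mean_add, mean_const]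
    rw [hVV]
    set mZ := mean (K x) fun x' => mean (K y) fun y' => Z (max (ℓ x') (ℓ y')) with hmZ
    have hsum : mean (K x) V + mean (K y) V + (f x + f y)
        ≤ V x + V y + ENNReal.ofReal (2 * b) := by
      calc _ = (mean (K x) V + f x) + (mean (K y) V + f y) := by ring
        _ ≤ (V x + ENNReal.ofReal b) + (V y + ENNReal.ofReal b) := add_le_add (h x) (h y)
        _ = V x + V y + (ENNReal.ofReal b + ENNReal.ofReal b) := by ring
        _ = _ := by rw [← ENNReal.ofReal_add hb hb, two_mul]
    have hDsplit : ENNReal.ofReal D = ENNReal.ofReal (2 * b) + 1 := by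
      rw [hD, ENNReal.ofReal_add (by positivity) zero_le_one, ENNReal.ofReal_one]
    by_cases hk : max (ℓ x) (ℓ y) ≤ R
    · have hk0 : 1 ≤ max (ℓ x) (ℓ y) := by
        by_contra hlt
        exact hxy (hzero x y (by omega) (by omega))
      set k := max (ℓ x) (ℓ y) with hkdef
      -- With probability at least `σ = ρ * ρ` both chains drop, and then the larger level is at
      -- most `k - 1`; in all other cases the penalty is at most `S`.
      have h1 : mZ + ENNReal.ofReal σ * (ENNReal.ofReal S - Z (k - 1)) ≤ ENNReal.ofReal S := by
        have hG : ENNReal.ofReal σ ≤ mean (K x) fun x' => mean (K y) fun y' =>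
            (if ℓ x' ≤ ℓ x - 1 then 1 else 0) * (if ℓ y' ≤ ℓ y - 1 then (1 : ℝ≥0∞) else 0) := by
          simp only [mean_const_mul]
          simp only [mul_comm _ (mean (K y) _), mean_const_mul]
          rw [hσ, ENNReal.ofReal_mul hρ.le]
          exact mul_le_mul' (hdown y) (hdown x)
        calc _ ≤ mZ + (ENNReal.ofReal S - Z (k - 1)) * mean (K x) fun x' => mean (K y) fun y' =>
            (if ℓ x' ≤ ℓ x - 1 then 1 else 0) * (if ℓ y' ≤ ℓ y - 1 then (1 : ℝ≥0∞) else 0) := by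
              rw [mul_comm]; gcongr
          _ = mean (K x) fun x' => mean (K y) fun y' => Z (max (ℓ x') (ℓ y')) +
              (ENNReal.ofReal S - Z (k - 1)) *
                ((if ℓ x' ≤ ℓ x - 1 then 1 else 0) *
                  (if ℓ y' ≤ ℓ y - 1 then (1 : ℝ≥0∞) else 0)) := by
              simp only [mean_const_mul, mean_add, hmZ]
          _ ≤ ENNReal.ofReal S := by
              refine hmm x y _ _ fun x' y' => ?_
              by_cases hx' : ℓ x' ≤ ℓ x - 1 <;> by_cases hy' : ℓ y' ≤ ℓ y - 1
              · simp only [hx', hy', if_true, mul_one]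
                have : Z (max (ℓ x') (ℓ y')) ≤ Z (k - 1) := hZmono (by omega)
                calc _ ≤ Z (k - 1) + (ENNReal.ofReal S - Z (k - 1)) := by gcongr
                  _ = _ := add_tsub_cancel_of_le (hZS _)
              all_goals simp [hx', hy', hZS]
      -- The recursion `σ χ(j+1) = χ(j) + D` turns this into an equality. The penalty therefore
      -- falls by `D = 2 b + 1` in the mean, which pays for the two drift constants `b` and for the
      -- unit required by `tendsto_uncoupled`.
      have h2 : ENNReal.ofReal S + ENNReal.ofReal D
          ≤ Z k + ENNReal.ofReal σ * (ENNReal.ofReal S - Z (k - 1)) := by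
        have hS0 : 0 ≤ S := couplingWeight_nonneg hD0 hσ0 R
        have hz0 : ∀ j, 0 ≤ S - χ (R - j) := fun j => by linarith [hmono (Nat.sub_le R j)]
        have hc0 := couplingWeight_nonneg hD0 hσ0 (R - (k - 1))
        rw [hZ]
        dsimp only
        rw [← ENNReal.ofReal_sub _ (hz0 _), ← ENNReal.ofReal_mul hσ0.le,
          ← ENNReal.ofReal_add hS0 hD0, ← ENNReal.ofReal_add (hz0 _) (by
            rw [sub_sub_cancel]; exact mul_nonneg hσ0.le hc0)]
        refine ENNReal.ofReal_le_ofReal ?_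
        have hidx : R - (k - 1) = (R - k) + 1 := by omega
        have hrec : σ * χ (R - (k - 1)) = χ (R - k) + D := by
          rw [hidx, hχ, couplingWeight]
          field_simp
        rw [sub_sub_cancel, hrec]
        linarith
      have h3 : mZ + ENNReal.ofReal D ≤ Z k := by
        have hfin : ENNReal.ofReal σ * (ENNReal.ofReal S - Z (k - 1)) ≠ ∞ :=
          ENNReal.mul_ne_top ENNReal.ofReal_ne_top (ENNReal.sub_ne_top ENNReal.ofReal_ne_top)
        refine (ENNReal.add_le_add_iff_right hfin).1 ?_
        refine le_trans ?_ h2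
        calc _ = (mZ + ENNReal.ofReal σ * (ENNReal.ofReal S - Z (k - 1))) + ENNReal.ofReal D := by
              ring
          _ ≤ _ := by gcongr
      calc mean (K x) V + mean (K y) V + mZ + 1
          ≤ (mean (K x) V + mean (K y) V + (f x + f y)) + mZ + 1 := by
            gcongr ?_ + _ + _; exact le_self_add
        _ ≤ (V x + V y + ENNReal.ofReal (2 * b)) + mZ + 1 := by gcongr
        _ = V x + V y + (mZ + ENNReal.ofReal D) := by rw [hDsplit]; ring
        _ ≤ _ := by rw [hW]; dsimp only; gcongr
    · have hf : ENNReal.ofReal D ≤ f x + f y := by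
        rcases le_max_iff.1 (not_le.1 hk).le with hx | hx
        · rcases lt_or_eq_of_le hx with hx | hx
          · exact ((hR x).resolve_left (by omega)).trans le_self_add
          · exact ((hR y).resolve_left (by omega)).trans le_add_self
        · rcases lt_or_eq_of_le hx with hx | hx
          · exact ((hR y).resolve_left (by omega)).trans le_add_self
          · exact ((hR x).resolve_left (by omega)).trans le_self_add
      have hmZS : mZ ≤ Z (max (ℓ x) (ℓ y)) := by
        have : Z (max (ℓ x) (ℓ y)) = ENNReal.ofReal S := by
          have h0 : R - max (ℓ x) (ℓ y) = 0 := by omega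
          simp only [hZ, h0]
          simp [hχ, couplingWeight]
        rw [this]
        exact hmm x y _ _ fun x' y' => hZS _
      have h4 : mean (K x) V + mean (K y) V + 1 ≤ V x + V y := by
        refine (ENNReal.add_le_add_iff_right
          (ENNReal.ofReal_ne_top (r := 2 * b))).1 (le_trans ?_ hsum)
        calc _ = mean (K x) V + mean (K y) V + ENNReal.ofReal D := by rw [hDsplit]; ring
          _ ≤ _ := by gcongr
      calc _ = (mean (K x) V + mean (K y) V + 1) + mZ := by ring
        _ ≤ _ := add_le_add h4 hmZS
  · exact ENNReal.add_ne_top.2 ⟨ENNReal.add_ne_top.2 ⟨hV x, hV y⟩, ENNReal.ofReal_ne_top⟩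

end Chain

/-! ### Moments of the Bernoulli arrivals -/

section Arrivals

variable {n : ℕ}

/-- The probability of an arrival pattern, as a real number. -/
def arrivalWeight (lam : Fin n → Fin n → ℝ) (a : Fin n → Fin n → Bool) : ℝ :=
  ∏ i, ∏ j, if a i j then lam i j else 1 - lam i j

/-- The expectation of a real function of the arrivals of one slot. -/
def arrivalMean (lam : Fin n → Fin n → ℝ) : ((Fin n → Fin n → Bool) → ℝ) →ₗ[ℝ] ℝ where
  toFun F := ∑ a, arrivalWeight lam a * F a
  map_add' F G := by simp [mul_add, Finset.sum_add_distrib]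
  map_smul' c F := by simp [Finset.mul_sum, mul_left_comm]

theorem arrivalMean_apply (lam : Fin n → Fin n → ℝ) (F : (Fin n → Fin n → Bool) → ℝ) :
    arrivalMean lam F = ∑ a, arrivalWeight lam a * F a := rfl

/-- Independence of the entries. As a polynomial identity, obtained by distributing products over
sums first in each row and then over the rows, it holds for all real `lam`. -/
theorem arrivalMean_prod (lam : Fin n → Fin n → ℝ) (φ : Fin n → Fin n → Bool → ℝ) :
    arrivalMean lam (fun a => ∏ i, ∏ j, φ i j (a i j))
      = ∏ i, ∏ j, (lam i j * φ i j true + (1 - lam i j) * φ i j false) := by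
  have h : ∀ i : Fin n, ∑ r : Fin n → Bool,
      ∏ j, (if r j then lam i j else 1 - lam i j) * φ i j (r j)
      = ∏ j, (lam i j * φ i j true + (1 - lam i j) * φ i j false) := by
    intro i
    rw [← Fintype.prod_sum (fun (j : Fin n) (b : Bool) =>
      (if b then lam i j else 1 - lam i j) * φ i j b)]
    simp
  simp only [arrivalMean_apply, arrivalWeight, ← Finset.prod_mul_distrib]
  rw [← Fintype.prod_sum (fun (i : Fin n) (r : Fin n → Bool) =>
    ∏ j, (if r j then lam i j else 1 - lam i j) * φ i j (r j))]
  exact Finset.prod_congr rfl fun i _ => h i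

theorem arrivalMean_const (lam : Fin n → Fin n → ℝ) (c : ℝ) :
    arrivalMean lam (fun _ => c) = c := by
  have h := arrivalMean_prod lam fun _ _ _ => 1
  simp only [Finset.prod_const_one, mul_one, add_sub_cancel] at h
  have : (fun _ : Fin n → Fin n → Bool => c) = c • fun _ => (1 : ℝ) := by funext; simp
  rw [this, map_smul, h]
  simp

theorem arrivalWeight_nonneg {lam : Fin n → Fin n → ℝ} (h0 : ∀ i j, 0 ≤ lam i j)
    (h1 : ∀ i j, lam i j ≤ 1) (a : Fin n → Fin n → Bool) : 0 ≤ arrivalWeight lam a := by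
  refine Finset.prod_nonneg fun i _ => Finset.prod_nonneg fun j _ => ?_
  split_ifs
  · exact h0 i j
  · linarith [h1 i j]

theorem arrivalMean_mono {lam : Fin n → Fin n → ℝ} (h0 : ∀ i j, 0 ≤ lam i j)
    (h1 : ∀ i j, lam i j ≤ 1) {F G : (Fin n → Fin n → Bool) → ℝ} (h : ∀ a, F a ≤ G a) :
    arrivalMean lam F ≤ arrivalMean lam G :=
  Finset.sum_le_sum fun a _ => mul_le_mul_of_nonneg_left (h a) (arrivalWeight_nonneg h0 h1 a)

theorem arrivalLaw_apply {lam : Fin n → Fin n → ℝ} (h0 : ∀ i j, 0 ≤ lam i j)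
    (h1 : ∀ i j, lam i j ≤ 1) (a : Fin n → Fin n → Bool) :
    arrivalLaw lam a = ENNReal.ofReal (arrivalWeight lam a) := by
  have hp : ∀ i j, prob (lam i j) = ENNReal.ofReal (lam i j) := fun i j =>
    min_eq_right (by simpa using h1 i j)
  have hf : ∀ i j, 0 ≤ (if a i j then lam i j else 1 - lam i j) := by
    intro i j
    split_ifs
    · exact h0 i j
    · linarith [h1 i j]
  rw [arrivalLaw, PMF.ofFintype_apply, arrivalWeight,
    ENNReal.ofReal_prod_of_nonneg fun i _ => Finset.prod_nonneg fun j _ => hf i j]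
  refine Finset.prod_congr rfl fun i _ => ?_
  rw [ENNReal.ofReal_prod_of_nonneg fun j _ => hf i j]
  refine Finset.prod_congr rfl fun j _ => ?_
  split_ifs
  · exact hp i j
  · rw [hp, ENNReal.ofReal_sub _ (h0 i j), ENNReal.ofReal_one]

theorem mean_arrivalLaw {lam : Fin n → Fin n → ℝ} (h0 : ∀ i j, 0 ≤ lam i j)
    (h1 : ∀ i j, lam i j ≤ 1) {F : (Fin n → Fin n → Bool) → ℝ} (hF : ∀ a, 0 ≤ F a) :
    mean (arrivalLaw lam) (fun a => ENNReal.ofReal (F a)) = ENNReal.ofReal (arrivalMean lam F) := by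
  rw [mean, tsum_fintype, arrivalMean_apply, ENNReal.ofReal_sum_of_nonneg fun a _ =>
    mul_nonneg (arrivalWeight_nonneg h0 h1 a) (hF a)]
  refine Finset.sum_congr rfl fun a _ => ?_
  rw [arrivalLaw_apply h0 h1, ENNReal.ofReal_mul (arrivalWeight_nonneg h0 h1 a)]

/-- The number of arrivals, zero or one, at queue `x`. -/
def arrivalCount (a : Fin n → Fin n → Bool) (x : Fin n × Fin n) : ℝ := ((a x.1 x.2).toNat : ℝ)

theorem arrivalMean_mul (lam : Fin n → Fin n → ℝ) (g : Fin n × Fin n → Bool → ℝ) :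
    arrivalMean lam (fun a => ∏ x, g x (a x.1 x.2))
      = ∏ x : Fin n × Fin n, (lam x.1 x.2 * g x true + (1 - lam x.1 x.2) * g x false) := by
  have := arrivalMean_prod lam fun i j => g (i, j)
  simp only [Fintype.prod_prod_type]
  exact this

theorem arrivalMean_arrivalCount (lam : Fin n → Fin n → ℝ) (x : Fin n × Fin n) :
    arrivalMean lam (fun a => arrivalCount a x) = lam x.1 x.2 := by
  have := arrivalMean_mul lam fun y b => if y = x then ((b.toNat : ℕ) : ℝ) else 1
  simp only [Finset.prod_ite_eq', Finset.mem_univ, if_true] at this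
  unfold arrivalCount
  rw [this, Finset.prod_eq_single x]
  · simp
  · intro y _ hy; simp [hy]
  · simp

/-- The arrivals are uncorrelated, with Bernoulli variances. -/
theorem arrivalMean_covariance (lam : Fin n → Fin n → ℝ) (x y : Fin n × Fin n) :
    arrivalMean lam (fun a => (arrivalCount a x - lam x.1 x.2) * (arrivalCount a y - lam y.1 y.2))
      = if x = y then lam x.1 x.2 * (1 - lam x.1 x.2) else 0 := by
  have := arrivalMean_mul lam fun z b =>
    (if z = x then ((b.toNat : ℕ) : ℝ) - lam x.1 x.2 else 1) *
      (if z = y then ((b.toNat : ℕ) : ℝ) - lam y.1 y.2 else 1)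
  simp only [Finset.prod_mul_distrib, Finset.prod_ite_eq', Finset.mem_univ, if_true] at this
  unfold arrivalCount
  rw [this]
  split_ifs with hxy
  · subst hxy
    rw [Finset.prod_eq_single x]
    · simp; ring
    · intro z _ hz; simp [hz]
    · simp
  · refine Finset.prod_eq_zero (Finset.mem_univ x) ?_
    simp [hxy]; ring

theorem arrivalMean_sum_mul_arrivalCount (lam : Fin n → Fin n → ℝ) (c : Fin n × Fin n → ℝ) :
    arrivalMean lam (fun a => ∑ x, c x * arrivalCount a x) = ∑ x, c x * lam x.1 x.2 := by
  have : (fun a : Fin n → Fin n → Bool => ∑ x, c x * arrivalCount a x)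
      = ∑ x, c x • fun a => arrivalCount a x := by funext a; simp
  rw [this, map_sum]
  refine Finset.sum_congr rfl fun x _ => ?_
  rw [map_smul, arrivalMean_arrivalCount, smul_eq_mul]

/-- Only the diagonal of `Q` survives, the arrivals being uncorrelated. Through this the trace of a
projection will enter. -/
theorem arrivalMean_quadratic (lam : Fin n → Fin n → ℝ) (Q : Fin n × Fin n → Fin n × Fin n → ℝ) :
    arrivalMean lam (fun a => ∑ x, ∑ y, Q x y *
        ((arrivalCount a x - lam x.1 x.2) * (arrivalCount a y - lam y.1 y.2)))
      = ∑ x : Fin n × Fin n, Q x x * (lam x.1 x.2 * (1 - lam x.1 x.2)) := by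
  have : (fun a : Fin n → Fin n → Bool => ∑ x, ∑ y, Q x y *
        ((arrivalCount a x - lam x.1 x.2) * (arrivalCount a y - lam y.1 y.2)))
      = ∑ x, ∑ y, Q x y • fun a =>
        (arrivalCount a x - lam x.1 x.2) * (arrivalCount a y - lam y.1 y.2) := by funext a; simp
  rw [this]
  simp only [map_sum, map_smul, arrivalMean_covariance, smul_eq_mul, mul_ite, mul_zero,
    Finset.sum_ite_eq, Finset.mem_univ, if_true]

end Arrivals

/-! ### The law of the queue lengths -/

section QueueLaw

variable {n : ℕ}

theorem meanTotal_eq_mean (π : PMF (QueueMatrix n)) :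
    meanTotal π = mean π fun q => ∑ i, ∑ j, (q i j : ℝ≥0∞) :=
  lintegral_toMeasure_eq_mean π _

theorem mean_queueLaw (P : Policy n) (lam : Fin n → Fin n → ℝ) (init : PMF (QueueMatrix n)) (t : ℕ)
    (f : QueueMatrix n → ℝ≥0∞) :
    mean (queueLaw P lam init t) f = mean (trajectoryLaw P lam init t) fun x => f x.2 :=
  mean_map _ _ _

theorem mean_trajectoryLaw_succ (P : Policy n) (lam : Fin n → Fin n → ℝ)
    (init : PMF (QueueMatrix n)) (t : ℕ) (f : QueueMatrix n → ℝ≥0∞) :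
    mean (trajectoryLaw P lam init (t + 1)) (fun x => f x.2)
      = mean (trajectoryLaw P lam init t) fun x => mean (P x.1 x.2) fun s =>
          mean (arrivalLaw lam) fun a => f (nextQueue x.2 a s) := by
  simp only [trajectoryLaw, mean_bind, step, mean_map]

/-- The space of queue matrices is discrete, so every bounded function is an admissible test
function. -/
theorem ConvergesInLaw.tendsto_mean {P : Policy n} {lam : Fin n → Fin n → ℝ}
    {init π : PMF (QueueMatrix n)} (h : ConvergesInLaw P lam init π) (f : QueueMatrix n → ℕ)
    {C : ℕ} (hf : ∀ q, f q ≤ C) :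
    Tendsto (fun t => mean (queueLaw P lam init t) fun q => (f q : ℝ≥0∞)) atTop
      (𝓝 (mean π fun q => (f q : ℝ≥0∞))) := by
  have := ProbabilityMeasure.tendsto_iff_forall_lintegral_tendsto.1 h
    (BoundedContinuousFunction.mkOfBound ⟨fun q => (f q : NNReal), continuous_of_discreteTopology⟩ C
      (fun x y => by
        have hx : ((f x : ℕ) : ℝ) ≤ C := by exact_mod_cast hf x
        have hy : ((f y : ℕ) : ℝ) ≤ C := by exact_mod_cast hf y
        simp only [NNReal.dist_eq, ContinuousMap.coe_mk, NNReal.coe_natCast]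
        rw [abs_le]
        constructor <;> linarith [Nat.cast_nonneg (α := ℝ) (f x), Nat.cast_nonneg (α := ℝ) (f y)]))
  simp only [BoundedContinuousFunction.mkOfBound_coe, ContinuousMap.coe_mk,
    ENNReal.coe_natCast] at this
  have hl : ∀ p : PMF (QueueMatrix n), ∫⁻ q, (f q : ℝ≥0∞) ∂(toProbabilityMeasure p : Measure _)
      = mean p fun q => (f q : ℝ≥0∞) := fun p => lintegral_toMeasure_eq_mean p _
  simpa only [hl] using this

end QueueLaw

/-! ### The lower bound: comparison with a single-server queue -/

section SingleServer

variable {n : ℕ} (lam : Fin n → Fin n → ℝ) (p : Fin n → Fin n × Fin n)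

/-- The number of arrivals in one slot to the queues of a port. -/
def portArrivals (a : Fin n → Fin n → Bool) : ℕ := ∑ k, (a (p k).1 (p k).2).toNat

/-- The number of packets in the queues of a port. -/
def portQueue (q : QueueMatrix n) : ℕ := ∑ k, q (p k).1 (p k).2

/-- One slot of the single-server queue fed by the arrivals to a port, acting on functions. -/
def lindley (h : ℕ → ℝ≥0∞) (r : ℕ) : ℝ≥0∞ :=
  mean (arrivalLaw lam) fun a => h (r + portArrivals p a - 1)

theorem lindley_monotone {h : ℕ → ℝ≥0∞} (hh : Monotone h) : Monotone (lindley lam p h) :=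
  fun r s hrs => mean_mono fun a => hh (by omega)

theorem lindley_iterate_monotone {h : ℕ → ℝ≥0∞} (hh : Monotone h) (t : ℕ) :
    Monotone ((lindley lam p)^[t] h) := by
  induction t with
  | zero => exact hh
  | succ t ih => rw [Function.iterate_succ_apply']; exact lindley_monotone lam p ih

/-- The empty queue is the lowest state, so after one slot the queue dominates it; the monotone
operator `lindley` propagates this to all times. -/
theorem lindley_iterate_zero_monotone {h : ℕ → ℝ≥0∞} (hh : Monotone h) :
    Monotone fun t => (lindley lam p)^[t] h 0 := by
  refine monotone_nat_of_le_succ fun t => ?_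
  rw [Function.iterate_succ_apply']
  calc (lindley lam p)^[t] h 0 = mean (arrivalLaw lam) fun _ => (lindley lam p)^[t] h 0 :=
        (mean_const _ _).symm
    _ ≤ _ := mean_mono fun a => lindley_iterate_monotone lam p hh t (Nat.zero_le _)

theorem portArrivals_le (a : Fin n → Fin n → Bool) : portArrivals p a ≤ n := by
  calc portArrivals p a ≤ ∑ _k : Fin n, 1 := Finset.sum_le_sum fun k _ => Bool.toNat_le _
    _ = n := by simp

/-- At most `n` packets arrive per slot, so within `t` slots the values of `h` beyond `B` are never
seen. -/
theorem lindley_iterate_congr {h g : ℕ → ℝ≥0∞} (t : ℕ) {B : ℕ} (hhg : ∀ r ≤ B, h r = g r) (r : ℕ)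
    (hr : r + t * n ≤ B) : (lindley lam p)^[t] h r = (lindley lam p)^[t] g r := by
  induction t generalizing r with
  | zero => exact hhg r (by simpa using hr)
  | succ t ih =>
    simp only [Function.iterate_succ_apply']
    unfold lindley
    congr 1
    funext a
    refine ih _ ?_
    have := portArrivals_le p a
    rw [Nat.succ_mul] at hr
    omega

theorem le_portQueue_nextQueue (hs : ∀ s : Schedule n, ∑ k, s.1 (p k).1 (p k).2 ≤ 1)
    (q : QueueMatrix n) (a : Fin n → Fin n → Bool) (s : Schedule n) :
    portQueue p q + portArrivals p a - 1 ≤ portQueue p (nextQueue q a s) := by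
  have h : portQueue p q + portArrivals p a
      ≤ portQueue p (nextQueue q a s) + ∑ k, s.1 (p k).1 (p k).2 := by
    simp only [portQueue, portArrivals, ← Finset.sum_add_distrib, nextQueue]
    exact Finset.sum_le_sum fun k _ => by omega
  have := hs s
  omega

/-- Under every policy a port holds at least as many packets as a single-server queue with the same
arrivals. -/
theorem lindley_iterate_le_mean_queueLaw
    (hs : ∀ s : Schedule n, ∑ k, s.1 (p k).1 (p k).2 ≤ 1) (P : Policy n)
    (init : PMF (QueueMatrix n)) (t : ℕ) {h : ℕ → ℝ≥0∞} (hh : Monotone h) :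
    (lindley lam p)^[t] h 0 ≤ mean (queueLaw P lam init t) fun q => h (portQueue p q) := by
  rw [mean_queueLaw]
  induction t generalizing h with
  | zero =>
    calc h 0 = mean (trajectoryLaw P lam init 0) fun _ => h 0 := (mean_const _ _).symm
      _ ≤ _ := mean_mono fun x => hh (Nat.zero_le _)
  | succ t ih =>
    rw [mean_trajectoryLaw_succ P lam init t fun q => h (portQueue p q), Function.iterate_succ_apply]
    refine (ih (lindley_monotone lam p hh)).trans (mean_mono fun x => ?_)
    calc lindley lam p h (portQueue p x.2)
        = mean (P x.1 x.2) fun _ => lindley lam p h (portQueue p x.2) := (mean_const _ _).symm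
      _ ≤ _ := mean_mono fun s => mean_mono fun a => hh (le_portQueue_nextQueue p hs _ _ _)

/-- Convergence in law controls bounded functions only. Truncation at `t * n` does not affect the
`t`-th iterate at `0`, and monotonicity in time extends the truncated bound to all later times, so
that it passes to the limit. -/
theorem lindley_iterate_le_mean (hs : ∀ s : Schedule n, ∑ k, s.1 (p k).1 (p k).2 ≤ 1)
    {P : Policy n} {init π : PMF (QueueMatrix n)} (hπ : ConvergesInLaw P lam init π) (t : ℕ) :
    (lindley lam p)^[t] (fun r => (r : ℝ≥0∞)) 0 ≤ mean π fun q => (portQueue p q : ℝ≥0∞) := by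
  set B := t * n with hB
  set h : ℕ → ℝ≥0∞ := fun r => ((min r B : ℕ) : ℝ≥0∞) with hh
  have hmono : Monotone h := fun r s hrs => by
    simp only [hh]
    exact_mod_cast min_le_min_right B hrs
  rw [lindley_iterate_congr lam p t (g := h) (B := B) (fun r hr => by simp [hh, hr]) 0 (by omega)]
  have hlim := hπ.tendsto_mean (fun q => min (portQueue p q) B) (C := B) fun q => min_le_right _ _
  refine (ge_of_tendsto hlim ?_).trans (mean_mono (g := fun q => (portQueue p q : ℝ≥0∞)) fun q => ?_)
  · filter_upwards [eventually_ge_atTop t] with u hu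
    exact (lindley_iterate_zero_monotone lam p hmono hu).trans
      (lindley_iterate_le_mean_queueLaw lam p hs P init u hmono)
  · exact_mod_cast min_le_left _ _

/-- The action of the single-server queue on real functions. -/
def lindleyReal : (ℕ → ℝ) →ₗ[ℝ] (ℕ → ℝ) where
  toFun h r := arrivalMean lam fun a => h (r + portArrivals p a - 1)
  map_add' h g := by funext r; exact map_add (arrivalMean lam) _ _
  map_smul' c h := by funext r; exact map_smul (arrivalMean lam) c _

theorem lindleyReal_apply (h : ℕ → ℝ) (r : ℕ) :
    lindleyReal lam p h r = arrivalMean lam fun a => h (r + portArrivals p a - 1) := rfl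

variable {lam p}

theorem lindleyReal_nonneg (h0 : ∀ i j, 0 ≤ lam i j) (h1 : ∀ i j, lam i j ≤ 1) {h : ℕ → ℝ}
    (hh : ∀ r, 0 ≤ h r) (r : ℕ) : 0 ≤ lindleyReal lam p h r := by
  rw [lindleyReal_apply, ← arrivalMean_const lam 0]
  exact arrivalMean_mono h0 h1 fun a => hh _

theorem lindleyReal_pow_nonneg (h0 : ∀ i j, 0 ≤ lam i j) (h1 : ∀ i j, lam i j ≤ 1) {h : ℕ → ℝ}
    (hh : ∀ r, 0 ≤ h r) (t : ℕ) (r : ℕ) : 0 ≤ (lindleyReal lam p ^ t) h r := by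
  induction t generalizing r with
  | zero => exact hh r
  | succ t ih => rw [pow_succ']; exact lindleyReal_nonneg h0 h1 ih r

theorem lindley_iterate_ofReal (h0 : ∀ i j, 0 ≤ lam i j) (h1 : ∀ i j, lam i j ≤ 1) {h : ℕ → ℝ}
    (hh : ∀ r, 0 ≤ h r) (t : ℕ) (r : ℕ) :
    (lindley lam p)^[t] (fun r => ENNReal.ofReal (h r)) r
      = ENNReal.ofReal ((lindleyReal lam p ^ t) h r) := by
  induction t generalizing r with
  | zero => rfl
  | succ t ih =>
    rw [Function.iterate_succ_apply', lindley]
    simp only [ih]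
    rw [mean_arrivalLaw h0 h1 fun a => lindleyReal_pow_nonneg h0 h1 hh t _, pow_succ']
    rfl

theorem lindleyReal_pow_zero_mono (h0 : ∀ i j, 0 ≤ lam i j) (h1 : ∀ i j, lam i j ≤ 1) {h : ℕ → ℝ}
    (hh : ∀ r, 0 ≤ h r) (hm : Monotone h) (t : ℕ) :
    (lindleyReal lam p ^ t) h 0 ≤ (lindleyReal lam p ^ (t + 1)) h 0 := by
  have := lindley_iterate_zero_monotone lam p (h := fun r => ENNReal.ofReal (h r))
    (fun r s hrs => ENNReal.ofReal_le_ofReal (hm hrs)) (Nat.le_succ t)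
  simp only [lindley_iterate_ofReal h0 h1 hh] at this
  exact (ENNReal.ofReal_le_ofReal_iff (lindleyReal_pow_nonneg h0 h1 hh _ _)).1 this

theorem lindleyReal_pow_const (c : ℝ) (t : ℕ) (r : ℕ) :
    (lindleyReal lam p ^ t) (fun _ => c) r = c := by
  induction t generalizing r with
  | zero => rfl
  | succ t ih =>
    rw [pow_succ', Module.End.mul_apply, lindleyReal_apply]
    simp only [ih, arrivalMean_const]

theorem portArrivals_eq_sum (a : Fin n → Fin n → Bool) :
    (portArrivals p a : ℝ) = ∑ k, arrivalCount a (p k) := by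
  simp [portArrivals, arrivalCount]

theorem arrivalMean_portArrivals {c : ℝ}
    (hc : ∑ k, lam (p k).1 (p k).2 = c) :
    arrivalMean lam (fun a => (portArrivals p a : ℝ)) = c := by
  simp only [portArrivals_eq_sum]
  have : (fun a : Fin n → Fin n → Bool => ∑ k, arrivalCount a (p k))
      = ∑ k, fun a => arrivalCount a (p k) := by funext a; simp
  rw [this, map_sum, ← hc]
  exact Finset.sum_congr rfl fun k _ => arrivalMean_arrivalCount lam (p k)

theorem arrivalMean_portArrivals_sq (hp : Function.Injective p) {c : ℝ}
    (hc : ∑ k, lam (p k).1 (p k).2 = c) :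
    arrivalMean lam (fun a => (portArrivals p a : ℝ) ^ 2)
      = ∑ k, lam (p k).1 (p k).2 * (1 - lam (p k).1 (p k).2) + c ^ 2 := by
  have h1 : (fun a : Fin n → Fin n → Bool => (portArrivals p a : ℝ) ^ 2)
      = (∑ k, ∑ l, fun a => (arrivalCount a (p k) - lam (p k).1 (p k).2) *
          (arrivalCount a (p l) - lam (p l).1 (p l).2))
        + ((2 * c) • (fun a => (portArrivals p a : ℝ)) + fun _ => - c ^ 2) := by
    funext a
    have h2 : (portArrivals p a : ℝ) - c = ∑ k, (arrivalCount a (p k) - lam (p k).1 (p k).2) := by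
      rw [Finset.sum_sub_distrib, hc, portArrivals_eq_sum]
    have h3 : ((portArrivals p a : ℝ) - c) ^ 2 = ∑ k, ∑ l,
        (arrivalCount a (p k) - lam (p k).1 (p k).2) *
          (arrivalCount a (p l) - lam (p l).1 (p l).2) := by
      rw [h2, sq, Finset.sum_mul_sum]
    simp only [Pi.add_apply, Finset.sum_apply, Pi.smul_apply, smul_eq_mul, ← h3]
    ring
  rw [h1]
  simp only [map_add, map_sum, map_smul, arrivalMean_const, arrivalMean_portArrivals hc,
    arrivalMean_covariance, hp.eq_iff, Finset.sum_ite_eq, Finset.mem_univ, if_true, smul_eq_mul]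
  ring

/-- The first moments of a single-server queue started empty approach the stationary mean. -/
theorem exists_lindley_iterate_gt (h0 : ∀ i j, 0 ≤ lam i j) (h1 : ∀ i j, lam i j ≤ 1)
    (hp : Function.Injective p) {ε : ℝ} (hε : 0 < ε) (hc : ∑ k, lam (p k).1 (p k).2 = 1 - ε)
    {M : ℝ} (hM : M < (∑ k, lam (p k).1 (p k).2 * (1 - lam (p k).1 (p k).2) - ε * (1 - ε)) / (2 * ε)) :
    ∃ t, M < (lindleyReal lam p ^ t) (fun r => (r : ℝ)) 0 := by
  -- If all first moments were at most `M`, the mean of `h` below would grow linearly in time. But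
  -- the mean of `g` never decreases, while its increment contains `-3 ε` times the mean of `h`; so
  -- the mean of `h` is bounded.
  by_contra! hle
  set A : (Fin n → Fin n → Bool) → ℝ := fun a => (portArrivals p a : ℝ) with hA
  set w : ℝ := ∑ k, lam (p k).1 (p k).2 * (1 - lam (p k).1 (p k).2) - ε * (1 - ε) with hw
  set κ : ℝ := arrivalMean lam (fun a => (A a - 1) ^ 3) + ε with hκ
  set v : ℝ := arrivalMean lam (fun a => (A a - 1) ^ 2) with hv
  have hA1 : arrivalMean lam A = 1 - ε := arrivalMean_portArrivals hc
  have hA2 : arrivalMean lam (fun a => A a ^ 2) = w + (1 - ε) := by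
    rw [arrivalMean_portArrivals_sq hp hc, hw]; ring
  have hv0 : 0 ≤ v := by
    rw [hv, ← arrivalMean_const lam 0]
    exact arrivalMean_mono h0 h1 fun a => sq_nonneg _
  set id' : ℕ → ℝ := fun r => (r : ℝ) with hid
  -- Both polynomials `h` and `g` take the same value at `-1` and at `0`. The truncation at an empty
  -- queue is thus invisible and no idling term appears.
  set h : ℕ → ℝ := fun r => (r : ℝ) * (r + 1) with hh
  set g : ℕ → ℝ := fun r => ((r : ℝ) - 1) * r * (r + 1) with hg
  have hTh : lindleyReal lam p h = h + (-(2 * ε)) • id' + fun _ => w := by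
    funext r
    have : (fun a => h (r + portArrivals p a - 1))
        = (fun a => A a ^ 2) + (2 * (r : ℝ) - 1) • A + fun _ => (r : ℝ) * (r - 1) := by
      funext a
      simp only [hh, hA, Pi.add_apply, Pi.smul_apply, smul_eq_mul]
      rcases Nat.eq_zero_or_pos (r + portArrivals p a) with h | h
      · have hr : r = 0 := by omega
        have ha : portArrivals p a = 0 := by omega
        simp [hr, ha]
      · rw [Nat.cast_sub h]; push_cast; ring
    rw [lindleyReal_apply, this, map_add, map_add, map_smul, hA1, hA2, arrivalMean_const]
    simp only [hh, hid, Pi.add_apply, Pi.smul_apply, smul_eq_mul]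
    ring
  have hTg : lindleyReal lam p g
      = g + (-(3 * ε)) • h + (3 * (v + ε)) • id' + fun _ => κ := by
    funext r
    have : (fun a => g (r + portArrivals p a - 1))
        = (fun a => (A a - 1) ^ 3) + (3 * (r : ℝ)) • (fun a => (A a - 1) ^ 2)
          + (3 * (r : ℝ) ^ 2 - 1) • A + fun _ => (r : ℝ) ^ 3 - r - 3 * (r : ℝ) ^ 2 + 1 := by
      funext a
      simp only [hg, hA, Pi.add_apply, Pi.smul_apply, smul_eq_mul]
      rcases Nat.eq_zero_or_pos (r + portArrivals p a) with h | h
      · have hr : r = 0 := by omega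
        have ha : portArrivals p a = 0 := by omega
        norm_num [hr, ha]
      · rw [Nat.cast_sub h]; push_cast; ring
    rw [lindleyReal_apply, this, map_add, map_add, map_add, map_smul, map_smul, hA1,
      arrivalMean_const, ← hv]
    simp only [hg, hh, hid, hκ, Pi.add_apply, Pi.smul_apply, smul_eq_mul]
    ring
  set m : ℕ → ℝ := fun t => (lindleyReal lam p ^ t) id' 0 with hm
  have hstep : ∀ t, (lindleyReal lam p ^ (t + 1)) h 0
      = (lindleyReal lam p ^ t) h 0 - 2 * ε * m t + w := by
    intro t
    rw [pow_succ, Module.End.mul_apply, hTh, map_add, map_add, map_smul]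
    simp only [Pi.add_apply, Pi.smul_apply, lindleyReal_pow_const, smul_eq_mul, hm]
    ring
  have hstep3 : ∀ t, (lindleyReal lam p ^ (t + 1)) g 0
      = (lindleyReal lam p ^ t) g 0 - 3 * ε * (lindleyReal lam p ^ t) h 0
        + 3 * (v + ε) * m t + κ := by
    intro t
    rw [pow_succ, Module.End.mul_apply, hTg, map_add, map_add, map_add, map_smul, map_smul]
    simp only [Pi.add_apply, Pi.smul_apply, lindleyReal_pow_const, smul_eq_mul, hm]
    ring
  have hgform : ∀ r : ℕ, g (r + 1) = g r + 3 * ((r : ℝ) ^ 2 + r) := by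
    intro r; simp only [hg]; push_cast; ring
  have hgmono : Monotone g := monotone_nat_of_le_succ fun r => by
    rw [hgform]; have : (0 : ℝ) ≤ 3 * ((r : ℝ) ^ 2 + r) := by positivity
    linarith
  have hg0 : ∀ r, 0 ≤ g r := fun r => by
    have := hgmono (Nat.zero_le r)
    simpa [hg] using this
  set c : ℝ := w - 2 * ε * M with hcdef
  have hcpos : 0 < c := by
    rw [lt_div_iff₀ (by positivity)] at hM
    rw [hcdef]; linarith
  have hgrow : ∀ t : ℕ, t * c ≤ (lindleyReal lam p ^ t) h 0 := by
    intro t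
    induction t with
    | zero => simp [hh]
    | succ t ih =>
      rw [hstep]
      have := mul_le_mul_of_nonneg_left (hle t) (by positivity : 0 ≤ 2 * ε)
      push_cast
      simp only [hm, hcdef] at *
      linarith
  have hbound : ∀ t, 3 * ε * (lindleyReal lam p ^ t) h 0 ≤ 3 * (v + ε) * M + κ := by
    intro t
    have h3 := lindleyReal_pow_zero_mono (p := p) h0 h1 hg0 hgmono t
    rw [hstep3] at h3
    have := mul_le_mul_of_nonneg_left (hle t) (by positivity : 0 ≤ 3 * (v + ε))
    simp only [hm] at *
    linarith
  obtain ⟨t, ht⟩ := exists_nat_gt ((3 * (v + ε) * M + κ) / (3 * ε * c))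
  rw [div_lt_iff₀ (by positivity)] at ht
  have := mul_le_mul_of_nonneg_left (hgrow t) (by positivity : 0 ≤ 3 * ε)
  linarith [hbound t]

/-- The universal lower bound on the mean number of packets at a port with total arrival rate
`1 - ε`. -/
theorem le_mean_portQueue (h0 : ∀ i j, 0 ≤ lam i j) (h1 : ∀ i j, lam i j ≤ 1)
    (hp : Function.Injective p) (hs : ∀ s : Schedule n, ∑ k, s.1 (p k).1 (p k).2 ≤ 1)
    {ε : ℝ} (hε : 0 < ε) (hc : ∑ k, lam (p k).1 (p k).2 = 1 - ε)
    {P : Policy n} {init π : PMF (QueueMatrix n)} (hπ : ConvergesInLaw P lam init π) :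
    ENNReal.ofReal
      ((∑ k, lam (p k).1 (p k).2 * (1 - lam (p k).1 (p k).2) - ε * (1 - ε)) / (2 * ε))
      ≤ mean π fun q => (portQueue p q : ℝ≥0∞) := by
  refine le_of_forall_lt fun x hx => ?_
  obtain ⟨t, ht⟩ := exists_lindley_iterate_gt h0 h1 hp hε hc
    ((ENNReal.lt_ofReal_iff_toReal_lt hx.ne_top).1 hx)
  have h2 := lindley_iterate_le_mean lam p hs hπ t
  have h3 := lindley_iterate_ofReal (p := p) h0 h1 (h := fun r => (r : ℝ))
    (fun r => Nat.cast_nonneg r) t 0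
  simp only [ENNReal.ofReal_natCast] at h3
  rw [h3] at h2
  exact ((ENNReal.lt_ofReal_iff_toReal_lt hx.ne_top).2 ht).trans_le h2

end SingleServer

/-! ### Maximum-weight schedules and Birkhoff's theorem -/

section Birkhoff

variable {n : ℕ}

/-- A doubly substochastic matrix is dominated by a doubly stochastic one. -/
theorem exists_doublyStochastic_ge {r : Matrix (Fin n) (Fin n) ℝ} (h0 : ∀ i j, 0 ≤ r i j)
    (hrow : ∀ i, ∑ j, r i j ≤ 1) (hcol : ∀ j, ∑ i, r i j ≤ 1) :
    ∃ M ∈ doublyStochastic ℝ (Fin n), ∀ i j, r i j ≤ M i j := by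
  set c : Fin n → ℝ := fun i => 1 - ∑ j, r i j with hc
  set d : Fin n → ℝ := fun j => 1 - ∑ i, r i j with hd
  have hc0 : ∀ i, 0 ≤ c i := fun i => sub_nonneg.2 (hrow i)
  have hd0 : ∀ j, 0 ≤ d j := fun j => sub_nonneg.2 (hcol j)
  set D : ℝ := ∑ i, c i with hD
  have hDd : ∑ j, d j = D := by
    simp only [hD, hc, hd, Finset.sum_sub_distrib]
    rw [Finset.sum_comm]
  have hD0 : 0 ≤ D := Finset.sum_nonneg fun i _ => hc0 i
  have hcD : ∀ i, D = 0 → c i = 0 := fun i h =>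
    (Finset.sum_eq_zero_iff_of_nonneg fun i _ => hc0 i).1 h i (Finset.mem_univ i)
  have hdD : ∀ j, D = 0 → d j = 0 := fun j h =>
    (Finset.sum_eq_zero_iff_of_nonneg fun j _ => hd0 j).1 (hDd.trans h) j (Finset.mem_univ j)
  -- The row deficits `c` and column deficits `d` have the same total `D`, so a rank-one matrix
  -- fills both. If `D = 0`, all deficits vanish and the quotient is `0` by convention.
  refine ⟨fun i j => r i j + c i * d j / D, mem_doublyStochastic_iff_sum.2 ⟨?_, ?_, ?_⟩, ?_⟩
  · intro i j
    have := h0 i j; have := hc0 i; have := hd0 j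
    positivity
  · intro i
    rw [Finset.sum_add_distrib, ← Finset.sum_div, ← Finset.mul_sum, hDd]
    by_cases h : D = 0
    · have := hcD i h
      simp only [hc] at this
      rw [h]; simp; linarith
    · rw [mul_div_assoc, div_self h]; simp [hc]
  · intro j
    rw [Finset.sum_add_distrib, ← Finset.sum_div, ← Finset.sum_mul]
    by_cases h : D = 0
    · have := hdD j h
      simp only [hd] at this
      rw [h]; simp; linarith
    · rw [← hD, mul_comm, mul_div_assoc, div_self h]; simp [hd]
  · intro i j
    have := hc0 i; have := hd0 j
    have : 0 ≤ c i * d j / D := by positivity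
    linarith

/-- The schedule given by a permutation. -/
def permSchedule (σ : Equiv.Perm (Fin n)) : Schedule n :=
  ⟨fun i j => if σ i = j then 1 else 0, fun i => by simp, fun j => by
    simp only [← Equiv.eq_symm_apply]; simp⟩

/-- A schedule of maximal weight beats every doubly substochastic matrix. -/
theorem sum_mul_le_weight {q : QueueMatrix n} {s : Schedule n}
    (hs : ∀ s' : Schedule n, s'.weight q ≤ s.weight q) {r : Matrix (Fin n) (Fin n) ℝ}
    (h0 : ∀ i j, 0 ≤ r i j) (hrow : ∀ i, ∑ j, r i j ≤ 1) (hcol : ∀ j, ∑ i, r i j ≤ 1) :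
    ∑ i, ∑ j, (q i j : ℝ) * r i j ≤ s.weight q := by
  obtain ⟨M, hM, hrM⟩ := exists_doublyStochastic_ge h0 hrow hcol
  obtain ⟨w, hw0, hw1, rfl⟩ := exists_eq_sum_perm_of_mem_doublyStochastic hM
  have hσ : ∀ σ : Equiv.Perm (Fin n), ∑ i, ∑ j, (q i j : ℝ) * σ.permMatrix ℝ i j ≤ s.weight q := by
    intro σ
    have : ∑ i, ∑ j, (q i j : ℝ) * σ.permMatrix ℝ i j = ((permSchedule σ).weight q : ℝ) := by
      simp only [Schedule.weight, permSchedule]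
      push_cast
      refine Finset.sum_congr rfl fun i _ => Finset.sum_congr rfl fun j _ => ?_
      simp [Equiv.Perm.permMatrix, PEquiv.toMatrix_apply, Equiv.toPEquiv_apply, eq_comm]
    rw [this]
    exact_mod_cast hs _
  calc ∑ i, ∑ j, (q i j : ℝ) * r i j
      ≤ ∑ i, ∑ j, (q i j : ℝ) * (∑ σ, w σ • σ.permMatrix ℝ) i j :=
        Finset.sum_le_sum fun i _ => Finset.sum_le_sum fun j _ =>
          mul_le_mul_of_nonneg_left (hrM i j) (Nat.cast_nonneg _)
    _ = ∑ i, ∑ j, ∑ σ, w σ * ((q i j : ℝ) * σ.permMatrix ℝ i j) := by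
        refine Finset.sum_congr rfl fun i _ => Finset.sum_congr rfl fun j _ => ?_
        rw [Matrix.sum_apply, Finset.mul_sum]
        exact Finset.sum_congr rfl fun σ _ => by
          rw [Matrix.smul_apply, smul_eq_mul]; ring
    _ = ∑ σ, w σ * ∑ i, ∑ j, (q i j : ℝ) * σ.permMatrix ℝ i j := by
        simp only [Finset.mul_sum]
        symm
        rw [Finset.sum_comm]
        exact Finset.sum_congr rfl fun i _ => Finset.sum_comm
    _ ≤ ∑ σ, w σ * (s.weight q : ℝ) :=
        Finset.sum_le_sum fun σ _ => mul_le_mul_of_nonneg_left (hσ σ) (hw0 σ)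
    _ = s.weight q := by rw [← Finset.sum_mul, hw1, one_mul]

end Birkhoff

/-! ### Queue lengths, schedules and unused service as vectors -/

section Vectors

variable {n : ℕ}

/-- The Euclidean space of real `n × n` matrices. -/
abbrev Vec (n : ℕ) : Type := EuclideanSpace ℝ (Fin n × Fin n)

/-- The queue lengths as a vector. -/
def queueVec (q : QueueMatrix n) : Vec n := WithLp.toLp 2 fun x => (q x.1 x.2 : ℝ)

/-- A schedule as a vector. -/
def schedVec (s : Schedule n) : Vec n := WithLp.toLp 2 fun x => (s.1 x.1 x.2 : ℝ)

/-- The arrivals as a vector. -/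
def arrVec (a : Fin n → Fin n → Bool) : Vec n := WithLp.toLp 2 (arrivalCount a)

/-- A matrix of arrival rates as a vector. -/
def rateVec (lam : Fin n → Fin n → ℝ) : Vec n := WithLp.toLp 2 fun x => lam x.1 x.2

/-- The unused service. -/
def unusedVec (q : QueueMatrix n) (a : Fin n → Fin n → Bool) (s : Schedule n) : Vec n :=
  queueVec (nextQueue q a s) - queueVec q - arrVec a + schedVec s

@[simp] theorem queueVec_apply (q : QueueMatrix n) (x) : queueVec q x = (q x.1 x.2 : ℝ) := rfl
@[simp] theorem schedVec_apply (s : Schedule n) (x) : schedVec s x = (s.1 x.1 x.2 : ℝ) := rfl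
@[simp] theorem arrVec_apply (a : Fin n → Fin n → Bool) (x) : arrVec a x = arrivalCount a x := rfl
@[simp] theorem rateVec_apply (lam : Fin n → Fin n → ℝ) (x) : rateVec lam x = lam x.1 x.2 := rfl

theorem inner_vec (v w : Vec n) : inner ℝ v w = ∑ x, v x * w x := by
  simp [PiLp.inner_apply, mul_comm]

theorem norm_sq_vec (v : Vec n) : ‖v‖ ^ 2 = ∑ x, v x ^ 2 := by
  rw [EuclideanSpace.norm_sq_eq]; simp

theorem abs_apply_le_norm (v : Vec n) (x) : |v x| ≤ ‖v‖ := by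
  simpa using PiLp.norm_apply_le v x

theorem norm_vec_le {v : Vec n} {c : ℝ} (hc : 0 ≤ c) (h : ∀ x, |v x| ≤ c) : ‖v‖ ≤ n * c := by
  refine le_of_sq_le_sq ?_ (by positivity)
  rw [norm_sq_vec]
  calc ∑ x, v x ^ 2 ≤ ∑ _x : Fin n × Fin n, c ^ 2 :=
        Finset.sum_le_sum fun x _ => sq_le_sq.2 ((h x).trans (le_abs_self c))
    _ = _ := by simp; ring

theorem schedule_le_one (s : Schedule n) (i j : Fin n) : s.1 i j ≤ 1 :=
  (Finset.single_le_sum (f := fun j => s.1 i j) (fun _ _ => Nat.zero_le _)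
    (Finset.mem_univ j)).trans (s.2.1 i)

theorem queueVec_nextQueue (q : QueueMatrix n) (a : Fin n → Fin n → Bool) (s : Schedule n) :
    queueVec (nextQueue q a s) = queueVec q + arrVec a - schedVec s + unusedVec q a s := by
  unfold unusedVec; abel

/-- Service is wasted only at a scheduled queue that is empty and receives no arrival, and such a
queue stays empty. Hence `u` is `0`-`1` valued and orthogonal to the queue lengths both before and
after the slot. -/
theorem unusedVec_cases (q : QueueMatrix n) (a : Fin n → Fin n → Bool) (s : Schedule n) (x) :
    unusedVec q a s x = 0 ∨
      (unusedVec q a s x = 1 ∧ q x.1 x.2 = 0 ∧ nextQueue q a s x.1 x.2 = 0) := by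
  have h1 := schedule_le_one s x.1 x.2
  have h : unusedVec q a s x = ((q x.1 x.2 + (a x.1 x.2).toNat - s.1 x.1 x.2 : ℕ) : ℝ)
      - (q x.1 x.2 : ℝ) - ((a x.1 x.2).toNat : ℝ) + (s.1 x.1 x.2 : ℝ) := rfl
  rcases Nat.lt_or_ge (q x.1 x.2 + (a x.1 x.2).toNat) (s.1 x.1 x.2) with h2 | h2
  · right
    have hq : q x.1 x.2 = 0 := by omega
    have ha : (a x.1 x.2).toNat = 0 := by omega
    have hs : s.1 x.1 x.2 = 1 := by omega
    refine ⟨?_, hq, ?_⟩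
    · rw [h, hq, ha, hs]; simp
    · simp [nextQueue, hq, ha]
  · left
    rw [h, Nat.cast_sub h2]; push_cast; ring

theorem unusedVec_nonneg (q : QueueMatrix n) (a : Fin n → Fin n → Bool) (s : Schedule n) (x) :
    0 ≤ unusedVec q a s x := by
  rcases unusedVec_cases q a s x with h | ⟨h, -, -⟩ <;> rw [h]; norm_num

theorem unusedVec_sq (q : QueueMatrix n) (a : Fin n → Fin n → Bool) (s : Schedule n) (x) :
    unusedVec q a s x ^ 2 = unusedVec q a s x := by
  rcases unusedVec_cases q a s x with h | ⟨h, -, -⟩ <;> rw [h] <;> norm_num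

theorem inner_queueVec_unusedVec (q : QueueMatrix n) (a : Fin n → Fin n → Bool) (s : Schedule n) :
    inner ℝ (queueVec q) (unusedVec q a s) = 0 := by
  rw [inner_vec]
  refine Finset.sum_eq_zero fun x _ => ?_
  rcases unusedVec_cases q a s x with h | ⟨-, h, -⟩ <;> simp [h]

theorem queueVec_nextQueue_mul_unusedVec (q : QueueMatrix n) (a : Fin n → Fin n → Bool)
    (s : Schedule n) (x) : queueVec (nextQueue q a s) x * unusedVec q a s x = 0 := by
  rcases unusedVec_cases q a s x with h | ⟨-, -, h⟩ <;> simp [h]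

theorem norm_queueVec_nextQueue_sub_le (q : QueueMatrix n) (a : Fin n → Fin n → Bool)
    (s : Schedule n) : ‖queueVec (nextQueue q a s) - queueVec q‖ ≤ n := by
  have := norm_vec_le (v := queueVec (nextQueue q a s) - queueVec q) zero_le_one fun x => by
    have h1 := schedule_le_one s x.1 x.2
    have h2 := Bool.toNat_le (a x.1 x.2)
    have h3 : nextQueue q a s x.1 x.2 ≤ q x.1 x.2 + 1 := by simp only [nextQueue]; omega
    have h4 : q x.1 x.2 ≤ nextQueue q a s x.1 x.2 + 1 := by simp only [nextQueue]; omega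
    have h3' : (nextQueue q a s x.1 x.2 : ℝ) ≤ q x.1 x.2 + 1 := by exact_mod_cast h3
    have h4' : (q x.1 x.2 : ℝ) ≤ nextQueue q a s x.1 x.2 + 1 := by exact_mod_cast h4
    simp only [PiLp.sub_apply, queueVec_apply, abs_le]
    constructor <;> linarith
  simpa using this

theorem schedule_weight_eq_inner (q : QueueMatrix n) (s : Schedule n) :
    (s.weight q : ℝ) = inner ℝ (queueVec q) (schedVec s) := by
  rw [inner_vec, Fintype.sum_prod_type]
  simp [Schedule.weight]

theorem inner_le_inner_schedVec {q : QueueMatrix n} {s : Schedule n}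
    (hs : ∀ s' : Schedule n, s'.weight q ≤ s.weight q) {r : Vec n}
    (h0 : ∀ x, 0 ≤ r x) (hrow : ∀ i, ∑ j, r (i, j) ≤ 1) (hcol : ∀ j, ∑ i, r (i, j) ≤ 1) :
    inner ℝ (queueVec q) r ≤ inner ℝ (queueVec q) (schedVec s) := by
  have := sum_mul_le_weight hs (r := fun i j => r (i, j)) (fun i j => h0 _) hrow hcol
  rw [schedule_weight_eq_inner] at this
  rw [inner_vec, Fintype.sum_prod_type]
  exact this

theorem arrivalMean_inner (lam : Fin n → Fin n → ℝ) (v : Vec n) :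
    arrivalMean lam (fun a => inner ℝ v (arrVec a)) = inner ℝ v (rateVec lam) := by
  simp only [inner_vec]
  exact arrivalMean_sum_mul_arrivalCount lam v

end Vectors

/-! ### The cone of the saturated ports and state space collapse -/

section PortSpace

variable {n n₁ n₂ : ℕ}

theorem rate_eq (n n₁ n₂ : ℕ) (ε : ℝ) (i j : Fin n) :
    rate n n₁ n₂ ε i j = (1 - ε) * rate n n₁ n₂ 0 i j := by
  unfold rate; split_ifs <;> ring

theorem rateVec_rate (n n₁ n₂ : ℕ) (ε : ℝ) :
    rateVec (rate n n₁ n₂ ε) = (1 - ε) • rateVec (rate n n₁ n₂ 0) := by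
  ext x; simp [rate_eq n n₁ n₂ ε]

theorem rate_zero_le (n n₁ n₂ : ℕ) (i j : Fin n) : rate n n₁ n₂ 0 i j ≤ 1 / n := by
  have : (0 : ℝ) < n := by exact_mod_cast i.pos
  unfold rate; split_ifs
  · rw [sub_zero]; gcongr; linarith
  · rw [sub_zero]

theorem le_rate_zero (n n₁ n₂ : ℕ) (i j : Fin n) : 1 / (2 * n) ≤ rate n n₁ n₂ 0 i j := by
  have : (0 : ℝ) < n := by exact_mod_cast i.pos
  unfold rate; split_ifs
  · rw [sub_zero]
  · rw [sub_zero]; gcongr; linarith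

theorem rate_zero_nonneg (n n₁ n₂ : ℕ) (i j : Fin n) : 0 ≤ rate n n₁ n₂ 0 i j :=
  le_trans (by positivity) (le_rate_zero n n₁ n₂ i j)

theorem rate_nonneg {ε : ℝ} (hε : ε ≤ 1) (i j : Fin n) : 0 ≤ rate n n₁ n₂ ε i j := by
  rw [rate_eq]; exact mul_nonneg (by linarith) (rate_zero_nonneg _ _ _ _ _)

theorem rate_zero_le_one (n n₁ n₂ : ℕ) (i j : Fin n) : rate n n₁ n₂ 0 i j ≤ 1 := by
  refine (rate_zero_le n n₁ n₂ i j).trans ?_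
  have : (1 : ℝ) ≤ n := by exact_mod_cast i.pos
  exact (div_le_one (by linarith)).2 this

theorem rate_le {ε : ℝ} (hε1 : ε ≤ 1) (i j : Fin n) :
    rate n n₁ n₂ ε i j ≤ 1 - ε := by
  rw [rate_eq]
  exact mul_le_of_le_one_right (by linarith) (rate_zero_le_one n n₁ n₂ i j)

theorem rate_zero_of_sat {i j : Fin n} (h : i.val < n₁ ∨ j.val < n₂) :
    rate n n₁ n₂ 0 i j = 1 / n := by
  unfold rate; rw [if_neg (by omega), sub_zero]

theorem sum_rate_zero_row {i : Fin n} (h : i.val < n₁) : ∑ j, rate n n₁ n₂ 0 i j = 1 := by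
  have : (n : ℝ) ≠ 0 := by have := i.pos; positivity
  rw [Finset.sum_congr rfl fun j _ => rate_zero_of_sat (Or.inl h)]
  simp [this]

theorem sum_rate_zero_col {j : Fin n} (h : j.val < n₂) : ∑ i, rate n n₁ n₂ 0 i j = 1 := by
  have : (n : ℝ) ≠ 0 := by have := j.pos; positivity
  rw [Finset.sum_congr rfl fun i _ => rate_zero_of_sat (Or.inr h)]
  simp [this]

/-- Compared with `n` entries equal to `1 / n`, the entry `k` alone falls short by `1 / (2n)`. -/
theorem sum_le_of_unsaturated {f : Fin n → ℝ} (hf : ∀ k, f k ≤ 1 / n) (k : Fin n)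
    (hk : f k = 1 / (2 * n)) : ∑ k, f k ≤ 1 - 1 / (2 * n) := by
  have hn : (0 : ℝ) < n := by exact_mod_cast k.pos
  have h1 : 1 / (n : ℝ) - f k ≤ ∑ k, (1 / (n : ℝ) - f k) :=
    Finset.single_le_sum (f := fun k => 1 / (n : ℝ) - f k) (fun k _ => sub_nonneg.2 (hf k))
      (Finset.mem_univ k)
  rw [Finset.sum_sub_distrib, hk] at h1
  have h2 : ∑ _k : Fin n, 1 / (n : ℝ) = 1 := by simp [hn.ne']
  have h3 : 1 / (n : ℝ) = 1 / (2 * n) + 1 / (2 * n) := by field_simp; norm_num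
  linarith

theorem sum_rate_zero_row_le (hn₂ : n₂ < n) {i : Fin n} (h : n₁ ≤ i.val) :
    ∑ j, rate n n₁ n₂ 0 i j ≤ 1 - 1 / (2 * n) :=
  sum_le_of_unsaturated (fun j => rate_zero_le n n₁ n₂ i j) ⟨n₂, hn₂⟩ (by simp [rate, h])

theorem sum_rate_zero_col_le (hn₁ : n₁ < n) {j : Fin n} (h : n₂ ≤ j.val) :
    ∑ i, rate n n₁ n₂ 0 i j ≤ 1 - 1 / (2 * n) :=
  sum_le_of_unsaturated (fun i => rate_zero_le n n₁ n₂ i j) ⟨n₁, hn₁⟩ (by simp [rate, h])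

/-- The saturated ports: the first `n₁` inputs and the first `n₂` outputs. -/
abbrev Port (n n₁ n₂ : ℕ) : Type := {i : Fin n // i.val < n₁} ⊕ {j : Fin n // j.val < n₂}

/-- The indicator matrix of the queues of a saturated port. -/
def portVec (n n₁ n₂ : ℕ) : Port n n₁ n₂ → Vec n
  | .inl i => WithLp.toLp 2 fun x => if x.1 = i.1 then 1 else 0
  | .inr j => WithLp.toLp 2 fun x => if x.2 = j.1 then 1 else 0

/-- The span of the indicator matrices of the saturated ports. -/
def portSpace (n n₁ n₂ : ℕ) : Submodule ℝ (Vec n) := Submodule.span ℝ (Set.range (portVec n n₁ n₂))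

theorem portVec_mem (k : Port n n₁ n₂) : portVec n n₁ n₂ k ∈ portSpace n n₁ n₂ :=
  Submodule.subset_span ⟨k, rfl⟩

theorem inner_portVec_inl (i : {i : Fin n // i.val < n₁}) (v : Vec n) :
    inner ℝ (portVec n n₁ n₂ (.inl i)) v = ∑ j, v (i.1, j) := by
  rw [inner_vec, Fintype.sum_prod_type, Finset.sum_eq_single i.1]
  · simp [portVec]
  · intro k _ hk; simp [portVec, hk]
  · simp

theorem inner_portVec_inr (j : {j : Fin n // j.val < n₂}) (v : Vec n) :
    inner ℝ (portVec n n₁ n₂ (.inr j)) v = ∑ i, v (i, j.1) := by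
  rw [inner_vec, Fintype.sum_prod_type_right, Finset.sum_eq_single j.1]
  · simp [portVec]
  · intro k _ hk; simp [portVec, hk]
  · simp

theorem sum_portVec (k : Port n n₁ n₂) : ∑ x, portVec n n₁ n₂ k x = n := by
  rcases k with i | j
  · have := inner_portVec_inl (n₁ := n₁) (n₂ := n₂) i (WithLp.toLp 2 fun _ => 1)
    rw [inner_vec] at this
    simpa using this
  · have := inner_portVec_inr (n₁ := n₁) (n₂ := n₂) j (WithLp.toLp 2 fun _ => 1)
    rw [inner_vec] at this
    simpa using this

theorem portVec_nonneg (k : Port n n₁ n₂) (x) : 0 ≤ portVec n n₁ n₂ k x := by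
  rcases k with i | j <;> simp only [portVec] <;> split_ifs <;> norm_num

theorem apply_eq_zero_of_mem_portSpace {y : Vec n} (hy : y ∈ portSpace n n₁ n₂)
    {x : Fin n × Fin n} (h1 : n₁ ≤ x.1.val) (h2 : n₂ ≤ x.2.val) : y x = 0 := by
  induction hy using Submodule.span_induction with
  | mem v hv =>
    obtain ⟨k, rfl⟩ := hv
    rcases k with i | j
    · have : x.1 ≠ i.1 := fun h => by have := i.2; rw [← h] at this; omega
      simp [portVec, this]
    · have : x.2 ≠ j.1 := fun h => by have := j.2; rw [← h] at this; omega
      simp [portVec, this]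
  | zero => rfl
  | add u v _ _ hu hv => simp [hu, hv]
  | smul c v _ hv => simp [hv]

/-- It suffices to check the generators, whose entries sum to `n`. Since this applies both to the
critical rates and to maximal schedules, the span does not distinguish them. -/
theorem inner_eq_sum_div_of_mem_portSpace (hn : 0 < n) {r : Vec n}
    (hr : ∀ k, inner ℝ (portVec n n₁ n₂ k) r = 1) {y : Vec n} (hy : y ∈ portSpace n n₁ n₂) :
    inner ℝ y r = (∑ x, y x) / n := by
  have hn' : (n : ℝ) ≠ 0 := by positivity
  induction hy using Submodule.span_induction with
  | mem v hv =>
    obtain ⟨k, rfl⟩ := hv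
    rw [hr, sum_portVec, div_self hn']
  | zero => simp
  | add u v _ _ hu hv =>
    simp only [inner_add_left, hu, hv, PiLp.add_apply, Finset.sum_add_distrib]; ring
  | smul c v _ hv =>
    simp only [inner_smul_left, hv, PiLp.smul_apply, ← Finset.mul_sum, smul_eq_mul,
      RCLike.conj_to_real]
    ring

theorem inner_portVec_rateVec_zero (k : Port n n₁ n₂) :
    inner ℝ (portVec n n₁ n₂ k) (rateVec (rate n n₁ n₂ 0)) = 1 := by
  rcases k with i | j
  · rw [inner_portVec_inl]; exact sum_rate_zero_row i.2
  · rw [inner_portVec_inr]; exact sum_rate_zero_col j.2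

theorem inner_portVec_schedVec {s : Schedule n} (hs : s.IsMaximal) (k : Port n n₁ n₂) :
    inner ℝ (portVec n n₁ n₂ k) (schedVec s) = 1 := by
  rcases k with i | j
  · rw [inner_portVec_inl]; simp only [schedVec_apply]; exact_mod_cast hs.1 i.1
  · rw [inner_portVec_inr]; simp only [schedVec_apply]; exact_mod_cast hs.2 j.1

theorem inner_rateVec_zero_of_mem (hn : 0 < n) {y : Vec n} (hy : y ∈ portSpace n n₁ n₂) :
    inner ℝ y (rateVec (rate n n₁ n₂ 0)) = (∑ x, y x) / n :=
  inner_eq_sum_div_of_mem_portSpace hn inner_portVec_rateVec_zero hy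

theorem inner_schedVec_of_mem (hn : 0 < n) {s : Schedule n} (hs : s.IsMaximal) {y : Vec n}
    (hy : y ∈ portSpace n n₁ n₂) : inner ℝ y (schedVec s) = (∑ x, y x) / n :=
  inner_eq_sum_div_of_mem_portSpace hn (inner_portVec_schedVec hs) hy

theorem norm_rateVec_zero_le (hn : 0 < n) : ‖rateVec (rate n n₁ n₂ 0)‖ ≤ 1 := by
  have hn' : (n : ℝ) ≠ 0 := by positivity
  have := norm_vec_le (v := rateVec (rate n n₁ n₂ 0)) (c := 1 / n) (by positivity) fun x => by
    rw [rateVec_apply, abs_of_nonneg (rate_zero_nonneg _ _ _ _ _)]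
    exact rate_zero_le _ _ _ _ _
  rwa [mul_one_div, div_self hn'] at this

/-- The cone of nonnegative matrices in the span of the saturated ports. -/
def portCone (n n₁ n₂ : ℕ) : Set (Vec n) := {y | y ∈ portSpace n n₁ n₂ ∧ ∀ x, 0 ≤ y x}

theorem isClosed_portCone : IsClosed (portCone n n₁ n₂) := by
  have h1 : IsClosed (portSpace n n₁ n₂ : Set (Vec n)) := Submodule.closed_of_finiteDimensional _
  have h2 : IsClosed {y : Vec n | ∀ x, 0 ≤ y x} := by
    simp only [Set.ofPred_forall]
    exact isClosed_iInter fun x => isClosed_le continuous_const (by fun_prop)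
  exact h1.inter h2

theorem convex_portCone : Convex ℝ (portCone n n₁ n₂) := by
  intro u hu v hv a b ha hb _
  refine ⟨Submodule.add_mem _ (Submodule.smul_mem _ _ hu.1) (Submodule.smul_mem _ _ hv.1),
    fun x => ?_⟩
  have := hu.2 x; have := hv.2 x
  simp only [PiLp.add_apply, PiLp.smul_apply, smul_eq_mul]
  positivity

theorem zero_mem_portCone : (0 : Vec n) ∈ portCone n n₁ n₂ := ⟨Submodule.zero_mem _, fun _ => le_rfl⟩

theorem portVec_mem_portCone (k : Port n n₁ n₂) : portVec n n₁ n₂ k ∈ portCone n n₁ n₂ :=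
  ⟨portVec_mem k, portVec_nonneg k⟩

theorem smul_mem_portCone {c : ℝ} (hc : 0 ≤ c) {y : Vec n} (hy : y ∈ portCone n n₁ n₂) :
    c • y ∈ portCone n n₁ n₂ :=
  ⟨Submodule.smul_mem _ _ hy.1, fun x => mul_nonneg hc (hy.2 x)⟩

/-- The projection of a vector to the cone. -/
theorem exists_portCone_projection (n n₁ n₂ : ℕ) (v : Vec n) :
    ∃ y ∈ portCone n n₁ n₂, ‖v - y‖ = Metric.infDist v (portCone n n₁ n₂) ∧
      inner ℝ (v - y) y = 0 ∧ ∀ k ∈ portCone n n₁ n₂, inner ℝ (v - y) k ≤ 0 := by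
  obtain ⟨y, hy, hd⟩ := isClosed_portCone.exists_infDist_eq_dist (s := portCone n n₁ n₂)
    ⟨0, zero_mem_portCone⟩ v
  rw [dist_eq_norm] at hd
  have hmin : ‖v - y‖ = ⨅ w : portCone n n₁ n₂, ‖v - w‖ := by
    rw [← hd, Metric.infDist_eq_iInf]
    simp only [dist_eq_norm]
  have hle := (norm_eq_iInf_iff_real_inner_le_zero convex_portCone hy).1 hmin
  have h0 : inner ℝ (v - y) y = 0 := by
    -- Testing the variational inequality at `0` and at `2 y` gives both signs of `⟨v - y, y⟩`.
    have h1 := hle 0 zero_mem_portCone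
    have h2 := hle ((2 : ℝ) • y) (smul_mem_portCone (by norm_num) hy)
    have h3 : (2 : ℝ) • y - y = y := by rw [two_smul]; abel
    rw [h3] at h2
    rw [zero_sub, inner_neg_right] at h1
    linarith
  refine ⟨y, hy, hd.symm, h0, fun k hk => ?_⟩
  have := hle k hk
  rw [inner_sub_right, h0] at this
  linarith

/-- The weight of a maximum-weight schedule exceeds the critical rates by a multiple of the distance
to the cone. -/
theorem inner_rateVec_add_le (hn₁ : n₁ < n) (hn₂ : n₂ < n) {q : QueueMatrix n} {s : Schedule n}
    (hs : ∀ s' : Schedule n, s'.weight q ≤ s.weight q) {z : Vec n}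
    (hz : ∀ k, inner ℝ z (portVec n n₁ n₂ k) ≤ 0) (hqz : inner ℝ (queueVec q) z = ‖z‖ ^ 2) :
    inner ℝ (queueVec q) (rateVec (rate n n₁ n₂ 0)) + 1 / (2 * n ^ 2) * ‖z‖
      ≤ inner ℝ (queueVec q) (schedVec s) := by
  have hn : 0 < n := by omega
  have hn' : (1 : ℝ) ≤ n := by exact_mod_cast hn
  -- The matrix `λ + c z`, with `λ` the critical rates, is doubly substochastic for this `c`. It is
  -- nonnegative since rates are at least `1 / (2n)`; sums over saturated ports do not increase
  -- since `⟨z, portVec⟩ ≤ 0`; an unsaturated port has slack `1 / (2n) = n * (1 / (2n²))`. For `z =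
  -- 0` one gets `c = 0`.
  set c : ℝ := 1 / (2 * n ^ 2) / ‖z‖ with hc
  have hc0 : 0 ≤ c := by positivity
  have hcz : c * ‖z‖ ≤ 1 / (2 * n ^ 2) := by
    by_cases h : ‖z‖ = 0
    · rw [h, mul_zero]; positivity
    · rw [hc, div_mul_cancel₀ _ h]
  have habs : ∀ x, |c * z x| ≤ 1 / (2 * n ^ 2) := fun x => by
    rw [abs_mul, abs_of_nonneg hc0]
    exact (mul_le_mul_of_nonneg_left (abs_apply_le_norm z x) hc0).trans hcz
  have hsq : 1 / (2 * (n : ℝ) ^ 2) ≤ 1 / (2 * n) := by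
    gcongr
    nlinarith
  have hnsq : (n : ℝ) * (1 / (2 * n ^ 2)) = 1 / (2 * n) := by field_simp
  have hsum : ∀ f : Fin n → Fin n × Fin n, ∑ k, c * z (f k) ≤ 1 / (2 * n) := by
    intro f
    calc ∑ k, c * z (f k) ≤ ∑ _k : Fin n, 1 / (2 * (n : ℝ) ^ 2) :=
          Finset.sum_le_sum fun k _ => (le_abs_self _).trans (habs _)
      _ = _ := by rw [Finset.sum_const, Finset.card_univ, Fintype.card_fin, nsmul_eq_mul, hnsq]
  have key := inner_le_inner_schedVec hs (r := rateVec (rate n n₁ n₂ 0) + c • z)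
    (fun x => by
      have h1 := (abs_le.1 (habs x)).1
      have h2 := le_rate_zero n n₁ n₂ x.1 x.2
      simp only [PiLp.add_apply, PiLp.smul_apply, rateVec_apply, smul_eq_mul]
      linarith)
    (fun i => by
      simp only [PiLp.add_apply, PiLp.smul_apply, rateVec_apply, smul_eq_mul,
        Finset.sum_add_distrib]
      by_cases hi : i.val < n₁
      · have := hz (.inl ⟨i, hi⟩)
        rw [real_inner_comm, inner_portVec_inl] at this
        rw [sum_rate_zero_row hi, ← Finset.mul_sum]
        have := mul_nonpos_of_nonneg_of_nonpos hc0 this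
        linarith
      · have := sum_rate_zero_row_le (n₁ := n₁) hn₂ (not_lt.1 hi)
        have := hsum fun j => (i, j)
        linarith)
    (fun j => by
      simp only [PiLp.add_apply, PiLp.smul_apply, rateVec_apply, smul_eq_mul,
        Finset.sum_add_distrib]
      by_cases hj : j.val < n₂
      · have := hz (.inr ⟨j, hj⟩)
        rw [real_inner_comm, inner_portVec_inr] at this
        rw [sum_rate_zero_col hj, ← Finset.mul_sum]
        have := mul_nonpos_of_nonneg_of_nonpos hc0 this
        linarith
      · have := sum_rate_zero_col_le (n₂ := n₂) hn₁ (not_lt.1 hj)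
        have := hsum fun i => (i, j)
        linarith)
  rw [inner_add_right, inner_smul_right, hqz] at key
  have h1 : c * ‖z‖ ^ 2 = 1 / (2 * n ^ 2) * ‖z‖ := by
    by_cases h : ‖z‖ = 0
    · rw [h]; ring
    · rw [hc]; field_simp
  rw [h1] at key
  exact key

/-- The square is expanded: the jump has norm at most `n`, and the unused service contributes to the
cross term with a favourable sign. -/
theorem arrivalMean_norm_add_sq_le {lam : Fin n → Fin n → ℝ} (h0 : ∀ i j, 0 ≤ lam i j)
    (h1 : ∀ i j, lam i j ≤ 1) (q : QueueMatrix n) (s : Schedule n) {z : Vec n}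
    (hz : ∀ a, inner ℝ z (unusedVec q a s) ≤ 0) :
    arrivalMean lam (fun a => ‖z + (queueVec (nextQueue q a s) - queueVec q)‖ ^ 2)
      ≤ ‖z‖ ^ 2 + 2 * (inner ℝ z (rateVec lam) - inner ℝ z (schedVec s)) + (n : ℝ) ^ 2 := by
  refine (arrivalMean_mono h0 h1 (G := (2 : ℝ) • (fun a => inner ℝ z (arrVec a)) +
    fun _ => ‖z‖ ^ 2 - 2 * inner ℝ z (schedVec s) + (n : ℝ) ^ 2) fun a => ?_).trans (le_of_eq ?_)
  · have h2 : ‖queueVec (nextQueue q a s) - queueVec q‖ ^ 2 ≤ (n : ℝ) ^ 2 :=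
      pow_le_pow_left₀ (norm_nonneg _) (norm_queueVec_nextQueue_sub_le q a s) 2
    have h3 : inner ℝ z (queueVec (nextQueue q a s) - queueVec q)
        = inner ℝ z (arrVec a) - inner ℝ z (schedVec s) + inner ℝ z (unusedVec q a s) := by
      rw [queueVec_nextQueue, ← inner_sub_right, ← inner_add_right]
      congr 1; abel
    rw [norm_add_sq_real, h3]
    simp only [Pi.add_apply, Pi.smul_apply, smul_eq_mul]
    linarith [hz a]
  · rw [map_add, map_smul, arrivalMean_const, arrivalMean_inner, smul_eq_mul]
    ring

/-- The distance of the queue lengths from the cone. -/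
def coneDist (n₁ n₂ : ℕ) (q : QueueMatrix n) : ℝ := Metric.infDist (queueVec q) (portCone n n₁ n₂)

theorem coneDist_nonneg (q : QueueMatrix n) : 0 ≤ coneDist n₁ n₂ q := Metric.infDist_nonneg

theorem abs_coneDist_nextQueue_sub_le (q : QueueMatrix n) (a : Fin n → Fin n → Bool)
    (s : Schedule n) : |coneDist n₁ n₂ (nextQueue q a s) - coneDist n₁ n₂ q| ≤ n := by
  have h := norm_queueVec_nextQueue_sub_le q a s
  rw [← dist_eq_norm] at h
  have h1 := Metric.infDist_le_infDist_add_dist (s := portCone n n₁ n₂)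
    (x := queueVec (nextQueue q a s)) (y := queueVec q)
  have h2 := Metric.infDist_le_infDist_add_dist (s := portCone n n₁ n₂)
    (x := queueVec q) (y := queueVec (nextQueue q a s))
  rw [dist_comm] at h2
  unfold coneDist
  rw [abs_le]
  constructor <;> linarith

/-- State space collapse: the distance to the cone has negative drift. -/
theorem arrivalMean_coneDist_sq_le (hn₁ : n₁ < n) (hn₂ : n₂ < n) {ε : ℝ} (hε : 0 ≤ ε)
    (hε1 : ε ≤ 1 / (4 * n ^ 2)) {q : QueueMatrix n} {s : Schedule n} (hm : s.IsMaximal)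
    (hs : ∀ s' : Schedule n, s'.weight q ≤ s.weight q) :
    arrivalMean (rate n n₁ n₂ ε) (fun a => coneDist n₁ n₂ (nextQueue q a s) ^ 2)
      ≤ coneDist n₁ n₂ q ^ 2 - 1 / (2 * n ^ 2) * coneDist n₁ n₂ q + (n : ℝ) ^ 2 := by
  have hn : 0 < n := by omega
  have hn' : (1 : ℝ) ≤ n := by exact_mod_cast hn
  have hε2 : ε ≤ 1 := hε1.trans ((div_le_one (by positivity)).2 (by nlinarith))
  have h0 : ∀ i j, 0 ≤ rate n n₁ n₂ ε i j := rate_nonneg hε2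
  have h1 : ∀ i j, rate n n₁ n₂ ε i j ≤ 1 := fun i j => (rate_le hε2 i j).trans (by linarith)
  obtain ⟨y, hy, hd, hzy, hzk⟩ := exists_portCone_projection n n₁ n₂ (queueVec q)
  set z := queueVec q - y with hz
  have hqyz : queueVec q = z + y := by rw [hz]; abel
  have hqz : inner ℝ (queueVec q) z = ‖z‖ ^ 2 := by
    rw [hqyz, inner_add_left, real_inner_self_eq_norm_sq, real_inner_comm, hzy, add_zero]
  have hd' : coneDist n₁ n₂ q = ‖z‖ := hd.symm
  have hweight := inner_rateVec_add_le hn₁ hn₂ hs (fun k => hzk _ (portVec_mem_portCone k)) hqz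
  -- Here the cone is needed rather than the span: `⟨q, u⟩ = 0`, and `⟨y, u⟩ ≥ 0` because `y` is
  -- nonnegative.
  have hzu : ∀ a, inner ℝ z (unusedVec q a s) ≤ 0 := by
    intro a
    rw [hz, inner_sub_left, inner_queueVec_unusedVec, zero_sub, neg_nonpos, inner_vec]
    exact Finset.sum_nonneg fun x _ => mul_nonneg (hy.2 x) (unusedVec_nonneg q a s x)
  calc arrivalMean (rate n n₁ n₂ ε) (fun a => coneDist n₁ n₂ (nextQueue q a s) ^ 2)
      ≤ arrivalMean (rate n n₁ n₂ ε)
          (fun a => ‖z + (queueVec (nextQueue q a s) - queueVec q)‖ ^ 2) := by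
        -- The projection `y` of the old queue lengths is a competitor for the new distance.
        refine arrivalMean_mono h0 h1 fun a => pow_le_pow_left₀ (coneDist_nonneg _) ?_ 2
        refine (Metric.infDist_le_dist_of_mem hy).trans (le_of_eq ?_)
        rw [dist_eq_norm, hz]
        congr 1; abel
    _ ≤ _ := arrivalMean_norm_add_sq_le h0 h1 q s hzu
    _ ≤ _ := by
        -- The part `y` pairs equally with critical rates and schedule, so the whole weight gap `‖z‖
        -- / (2n²)` belongs to `z`. The correction `ε ‖z‖ ≤ ‖z‖ / (4n²)` uses up half of it.
        rw [hd', rateVec_rate, inner_smul_right]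
        have hy1 := inner_rateVec_zero_of_mem hn hy.1
        have hy2 := inner_schedVec_of_mem hn hm hy.1
        rw [hqyz] at hweight
        simp only [inner_add_left] at hweight
        have hzr : -‖z‖ ≤ inner ℝ z (rateVec (rate n n₁ n₂ 0)) := by
          have h3 := abs_real_inner_le_norm z (rateVec (rate n n₁ n₂ 0))
          have h4 := mul_le_mul_of_nonneg_left (norm_rateVec_zero_le (n₁ := n₁) (n₂ := n₂) hn)
            (norm_nonneg z)
          linarith [(abs_le.1 h3).1]
        have h5 : ε * ‖z‖ ≤ 1 / (4 * n ^ 2) * ‖z‖ := by gcongr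
        have h6 := mul_le_mul_of_nonneg_left hzr hε
        have h7 : 1 / (2 * (n : ℝ) ^ 2) = 2 * (1 / (4 * n ^ 2)) := by ring
        rw [h7] at hweight ⊢
        linarith

theorem norm_queueVec_le_sum (q : QueueMatrix n) : ‖queueVec q‖ ≤ ∑ x, queueVec q x := by
  refine le_of_sq_le_sq ?_ (Finset.sum_nonneg fun x _ => Nat.cast_nonneg _)
  rw [norm_sq_vec]
  exact Finset.sum_sq_le_sq_sum_of_nonneg fun x _ => Nat.cast_nonneg _

/-- Under MaxWeight the norm of the queue lengths has negative drift. -/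
theorem arrivalMean_norm_sq_le (hn₁ : n₁ < n) (hn₂ : n₂ < n) {ε : ℝ} (hε : 0 ≤ ε)
    (hε1 : ε ≤ 1) {q : QueueMatrix n} {s : Schedule n}
    (hs : ∀ s' : Schedule n, s'.weight q ≤ s.weight q) :
    arrivalMean (rate n n₁ n₂ ε) (fun a => ‖queueVec (nextQueue q a s)‖ ^ 2)
      ≤ ‖queueVec q‖ ^ 2 - ε / n * ‖queueVec q‖ + (n : ℝ) ^ 2 := by
  have hn : 0 < n := by omega
  have hn' : (1 : ℝ) ≤ n := by exact_mod_cast hn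
  have h0 : ∀ i j, 0 ≤ rate n n₁ n₂ ε i j := rate_nonneg hε1
  have h1 : ∀ i j, rate n n₁ n₂ ε i j ≤ 1 := fun i j => (rate_le hε1 i j).trans (by linarith)
  have key := arrivalMean_norm_add_sq_le h0 h1 q s (z := queueVec q)
    fun a => (inner_queueVec_unusedVec q a s).le
  have hw := inner_rateVec_add_le (n₁ := n₁) (n₂ := n₂) hn₁ hn₂ hs (z := 0) (by simp) (by simp)
  rw [norm_zero, mul_zero, add_zero] at hw
  simp only [add_sub_cancel] at key
  refine key.trans ?_
  rw [rateVec_rate, inner_smul_right]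
  have h2 : 1 / (2 * n) * ‖queueVec q‖ ≤ inner ℝ (queueVec q) (rateVec (rate n n₁ n₂ 0)) := by
    refine (mul_le_mul_of_nonneg_left (norm_queueVec_le_sum q) (by positivity)).trans ?_
    rw [inner_vec, Finset.mul_sum]
    refine Finset.sum_le_sum fun x _ => ?_
    rw [mul_comm]
    exact mul_le_mul_of_nonneg_left (le_rate_zero _ _ _ _ _) (Nat.cast_nonneg _)
  have h3 := mul_le_mul_of_nonneg_left h2 hε
  have h4 : ε * (1 / (2 * n) * ‖queueVec q‖) = ε / n * ‖queueVec q‖ / 2 := by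
    field_simp
  linarith

/-- A quadratic drift condition for a function with bounded jumps gives a cubic one. -/
theorem arrivalMean_pow_three_le {lam : Fin n → Fin n → ℝ} (h0 : ∀ i j, 0 ≤ lam i j)
    (h1 : ∀ i j, lam i j ≤ 1) {x B δ C : ℝ} {y : (Fin n → Fin n → Bool) → ℝ} (hx : 0 ≤ x)
    (hδ : 0 < δ) (hB : ∀ a, |y a - x| ≤ B)
    (h : arrivalMean lam (fun a => y a ^ 2) ≤ x ^ 2 - δ * x + C) :
    arrivalMean lam (fun a => y a ^ 3)
      ≤ x ^ 3 - δ * x ^ 2 + ((3 / 2 * (C + B ^ 2)) ^ 2 / (2 * δ) + B ^ 3) := by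
  -- With `y = x + t` one has `y³ = (3/2) x y² - x³/2 + (3/2) x t² + t³`: the term linear in `t` is
  -- absorbed into `y²`, whose mean is controlled.
  have h2 := arrivalMean_mono h0 h1 (F := fun a => y a ^ 3)
    (G := (3 / 2 * x) • (fun a => y a ^ 2) +
      fun _ => x ^ 3 - 3 / 2 * x ^ 3 + 3 / 2 * x * B ^ 2 + B ^ 3) fun a => by
    obtain ⟨t, ht⟩ : ∃ t, y a = x + t := ⟨y a - x, by ring⟩
    have hB' := hB a
    rw [ht] at hB' ⊢
    rw [add_sub_cancel_left] at hB'
    have hB0 : 0 ≤ B := (abs_nonneg t).trans hB'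
    have ht2 : t ^ 2 ≤ B ^ 2 := sq_le_sq.2 (hB'.trans (le_abs_self B))
    have ht3 : t ^ 3 ≤ B ^ 3 := (Odd.strictMono_pow (by decide)).monotone ((le_abs_self t).trans hB')
    simp only [Pi.add_apply, Pi.smul_apply, smul_eq_mul, ht]
    nlinarith [mul_le_mul_of_nonneg_left ht2 hx]
  rw [map_add, map_smul, arrivalMean_const, smul_eq_mul] at h2
  have h3 := mul_le_mul_of_nonneg_left h (by positivity : 0 ≤ 3 / 2 * x)
  set D := 3 / 2 * (C + B ^ 2) with hD
  -- Young's inequality, at the expense of one third of the available `(3/2) δ x²`.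
  have h4 : D * x ≤ δ / 2 * x ^ 2 + D ^ 2 / (2 * δ) := by
    have : δ / 2 * x ^ 2 + D ^ 2 / (2 * δ) - D * x = (δ * x - D) ^ 2 / (2 * δ) := by
      field_simp; ring
    have h5 : 0 ≤ (δ * x - D) ^ 2 / (2 * δ) := by positivity
    linarith
  have h6 : 3 / 2 * x * C + 3 / 2 * x * B ^ 2 = D * x := by rw [hD]; ring
  nlinarith

end PortSpace

/-! ### Projection to the span and the drift of its squared norm -/

section Projection

variable {n n₁ n₂ : ℕ}

/-- The orthogonal projection to the span of the saturated ports. -/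
def portProj (n n₁ n₂ : ℕ) : Vec n →L[ℝ] Vec n := (portSpace n n₁ n₂).starProjection

theorem portProj_mem (v : Vec n) : portProj n n₁ n₂ v ∈ portSpace n n₁ n₂ :=
  Submodule.starProjection_apply_mem _ _

theorem inner_portProj_of_mem (v : Vec n) {y : Vec n} (hy : y ∈ portSpace n n₁ n₂) :
    inner ℝ (portProj n n₁ n₂ v) y = inner ℝ v y := by
  have := Submodule.starProjection_inner_eq_zero (K := portSpace n n₁ n₂) v y hy
  rw [inner_sub_left] at this
  unfold portProj
  linarith

theorem inner_portProj_comm (v w : Vec n) :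
    inner ℝ (portProj n n₁ n₂ v) w = inner ℝ v (portProj n n₁ n₂ w) := by
  rw [← inner_portProj_of_mem v (portProj_mem w), real_inner_comm,
    ← inner_portProj_of_mem w (portProj_mem v), real_inner_comm]

theorem inner_portProj_portProj (v w : Vec n) :
    inner ℝ (portProj n n₁ n₂ v) (portProj n n₁ n₂ w) = inner ℝ (portProj n n₁ n₂ v) w := by
  rw [inner_portProj_of_mem v (portProj_mem w), inner_portProj_comm]

theorem inner_portProj_self (v : Vec n) :
    inner ℝ (portProj n n₁ n₂ v) v = ‖portProj n n₁ n₂ v‖ ^ 2 := by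
  rw [← inner_portProj_portProj, real_inner_self_eq_norm_sq]

theorem norm_portProj_le (v : Vec n) : ‖portProj n n₁ n₂ v‖ ≤ ‖v‖ :=
  Submodule.norm_starProjection_apply_le _ v

/-- The cone lies in the span, so the span is at least as close. -/
theorem norm_sub_portProj_le (q : QueueMatrix n) :
    ‖queueVec q - portProj n n₁ n₂ (queueVec q)‖ ≤ coneDist n₁ n₂ q := by
  obtain ⟨y, hy, hd, -⟩ := exists_portCone_projection n n₁ n₂ (queueVec q)
  rw [coneDist, ← hd, portProj, Submodule.starProjection_minimal]
  exact ciInf_le (f := fun x : portSpace n n₁ n₂ => ‖queueVec q - x‖)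
    ⟨0, by rintro _ ⟨x, rfl⟩; exact norm_nonneg _⟩ ⟨y, hy.1⟩

theorem portProj_apply_eq_zero (v : Vec n) {x : Fin n × Fin n} (h1 : n₁ ≤ x.1.val)
    (h2 : n₂ ≤ x.2.val) : portProj n n₁ n₂ v x = 0 :=
  apply_eq_zero_of_mem_portSpace (portProj_mem v) h1 h2

/-- At the crossing of a saturated port with an unsaturated one only a single generator is nonzero.
With all ports saturated the sum of the rows would equal the sum of the columns. -/
theorem linearIndependent_portVec (hn₁ : n₁ < n) (hn₂ : n₂ < n) :
    LinearIndependent ℝ (portVec n n₁ n₂) := by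
  rw [Fintype.linearIndependent_iff]
  intro g hg
  have happ : ∀ x : Fin n × Fin n, ∑ k, g k * portVec n n₁ n₂ k x = 0 := by
    intro x
    have h := congrArg (fun v : Vec n => v x) hg
    simpa using h
  simp only [Fintype.sum_sum_type] at happ
  rintro (i | j)
  · have h := happ (i.1, ⟨n₂, hn₂⟩)
    have hz : ∀ j : {j : Fin n // j.val < n₂}, (⟨n₂, hn₂⟩ : Fin n) ≠ j.1 := fun j hj => by
      have := j.2; rw [← hj] at this; simp at this
    simpa [portVec, hz, ← Subtype.ext_iff] using h
  · have h := happ (⟨n₁, hn₁⟩, j.1)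
    have hz : ∀ i : {i : Fin n // i.val < n₁}, (⟨n₁, hn₁⟩ : Fin n) ≠ i.1 := fun i hi => by
      have := i.2; rw [← hi] at this; simp at this
    simpa [portVec, hz, ← Subtype.ext_iff] using h

theorem card_fin_val_lt {m : ℕ} (h : m < n) : Fintype.card {i : Fin n // i.val < m} = m := by
  have e : {i : Fin n // i.val < m} ≃ Fin m :=
    { toFun := fun i => ⟨i.1.val, i.2⟩
      invFun := fun i => ⟨⟨i.val, i.2.trans h⟩, i.2⟩
      left_inv := fun i => rfl
      right_inv := fun i => rfl }
  rw [Fintype.card_congr e, Fintype.card_fin]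

theorem card_port (hn₁ : n₁ < n) (hn₂ : n₂ < n) : Fintype.card (Port n n₁ n₂) = n₁ + n₂ := by
  rw [Fintype.card_sum, card_fin_val_lt hn₁, card_fin_val_lt hn₂]

/-- The trace of a projection is the dimension of its range; this is the source of `n₁ + n₂` in the
limit. -/
theorem sum_portProj_single (hn₁ : n₁ < n) (hn₂ : n₂ < n) :
    ∑ x, portProj n n₁ n₂ (EuclideanSpace.single x 1) x = n₁ + n₂ := by
  have hproj : LinearMap.IsProj (portSpace n n₁ n₂)
      (portProj n n₁ n₂ : Vec n →ₗ[ℝ] Vec n) :=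
    ⟨fun v => portProj_mem v, fun v hv => Submodule.starProjection_eq_self_iff.2 hv⟩
  have h1 := hproj.trace
  rw [LinearMap.trace_eq_sum_inner _ (EuclideanSpace.basisFun (Fin n × Fin n) ℝ), portSpace,
    finrank_span_eq_card (linearIndependent_portVec hn₁ hn₂), card_port hn₁ hn₂] at h1
  simpa [EuclideanSpace.inner_single_left] using h1

theorem vec_eq_sum_single (v : Vec n) : v = ∑ x, v x • EuclideanSpace.single x (1 : ℝ) := by
  have := (EuclideanSpace.basisFun (Fin n × Fin n) ℝ).sum_repr v
  simpa using this.symm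

theorem norm_portProj_sq (v : Vec n) :
    ‖portProj n n₁ n₂ v‖ ^ 2
      = ∑ x, ∑ y, portProj n n₁ n₂ (EuclideanSpace.single y 1) x * (v x * v y) := by
  have h : ∀ x, portProj n n₁ n₂ v x
      = ∑ y, v y * portProj n n₁ n₂ (EuclideanSpace.single y 1) x := by
    intro x
    conv_lhs => rw [vec_eq_sum_single v, map_sum]
    simp
  rw [← inner_portProj_self, inner_vec]
  refine Finset.sum_congr rfl fun x _ => ?_
  rw [h, Finset.sum_mul]
  exact Finset.sum_congr rfl fun y _ => by ring

/-- The variance of a Bernoulli arrival at a saturated port. -/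
def satVariance (n : ℕ) (ε : ℝ) : ℝ := (1 - ε) / n * (1 - (1 - ε) / n)

theorem rate_mul_of_sat {ε : ℝ} {i j : Fin n} (h : i.val < n₁ ∨ j.val < n₂) :
    rate n n₁ n₂ ε i j * (1 - rate n n₁ n₂ ε i j) = satVariance n ε := by
  unfold rate satVariance; rw [if_neg (by omega)]

/-- The mean is the sum of the variances weighted by the diagonal of the projection. The diagonal
vanishes where both ports are unsaturated, and all remaining variances coincide, so the trace
factors out. -/
theorem arrivalMean_norm_portProj_sub_sq (hn₁ : n₁ < n) (hn₂ : n₂ < n) (ε : ℝ) :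
    arrivalMean (rate n n₁ n₂ ε)
        (fun a => ‖portProj n n₁ n₂ (arrVec a - rateVec (rate n n₁ n₂ ε))‖ ^ 2)
      = satVariance n ε * (n₁ + n₂) := by
  simp only [norm_portProj_sq, PiLp.sub_apply, arrVec_apply, rateVec_apply]
  rw [arrivalMean_quadratic _ fun x y => portProj n n₁ n₂ (EuclideanSpace.single y 1) x,
    ← sum_portProj_single hn₁ hn₂, Finset.mul_sum]
  refine Finset.sum_congr rfl fun x _ => ?_
  by_cases h : x.1.val < n₁ ∨ x.2.val < n₂
  · rw [rate_mul_of_sat h, mul_comm]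
  · rw [portProj_apply_eq_zero _ (by omega) (by omega)]; ring

theorem portProj_rateVec_zero_eq (hn : 0 < n) {s : Schedule n} (hs : s.IsMaximal) :
    portProj n n₁ n₂ (rateVec (rate n n₁ n₂ 0)) = portProj n n₁ n₂ (schedVec s) := by
  rw [← sub_eq_zero, ← map_sub, ← norm_eq_zero, ← sq_eq_zero_iff, ← inner_portProj_self,
    inner_sub_right, inner_rateVec_zero_of_mem hn (portProj_mem _),
    inner_schedVec_of_mem hn hs (portProj_mem _), sub_self]

/-- The second moment of the projected net arrivals. -/
def netVariance (n n₁ n₂ : ℕ) (ε : ℝ) : ℝ :=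
  satVariance n ε * (n₁ + n₂) + ε ^ 2 * ‖portProj n n₁ n₂ (rateVec (rate n n₁ n₂ 0))‖ ^ 2

/-- After projection `a - s` is the centred noise minus `ε` times the projected critical rates,
whichever maximal `s` is used, and the cross term has mean zero. -/
theorem arrivalMean_norm_portProj_net_sq (hn₁ : n₁ < n) (hn₂ : n₂ < n) (ε : ℝ) {s : Schedule n}
    (hs : s.IsMaximal) :
    arrivalMean (rate n n₁ n₂ ε) (fun a => ‖portProj n n₁ n₂ (arrVec a - schedVec s)‖ ^ 2)
      = netVariance n n₁ n₂ ε := by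
  have hn : 0 < n := by omega
  set lam := rate n n₁ n₂ ε with hlam
  set P := portProj n n₁ n₂ with hP
  set w := P (rateVec (rate n n₁ n₂ 0)) with hw
  have hfun : (fun a : Fin n → Fin n → Bool => ‖P (arrVec a - schedVec s)‖ ^ 2)
      = (fun a => ‖P (arrVec a - rateVec lam)‖ ^ 2)
        + ((-(2 * ε)) • (fun a => inner ℝ w (arrVec a))
          + fun _ => 2 * ε * inner ℝ w (rateVec lam) + ε ^ 2 * ‖w‖ ^ 2) := by
    funext a
    have h1 : P (arrVec a - schedVec s) = P (arrVec a - rateVec lam) - ε • w := by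
      rw [map_sub, map_sub, hlam, rateVec_rate, ← portProj_rateVec_zero_eq hn hs, map_smul, ← hP,
        ← hw]
      module
    have h2 : inner ℝ (P (arrVec a - rateVec lam)) w
        = inner ℝ w (arrVec a) - inner ℝ w (rateVec lam) := by
      rw [real_inner_comm, hw, hP, inner_portProj_portProj, inner_sub_right]
    rw [h1, norm_sub_sq_real, inner_smul_right, h2, norm_smul, mul_pow, Real.norm_eq_abs, sq_abs]
    simp only [Pi.add_apply, Pi.smul_apply, smul_eq_mul]
    ring
  rw [hfun, map_add, map_add, map_smul, arrivalMean_norm_portProj_sub_sq hn₁ hn₂,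
    arrivalMean_inner, arrivalMean_const, netVariance, smul_eq_mul]
  ring

/-- The number of saturated ports that a queue belongs to. -/
def portSum (n n₁ n₂ : ℕ) : Vec n := ∑ k, portVec n n₁ n₂ k

theorem portSum_mem : portSum n n₁ n₂ ∈ portSpace n n₁ n₂ :=
  Submodule.sum_mem _ fun k _ => portVec_mem k

theorem portSum_apply (x : Fin n × Fin n) :
    portSum n n₁ n₂ x = ∑ k, portVec n n₁ n₂ k x := by
  simp [portSum]

theorem portSum_nonneg (x : Fin n × Fin n) : 0 ≤ portSum n n₁ n₂ x := by
  rw [portSum_apply]; exact Finset.sum_nonneg fun k _ => portVec_nonneg k x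

theorem one_le_portSum {x : Fin n × Fin n} (h : x.1.val < n₁ ∨ x.2.val < n₂) :
    1 ≤ portSum n n₁ n₂ x := by
  rw [portSum_apply]
  rcases h with h | h
  · have := Finset.single_le_sum (f := fun k => portVec n n₁ n₂ k x)
      (fun k _ => portVec_nonneg k x) (Finset.mem_univ (.inl ⟨x.1, h⟩))
    simpa [portVec] using this
  · have := Finset.single_le_sum (f := fun k => portVec n n₁ n₂ k x)
      (fun k _ => portVec_nonneg k x) (Finset.mem_univ (.inr ⟨x.2, h⟩))
    simpa [portVec] using this

theorem sum_portSum (hn₁ : n₁ < n) (hn₂ : n₂ < n) :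
    ∑ x, portSum n n₁ n₂ x = n * (n₁ + n₂) := by
  simp only [portSum_apply]
  rw [Finset.sum_comm]
  simp only [sum_portVec, Finset.sum_const, Finset.card_univ, card_port hn₁ hn₂, nsmul_eq_mul]
  push_cast; ring

/-- The unused service at the saturated ports. -/
def portUnused (n₁ n₂ : ℕ) (q : QueueMatrix n) (a : Fin n → Fin n → Bool) (s : Schedule n) : ℝ :=
  inner ℝ (portSum n n₁ n₂) (unusedVec q a s)

theorem portUnused_nonneg (q : QueueMatrix n) (a : Fin n → Fin n → Bool) (s : Schedule n) :
    0 ≤ portUnused n₁ n₂ q a s := by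
  rw [portUnused, inner_vec]
  exact Finset.sum_nonneg fun x _ => mul_nonneg (portSum_nonneg x) (unusedVec_nonneg q a s x)

/-- The mean unused service is the decrease of the total queue length at the saturated ports. -/
theorem inner_portSum_add_arrivalMean_portUnused (hn₁ : n₁ < n) (hn₂ : n₂ < n) (ε : ℝ)
    (q : QueueMatrix n) {s : Schedule n} (hs : s.IsMaximal) :
    inner ℝ (portSum n n₁ n₂) (queueVec q)
        + arrivalMean (rate n n₁ n₂ ε) (fun a => portUnused n₁ n₂ q a s)
      = arrivalMean (rate n n₁ n₂ ε)
          (fun a => inner ℝ (portSum n n₁ n₂) (queueVec (nextQueue q a s))) + ε * (n₁ + n₂) := by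
  have hn : 0 < n := by omega
  have hn' : (n : ℝ) ≠ 0 := by positivity
  have hfun : (fun a => inner ℝ (portSum n n₁ n₂) (queueVec (nextQueue q a s)))
      = (fun a => inner ℝ (portSum n n₁ n₂) (arrVec a)) + ((fun a => portUnused n₁ n₂ q a s)
        + fun _ => inner ℝ (portSum n n₁ n₂) (queueVec q)
            - inner ℝ (portSum n n₁ n₂) (schedVec s)) := by
    funext a
    rw [queueVec_nextQueue, inner_add_right, inner_sub_right, inner_add_right]
    simp only [Pi.add_apply, portUnused]
    ring
  rw [hfun, map_add, map_add, arrivalMean_inner, arrivalMean_const, rateVec_rate,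
    inner_smul_right, inner_rateVec_zero_of_mem hn portSum_mem,
    inner_schedVec_of_mem hn hs portSum_mem, sum_portSum hn₁ hn₂]
  field_simp
  ring

/-- `‖P u‖² = ⟨P u, u⟩` only involves queues at saturated ports, where `u² = u ≤ portSum * u`;
Young's inequality then absorbs `‖P u‖² / 2`. -/
theorem norm_portProj_unusedVec_sq_le (q : QueueMatrix n) (a : Fin n → Fin n → Bool)
    (s : Schedule n) : ‖portProj n n₁ n₂ (unusedVec q a s)‖ ^ 2 ≤ portUnused n₁ n₂ q a s := by
  set u := unusedVec q a s with hu
  set w := portProj n n₁ n₂ u with hw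
  have h1 : ‖w‖ ^ 2 ≤ ‖w‖ ^ 2 / 2 + portUnused n₁ n₂ q a s / 2 := by
    conv_lhs => rw [hw, ← inner_portProj_self, ← hw, inner_vec]
    rw [norm_sq_vec, portUnused, inner_vec, ← hu, Finset.sum_div, Finset.sum_div,
      ← Finset.sum_add_distrib]
    refine Finset.sum_le_sum fun x _ => ?_
    have hu0 : 0 ≤ u x := unusedVec_nonneg q a s x
    have hu2 : u x ^ 2 = u x := unusedVec_sq q a s x
    by_cases h : x.1.val < n₁ ∨ x.2.val < n₂
    · have := mul_le_mul_of_nonneg_right (one_le_portSum h) hu0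
      nlinarith [sq_nonneg (w x - u x)]
    · rw [hw, portProj_apply_eq_zero _ (by omega) (by omega)]
      have := mul_nonneg (portSum_nonneg (n₁ := n₁) (n₂ := n₂) x) hu0
      linarith
  linarith

/-- Since `q⁺ u = 0` entrywise, `P q⁺` may be replaced by `-(q⁺ - P q⁺)`, which collapse keeps
bounded. Young's inequality with weight `η` separates it from `u`, using `u² = u`. -/
theorem abs_inner_portProj_unusedVec_le {η : ℝ} (hη : 0 < η) (q : QueueMatrix n)
    (a : Fin n → Fin n → Bool) (s : Schedule n) :
    |2 * inner ℝ (portProj n n₁ n₂ (queueVec (nextQueue q a s))) (unusedVec q a s)|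
      ≤ η * coneDist n₁ n₂ (nextQueue q a s) ^ 2 + 1 / η * portUnused n₁ n₂ q a s := by
  set u := unusedVec q a s with hu
  set v := queueVec (nextQueue q a s) with hv
  set w := portProj n n₁ n₂ v with hw
  have hd : ‖v - w‖ ^ 2 ≤ coneDist n₁ n₂ (nextQueue q a s) ^ 2 :=
    pow_le_pow_left₀ (norm_nonneg _) (norm_sub_portProj_le _) 2
  have h1 : |2 * inner ℝ w u| ≤ η * ‖v - w‖ ^ 2 + 1 / η * portUnused n₁ n₂ q a s := by
    rw [norm_sq_vec, portUnused, inner_vec, inner_vec, ← hu, Finset.mul_sum, Finset.mul_sum,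
      Finset.mul_sum, ← Finset.sum_add_distrib]
    refine (Finset.abs_sum_le_sum_abs _ _).trans (Finset.sum_le_sum fun x _ => ?_)
    have hu0 : 0 ≤ u x := unusedVec_nonneg q a s x
    have hu2 : u x ^ 2 = u x := unusedVec_sq q a s x
    have hc0 := portSum_nonneg (n₁ := n₁) (n₂ := n₂) x
    have hvu : v x * u x = 0 := queueVec_nextQueue_mul_unusedVec q a s x
    by_cases h : x.1.val < n₁ ∨ x.2.val < n₂
    · have hc := mul_le_mul_of_nonneg_right (one_le_portSum h) hu0
      have h2 : w x * u x = -((v - w) x * u x) := by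
        rw [PiLp.sub_apply, sub_mul, hvu]; ring
      have h3 : 1 / η * (1 * u x) ≤ 1 / η * (portSum n n₁ n₂ x * u x) := by gcongr
      have h4 : ∀ y : ℝ, 2 * (y * u x) ≤ η * y ^ 2 + 1 / η * u x := by
        intro y
        have h5 : η * y ^ 2 + 1 / η * u x ^ 2 - 2 * (y * u x) = (η * y - u x) ^ 2 / η := by
          field_simp; ring
        have h6 : 0 ≤ (η * y - u x) ^ 2 / η := by positivity
        rw [hu2] at h5
        linarith
      have h7 := h4 ((v - w) x)
      have h8 := h4 (-(v - w) x)
      rw [h2, abs_le]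
      constructor <;> nlinarith
    · rw [hw, portProj_apply_eq_zero _ (by omega) (by omega), ← hw]
      simp only [zero_mul, mul_zero, abs_zero]
      positivity
  refine h1.trans ?_
  gcongr

theorem abs_sum_portProj_sub_le (q : QueueMatrix n) :
    |∑ x, portProj n n₁ n₂ (queueVec q) x - ∑ x, queueVec q x| ≤ n ^ 2 * coneDist n₁ n₂ q := by
  rw [← Finset.sum_sub_distrib]
  refine (Finset.abs_sum_le_sum_abs _ _).trans ?_
  calc ∑ x, |portProj n n₁ n₂ (queueVec q) x - queueVec q x|
      ≤ ∑ _x : Fin n × Fin n, coneDist n₁ n₂ q := Finset.sum_le_sum fun x _ => by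
        rw [abs_sub_comm]
        exact (abs_apply_le_norm (queueVec q - portProj n n₁ n₂ (queueVec q)) x).trans
          (norm_sub_portProj_le q)
    _ = _ := by
        simp only [Finset.sum_const, Finset.card_univ, Fintype.card_prod, Fintype.card_fin,
          nsmul_eq_mul]
        push_cast; ring

/-- The drift of the squared norm of the projected queue lengths. -/
theorem abs_drift_norm_portProj_sq_le (hn₁ : n₁ < n) (hn₂ : n₂ < n) {ε η : ℝ} (hε : 0 ≤ ε)
    (hε1 : ε ≤ 1) (hη : 0 < η) (q : QueueMatrix n) {s : Schedule n} (hs : s.IsMaximal) :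
    |arrivalMean (rate n n₁ n₂ ε) (fun a => ‖portProj n n₁ n₂ (queueVec (nextQueue q a s))‖ ^ 2)
        + 2 * ε / n * ∑ x, queueVec q x
        - (‖portProj n n₁ n₂ (queueVec q)‖ ^ 2 + netVariance n n₁ n₂ ε)|
      ≤ 2 * ε * n * coneDist n₁ n₂ q + arrivalMean (rate n n₁ n₂ ε) (fun a =>
          η * coneDist n₁ n₂ (nextQueue q a s) ^ 2 + (1 / η + 1) * portUnused n₁ n₂ q a s) := by
  have hn : 0 < n := by omega
  have hn' : (0 : ℝ) < n := by positivity
  set lam := rate n n₁ n₂ ε with hlam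
  have h0 : ∀ i j, 0 ≤ lam i j := rate_nonneg hε1
  have h1 : ∀ i j, lam i j ≤ 1 := fun i j => (rate_le hε1 i j).trans (by linarith)
  set P := portProj n n₁ n₂ with hP
  set E : (Fin n → Fin n → Bool) → ℝ := fun a =>
    2 * inner ℝ (P (queueVec (nextQueue q a s))) (unusedVec q a s) - ‖P (unusedVec q a s)‖ ^ 2
    with hE
  set err : (Fin n → Fin n → Bool) → ℝ := fun a =>
    η * coneDist n₁ n₂ (nextQueue q a s) ^ 2 + (1 / η + 1) * portUnused n₁ n₂ q a s with herr
  have hEerr : ∀ a, |E a| ≤ err a := fun a => by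
    have h2 := abs_inner_portProj_unusedVec_le (n₁ := n₁) (n₂ := n₂) hη q a s
    have h3 := norm_portProj_unusedVec_sq_le (n₁ := n₁) (n₂ := n₂) q a s
    have h4 := abs_sub (2 * inner ℝ (P (queueVec (nextQueue q a s))) (unusedVec q a s))
      (‖P (unusedVec q a s)‖ ^ 2)
    rw [abs_of_nonneg (sq_nonneg ‖P (unusedVec q a s)‖)] at h4
    simp only [hE, herr]
    linarith
  have hmeanE : |arrivalMean lam E| ≤ arrivalMean lam err := by
    refine abs_le.2 ⟨?_, arrivalMean_mono h0 h1 fun a => (le_abs_self _).trans (hEerr a)⟩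
    rw [← map_neg]
    exact arrivalMean_mono h0 h1 fun a => (neg_le_neg (hEerr a)).trans (neg_abs_le _)
  have hfun : (fun a => ‖P (queueVec (nextQueue q a s))‖ ^ 2)
      = E + ((2 : ℝ) • (fun a => inner ℝ (P (queueVec q)) (arrVec a))
        + ((fun a => ‖P (arrVec a - schedVec s)‖ ^ 2)
          + fun _ => ‖P (queueVec q)‖ ^ 2 - 2 * inner ℝ (P (queueVec q)) (schedVec s))) := by
    funext a
    set v := queueVec (nextQueue q a s) with hv
    set u := unusedVec q a s with hu
    -- Comparing the squared norms of the two sides isolates `‖P q⁺‖²`; the terms containing the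
    -- unused service are those collected in `E`.
    have h2 : P v - P u = P (queueVec q) + P (arrVec a - schedVec s) := by
      rw [← map_sub, ← map_add, hv, queueVec_nextQueue]
      congr 1; rw [← hu]; abel
    have h3 := congrArg (fun w => ‖w‖ ^ 2) h2
    simp only [norm_sub_sq_real, norm_add_sq_real] at h3
    rw [inner_portProj_portProj, inner_portProj_portProj, inner_sub_right] at h3
    simp only [Pi.add_apply, Pi.smul_apply, smul_eq_mul, hE, ← hu, ← hv]
    linarith
  have hdrift : inner ℝ (P (queueVec q)) (rateVec lam) - inner ℝ (P (queueVec q)) (schedVec s)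
      = -(ε / n * ∑ x, P (queueVec q) x) := by
    rw [hlam, rateVec_rate, inner_smul_right, inner_rateVec_zero_of_mem hn (portProj_mem _),
      inner_schedVec_of_mem hn hs (portProj_mem _)]
    ring
  rw [hfun, map_add, map_add, map_add, map_smul, arrivalMean_inner,
    arrivalMean_norm_portProj_net_sq hn₁ hn₂ ε hs, arrivalMean_const, smul_eq_mul]
  have hsum := abs_sum_portProj_sub_le (n₁ := n₁) (n₂ := n₂) q
  have h5 : 2 * ε / n * (n ^ 2 * coneDist n₁ n₂ q) = 2 * ε * n * coneDist n₁ n₂ q := by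
    field_simp
  have h6 : |2 * ε / n * (∑ x, P (queueVec q) x - ∑ x, queueVec q x)|
      ≤ 2 * ε * n * coneDist n₁ n₂ q := by
    rw [abs_mul, abs_of_nonneg (by positivity), ← h5]
    gcongr
  have h7 : arrivalMean lam E + (2 * inner ℝ (P (queueVec q)) (rateVec lam) +
      (netVariance n n₁ n₂ ε + (‖P (queueVec q)‖ ^ 2 - 2 * inner ℝ (P (queueVec q)) (schedVec s))))
      + 2 * ε / n * ∑ x, queueVec q x - (‖P (queueVec q)‖ ^ 2 + netVariance n n₁ n₂ ε)
      = arrivalMean lam E - 2 * ε / n * (∑ x, P (queueVec q) x - ∑ x, queueVec q x) := by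
    linear_combination 2 * hdrift
  rw [h7]
  refine (abs_sub _ _).trans ?_
  linarith

end Projection

/-! ### MaxWeight as an ergodic Markov chain -/

section MaxWeight

variable {n n₁ n₂ : ℕ}

/-- The transition law of the queue lengths when the schedule is picked by a stationary rule. -/
def ruleKernel (rule : QueueMatrix n → PMF (Schedule n)) (lam : Fin n → Fin n → ℝ)
    (q : QueueMatrix n) : PMF (QueueMatrix n) :=
  (rule q).bind fun s => (arrivalLaw lam).map fun a => nextQueue q a s

theorem mean_ruleKernel (rule : QueueMatrix n → PMF (Schedule n)) (lam : Fin n → Fin n → ℝ)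
    (q : QueueMatrix n) (f : QueueMatrix n → ℝ≥0∞) :
    mean (ruleKernel rule lam q) f
      = mean (rule q) fun s => mean (arrivalLaw lam) fun a => f (nextQueue q a s) := by
  simp only [ruleKernel, mean_bind, mean_map]

/-- The rule ignores the history, so forgetting the history commutes with each step. -/
theorem queueLaw_eq_bind_kernelPow {P : Policy n} {rule : QueueMatrix n → PMF (Schedule n)}
    (hP : ∀ h q, P h q = rule q) (lam : Fin n → Fin n → ℝ) (init : PMF (QueueMatrix n)) (t : ℕ) :
    queueLaw P lam init t = init.bind (kernelPow (ruleKernel rule lam) t) := by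
  induction t with
  | zero =>
    have h1 : kernelPow (ruleKernel rule lam) 0 = PMF.pure := by funext x; rfl
    rw [h1, PMF.bind_pure, queueLaw, trajectoryLaw, PMF.map_comp]
    exact PMF.map_id init
  | succ t ih =>
    have h1 : kernelPow (ruleKernel rule lam) (t + 1)
        = fun x => (kernelPow (ruleKernel rule lam) t x).bind (ruleKernel rule lam) := by
      funext x; rw [kernelPow_bind]
    rw [h1, ← PMF.bind_bind, ← ih, queueLaw, queueLaw, trajectoryLaw, PMF.map_bind, PMF.bind_map]
    congr 1
    funext x
    simp only [step, Function.comp_apply, ruleKernel, hP, PMF.map_bind, PMF.map_comp]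
    rfl

/-- Portmanteau theorem: indicators of open sets are sufficient test functions. -/
theorem convergesInLaw_of_le_liminf {P : Policy n} {lam : Fin n → Fin n → ℝ}
    {init π : PMF (QueueMatrix n)}
    (h : ∀ f : QueueMatrix n → ℝ≥0∞, (∀ q, f q ≤ 1) →
      mean π f ≤ liminf (fun t => mean (queueLaw P lam init t) f) atTop) :
    ConvergesInLaw P lam init π := by
  refine tendsto_of_forall_isOpen_le_liminf' fun G _ => ?_
  have hm : ∀ p : PMF (QueueMatrix n),
      (toProbabilityMeasure p : Measure (QueueMatrix n)) G = mean p (G.indicator 1) := by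
    intro p
    rw [← lintegral_toMeasure_eq_mean, lintegral_indicator_one (MeasurableSet.of_discrete)]
    rfl
  simp only [hm]
  exact h _ fun q => Set.indicator_le_self' (fun _ _ => zero_le) q

theorem mean_rule_arrivalLaw_mono {rule : QueueMatrix n → PMF (Schedule n)}
    {lam : Fin n → Fin n → ℝ} (h0 : ∀ i j, 0 ≤ lam i j) (h1 : ∀ i j, lam i j ≤ 1)
    {q : QueueMatrix n} {F G : Schedule n → (Fin n → Fin n → Bool) → ℝ} (hF : ∀ s a, 0 ≤ F s a)
    (hG : ∀ s a, 0 ≤ G s a)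
    (h : ∀ s ∈ (rule q).support, arrivalMean lam (F s) ≤ arrivalMean lam (G s)) :
    (mean (rule q) fun s => mean (arrivalLaw lam) fun a => ENNReal.ofReal (F s a))
      ≤ mean (rule q) fun s => mean (arrivalLaw lam) fun a => ENNReal.ofReal (G s a) := by
  refine mean_mono_support fun s hs => ?_
  rw [mean_arrivalLaw h0 h1 (hF s), mean_arrivalLaw h0 h1 (hG s)]
  exact ENNReal.ofReal_le_ofReal (h s hs)

/-- The steady-state expectation of a function of the queue lengths, the schedule and the arrivals
of one slot. -/
def slotMean (rule : QueueMatrix n → PMF (Schedule n)) (lam : Fin n → Fin n → ℝ)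
    (π : PMF (QueueMatrix n))
    (Φ : QueueMatrix n → Schedule n → (Fin n → Fin n → Bool) → ℝ) : ℝ≥0∞ :=
  mean π fun q => mean (rule q) fun s => mean (arrivalLaw lam) fun a => ENNReal.ofReal (Φ q s a)

/-- Integration of a one-slot inequality in steady state. -/
theorem slotMean_le_slotMean {rule : QueueMatrix n → PMF (Schedule n)}
    {lam : Fin n → Fin n → ℝ} (h0 : ∀ i j, 0 ≤ lam i j) (h1 : ∀ i j, lam i j ≤ 1)
    {π : PMF (QueueMatrix n)} (hπ : π.bind (ruleKernel rule lam) = π)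
    {F₁ F₂ G₁ G₂ : QueueMatrix n → ℝ}
    {Φ₁ Φ₂ : QueueMatrix n → Schedule n → (Fin n → Fin n → Bool) → ℝ}
    (hF₁ : ∀ q, 0 ≤ F₁ q) (hF₂ : ∀ q, 0 ≤ F₂ q) (hG₁ : ∀ q, 0 ≤ G₁ q) (hG₂ : ∀ q, 0 ≤ G₂ q)
    (hΦ₁ : ∀ q s a, 0 ≤ Φ₁ q s a) (hΦ₂ : ∀ q s a, 0 ≤ Φ₂ q s a)
    (h : ∀ q, ∀ s ∈ (rule q).support,
      arrivalMean lam (fun a => F₁ (nextQueue q a s) + Φ₁ q s a) + G₁ q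
        ≤ arrivalMean lam (fun a => F₂ (nextQueue q a s) + Φ₂ q s a) + G₂ q) :
    (mean π fun q => ENNReal.ofReal (F₁ q)) + slotMean rule lam π Φ₁
        + (mean π fun q => ENNReal.ofReal (G₁ q))
      ≤ (mean π fun q => ENNReal.ofReal (F₂ q)) + slotMean rule lam π Φ₂
        + mean π fun q => ENNReal.ofReal (G₂ q) := by
  -- By stationarity the mean of `F` may be taken one slot later, under the same expectation as `Φ`
  -- and `G`. Keeping all terms nonnegative on their own side avoids subtraction in `[0, ∞]`.
  have hsplit : ∀ (F G : QueueMatrix n → ℝ)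
      (Φ : QueueMatrix n → Schedule n → (Fin n → Fin n → Bool) → ℝ), (∀ q, 0 ≤ F q) →
      (∀ q, 0 ≤ G q) → (∀ q s a, 0 ≤ Φ q s a) →
      (mean π fun q => ENNReal.ofReal (F q)) + slotMean rule lam π Φ
        + (mean π fun q => ENNReal.ofReal (G q))
      = mean π fun q => mean (rule q) fun s => mean (arrivalLaw lam) fun a =>
          ENNReal.ofReal (F (nextQueue q a s) + Φ q s a + G q) := by
    intro F G Φ hF hG hΦ
    conv_lhs => rw [← hπ]
    rw [mean_bind]
    simp only [slotMean, mean_ruleKernel]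
    simp only [ENNReal.ofReal_add (add_nonneg (hF _) (hΦ _ _ _)) (hG _),
      ENNReal.ofReal_add (hF _) (hΦ _ _ _), mean_add, mean_const]
    rw [hπ]
  rw [hsplit F₁ G₁ Φ₁ hF₁ hG₁ hΦ₁, hsplit F₂ G₂ Φ₂ hF₂ hG₂ hΦ₂]
  refine mean_mono fun q => mean_rule_arrivalLaw_mono h0 h1
    (fun s a => add_nonneg (add_nonneg (hF₁ _) (hΦ₁ _ _ _)) (hG₁ _))
    (fun s a => add_nonneg (add_nonneg (hF₂ _) (hΦ₂ _ _ _)) (hG₂ _)) fun s hs => ?_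
  have hadd : ∀ (F : (Fin n → Fin n → Bool) → ℝ) (c : ℝ),
      arrivalMean lam (fun a => F a + c) = arrivalMean lam F + c := by
    intro F c
    rw [← arrivalMean_const lam c, ← map_add, arrivalMean_const]
    rfl
  rw [hadd, hadd]
  exact h q s hs

theorem mean_ruleKernel_drift {rule : QueueMatrix n → PMF (Schedule n)}
    {lam : Fin n → Fin n → ℝ} (h0 : ∀ i j, 0 ≤ lam i j) (h1 : ∀ i j, lam i j ≤ 1)
    {V f : QueueMatrix n → ℝ} {b : ℝ} (hV : ∀ q, 0 ≤ V q) (hf : ∀ q, 0 ≤ f q) (hb : 0 ≤ b)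
    {q : QueueMatrix n}
    (h : ∀ s ∈ (rule q).support,
      arrivalMean lam (fun a => V (nextQueue q a s)) ≤ V q - f q + b) :
    mean (ruleKernel rule lam q) (fun q => ENNReal.ofReal (V q)) + ENNReal.ofReal (f q)
      ≤ ENNReal.ofReal (V q) + ENNReal.ofReal b := by
  rw [mean_ruleKernel, ← ENNReal.ofReal_add (hV q) hb]
  calc _ = mean (rule q) fun s => ENNReal.ofReal (arrivalMean lam (fun a => V (nextQueue q a s)))
          + ENNReal.ofReal (f q) := by
        rw [mean_add, mean_const]
        congr 2
        funext s
        exact mean_arrivalLaw h0 h1 fun a => hV _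
    _ ≤ mean (rule q) fun _ => ENNReal.ofReal (V q + b) := by
        refine mean_mono_support fun s hs => ?_
        have h2 : 0 ≤ arrivalMean lam (fun a => V (nextQueue q a s)) := by
          rw [← arrivalMean_const lam 0]
          exact arrivalMean_mono h0 h1 fun a => hV _
        rw [← ENNReal.ofReal_add h2 (hf q)]
        exact ENNReal.ofReal_le_ofReal (by linarith [h s hs])
    _ = _ := mean_const _ _

/-- A schedule of maximal weight serves a nonempty queue unless all queues are empty. -/
theorem exists_served {q : QueueMatrix n} {s : Schedule n}
    (hs : ∀ s' : Schedule n, s'.weight q ≤ s.weight q) {i j : Fin n} (hij : 0 < q i j) :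
    ∃ i' j', 0 < q i' j' ∧ s.1 i' j' = 1 := by
  by_contra! hne
  have h0 : s.weight q = 0 := by
    refine Finset.sum_eq_zero fun i' _ => Finset.sum_eq_zero fun j' _ => ?_
    rcases Nat.eq_zero_or_pos (q i' j') with h | h
    · simp [h]
    · have h1 := hne i' j' h
      have h2 := schedule_le_one s i' j'
      have h3 : s.1 i' j' = 0 := by omega
      simp [h3]
  -- The transposition serves merely as a permutation mapping `i` to `j`.
  have h1 := hs (permSchedule (Equiv.swap i j))
  have h2 : q i j ≤ (permSchedule (Equiv.swap i j)).weight q := by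
    have h3 := Finset.single_le_sum
      (f := fun i' => ∑ j', q i' j' * (permSchedule (Equiv.swap i j)).1 i' j')
      (fun _ _ => Nat.zero_le _) (Finset.mem_univ i)
    have h4 := Finset.single_le_sum
      (f := fun j' => q i j' * (permSchedule (Equiv.swap i j)).1 i j')
      (fun _ _ => Nat.zero_le _) (Finset.mem_univ j)
    have h5 : (permSchedule (Equiv.swap i j)).1 i j = 1 := by simp [permSchedule]
    simp only [h5, mul_one] at h4
    exact h4.trans h3
  omega

/-- The total number of packets. -/
def totalQueue (q : QueueMatrix n) : ℕ := ∑ x : Fin n × Fin n, q x.1 x.2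

/-- Without arrivals a nonempty switch loses a packet; the empty one is covered by `0 - 1 = 0`. This
is the downward step of the coupling. -/
theorem totalQueue_nextQueue_le {q : QueueMatrix n} {s : Schedule n}
    (hs : ∀ s' : Schedule n, s'.weight q ≤ s.weight q) :
    totalQueue (nextQueue q (fun _ _ => false) s) ≤ totalQueue q - 1 := by
  have hle : ∀ x : Fin n × Fin n, nextQueue q (fun _ _ => false) s x.1 x.2 ≤ q x.1 x.2 := by
    intro x; simp [nextQueue]
  by_cases h : ∃ i j, 0 < q i j
  · obtain ⟨i, j, hij⟩ := h
    obtain ⟨i', j', hq, hs'⟩ := exists_served hs hij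
    refine Nat.le_sub_one_of_lt (Finset.sum_lt_sum (fun x _ => hle x) ⟨(i', j'), Finset.mem_univ _, ?_⟩)
    simp only [nextQueue, hs', Bool.toNat_false]
    omega
  · push Not at h
    have : totalQueue (nextQueue q (fun _ _ => false) s) = 0 :=
      Finset.sum_eq_zero fun x _ => by have := hle x; have := h x.1 x.2; omega
    omega

theorem sum_queueVec (q : QueueMatrix n) : ∑ x, queueVec q x = (totalQueue q : ℝ) := by
  simp [totalQueue]

theorem totalQueue_le_norm (q : QueueMatrix n) : (totalQueue q : ℝ) ≤ n ^ 2 * ‖queueVec q‖ := by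
  rw [← sum_queueVec]
  calc ∑ x, queueVec q x ≤ ∑ _x : Fin n × Fin n, ‖queueVec q‖ :=
        Finset.sum_le_sum fun x _ => (le_abs_self _).trans (abs_apply_le_norm _ x)
    _ = _ := by
        simp only [Finset.sum_const, Finset.card_univ, Fintype.card_prod, Fintype.card_fin,
          nsmul_eq_mul]
        push_cast; ring

theorem finite_setOf_norm_queueVec_le (r : ℝ) : {q : QueueMatrix n | ‖queueVec q‖ ≤ r}.Finite := by
  refine (Set.finite_Iic (fun _ _ => ⌈r⌉₊ : QueueMatrix n)).subset fun q hq i j => ?_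
  have h1 : (q i j : ℝ) ≤ r :=
    ((le_abs_self _).trans (abs_apply_le_norm (queueVec q) (i, j))).trans hq
  exact_mod_cast h1.trans (Nat.le_ceil r)

/-- The rule picks maximal schedules of maximal weight. -/
def IsMaxWeightRule (rule : QueueMatrix n → PMF (Schedule n)) : Prop :=
  ∀ q, ∀ s ∈ (rule q).support, s.IsMaximal ∧ ∀ s' : Schedule n, s'.weight q ≤ s.weight q

theorem arrivalWeight_zero_pos {ε : ℝ} (hε : 0 < ε) (hε1 : ε ≤ 1) :
    0 < arrivalWeight (rate n n₁ n₂ ε) fun _ _ => false := by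
  refine Finset.prod_pos fun i _ => Finset.prod_pos fun j _ => ?_
  have := rate_le (n₁ := n₁) (n₂ := n₂) hε1 i j
  simp only [Bool.false_eq_true, if_false]
  linarith

theorem arrivalWeight_le_one {lam : Fin n → Fin n → ℝ} (h0 : ∀ i j, 0 ≤ lam i j)
    (h1 : ∀ i j, lam i j ≤ 1) (a : Fin n → Fin n → Bool) : arrivalWeight lam a ≤ 1 := by
  have h2 := arrivalLaw_apply h0 h1 a
  have h3 := PMF.coe_le_one (arrivalLaw lam) a
  rw [h2, ENNReal.ofReal_le_one] at h3
  exact h3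

/-- Positive recurrence and ergodicity of the queue lengths under MaxWeight. -/
theorem exists_steadyState (hn₁ : n₁ < n) (hn₂ : n₂ < n)
    {rule : QueueMatrix n → PMF (Schedule n)} (hrule : IsMaxWeightRule rule) {ε : ℝ} (hε : 0 < ε)
    (hε1 : ε ≤ 1) :
    ∃ π : PMF (QueueMatrix n), π.bind (ruleKernel rule (rate n n₁ n₂ ε)) = π ∧
      (∀ ν : PMF (QueueMatrix n), ∀ f : QueueMatrix n → ℝ≥0∞, (∀ q, f q ≤ 1) → mean π f ≤
        liminf (fun t => mean (ν.bind (kernelPow (ruleKernel rule (rate n n₁ n₂ ε)) t)) f) atTop) ∧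
      ∀ (V f : QueueMatrix n → ℝ) (b : ℝ), (∀ q, 0 ≤ V q) → (∀ q, 0 ≤ f q) → 0 ≤ b →
        (∀ q, ∀ s ∈ (rule q).support,
          arrivalMean (rate n n₁ n₂ ε) (fun a => V (nextQueue q a s)) ≤ V q - f q + b) →
        mean π (fun q => ENNReal.ofReal (f q)) ≤ ENNReal.ofReal b := by
  have hn : 0 < n := by omega
  have hn' : (0 : ℝ) < n := by positivity
  set lam := rate n n₁ n₂ ε with hlam
  have h0 : ∀ i j, 0 ≤ lam i j := rate_nonneg hε1
  have h1 : ∀ i j, lam i j ≤ 1 := fun i j => (rate_le hε1 i j).trans (by linarith)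
  set K := ruleKernel rule lam with hK
  set V : QueueMatrix n → ℝ≥0∞ := fun q => ENNReal.ofReal (‖queueVec q‖ ^ 2) with hV
  set f : QueueMatrix n → ℝ≥0∞ := fun q => ENNReal.ofReal (ε / n * ‖queueVec q‖) with hf
  have hdrift : ∀ q, mean (K q) V + f q ≤ V q + ENNReal.ofReal ((n : ℝ) ^ 2) := fun q =>
    mean_ruleKernel_drift (V := fun q => ‖queueVec q‖ ^ 2) (f := fun q => ε / n * ‖queueVec q‖)
      h0 h1 (fun q => by positivity) (fun q => by positivity) (by positivity)
      fun s hs => arrivalMean_norm_sq_le hn₁ hn₂ hε.le hε1 (hrule q s hs).2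
  have hfin : ∀ r : ℕ, {q | f q ≤ r}.Finite := by
    intro r
    refine (finite_setOf_norm_queueVec_le (r / (ε / n))).subset fun q hq => ?_
    have h2 : ENNReal.ofReal (ε / n * ‖queueVec q‖) ≤ r := hq
    rw [← ENNReal.ofReal_natCast, ENNReal.ofReal_le_ofReal_iff (Nat.cast_nonneg r)] at h2
    change ‖queueVec q‖ ≤ r / (ε / n)
    rw [le_div_iff₀ (by positivity), mul_comm]
    exact h2
  obtain ⟨π, hπ, hmom⟩ := exists_invariant_of_drift K (V := V) (f := f) ENNReal.ofReal_ne_top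
    (fun _ _ => 0) ENNReal.ofReal_ne_top hdrift hfin
  refine ⟨π, hπ, fun ν g hg => ?_, fun V' f' b' hV' hf' hb' h' => ?_⟩
  · refine mean_le_liminf_of_uncoupled K hπ (fun x y => ?_) ν hg
    -- Since the total is at most `n² ‖q‖`, more than `R` packets force `(ε / n) ‖q‖ ≥ 2 n² + 1`.
    -- The level drops at least with the probability `ρ` of a slot without arrivals.
    obtain ⟨R, hR⟩ := exists_nat_ge (n ^ 2 * ((2 * (n : ℝ) ^ 2 + 1) / (ε / n)))
    refine tendsto_uncoupled_of_drift K (V := V) (f := f) (b := (n : ℝ) ^ 2) (ℓ := totalQueue)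
      (R := R) (ρ := arrivalWeight lam fun _ _ => false) (fun _ => ENNReal.ofReal_ne_top) hdrift
      (by positivity) (fun q => ?_) (arrivalWeight_zero_pos hε hε1)
      (arrivalWeight_le_one h0 h1 _) (fun q => ?_) (fun q q' hq hq' => ?_) x y
    · by_cases hq : totalQueue q ≤ R
      · exact Or.inl hq
      · refine Or.inr (ENNReal.ofReal_le_ofReal ?_)
        have h2 : (R : ℝ) ≤ totalQueue q := by exact_mod_cast (not_le.1 hq).le
        have h3 := (hR.trans h2).trans (totalQueue_le_norm q)
        have h4 := le_of_mul_le_mul_left h3 (by positivity)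
        rw [div_le_iff₀ (by positivity)] at h4
        linarith
    · rw [hK, mean_ruleKernel, ← mean_const (rule q) (ENNReal.ofReal _)]
      refine mean_mono_support fun s hs => ?_
      rw [← arrivalLaw_apply h0 h1, mean]
      refine le_trans ?_ (ENNReal.le_tsum fun _ _ => false)
      rw [if_pos (totalQueue_nextQueue_le (hrule q s hs).2), mul_one]
    · have hz : ∀ p : QueueMatrix n, totalQueue p = 0 → ∀ i j, p i j = 0 := fun p hp i j =>
        (Finset.sum_eq_zero_iff.1 hp) (i, j) (Finset.mem_univ _)
      funext i j
      rw [hz q hq, hz q' hq']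
  · exact hmom (fun q => ENNReal.ofReal (V' q)) (fun q => ENNReal.ofReal (f' q)) _
      ENNReal.ofReal_ne_top (fun _ => ENNReal.ofReal_ne_top)
      fun q => mean_ruleKernel_drift h0 h1 hV' hf' hb' (h' q)

end MaxWeight

/-! ### Heavy-traffic limits -/

section HeavyTraffic

variable {n n₁ n₂ : ℕ}

theorem mean_ofReal_add {X : Type*} (p : PMF X) {F G : X → ℝ} (hF : ∀ x, 0 ≤ F x)
    (hG : ∀ x, 0 ≤ G x) :
    mean p (fun x => ENNReal.ofReal (F x + G x))
      = mean p (fun x => ENNReal.ofReal (F x)) + mean p (fun x => ENNReal.ofReal (G x)) := by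
  rw [← mean_add]
  congr 1
  funext x
  exact ENNReal.ofReal_add (hF x) (hG x)

theorem mean_ofReal_const_mul {X : Type*} (p : PMF X) {c : ℝ} (hc : 0 ≤ c) (F : X → ℝ) :
    mean p (fun x => ENNReal.ofReal (c * F x))
      = ENNReal.ofReal c * mean p (fun x => ENNReal.ofReal (F x)) := by
  rw [← mean_const_mul]
  congr 1
  funext x
  exact ENNReal.ofReal_mul hc

theorem slotMean_const_mul (rule : QueueMatrix n → PMF (Schedule n)) (lam : Fin n → Fin n → ℝ)
    (π : PMF (QueueMatrix n)) {c : ℝ} (hc : 0 ≤ c)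
    (Φ : QueueMatrix n → Schedule n → (Fin n → Fin n → Bool) → ℝ) :
    slotMean rule lam π (fun q s a => c * Φ q s a)
      = ENNReal.ofReal c * slotMean rule lam π Φ := by
  simp only [slotMean, ENNReal.ofReal_mul hc, mean_const_mul]

theorem slotMean_zero (rule : QueueMatrix n → PMF (Schedule n)) (lam : Fin n → Fin n → ℝ)
    (π : PMF (QueueMatrix n)) : slotMean rule lam π (fun _ _ _ => 0) = 0 := by
  simp only [slotMean, mean_const, ENNReal.ofReal_zero]

theorem meanTotal_eq_mean_sum (π : PMF (QueueMatrix n)) :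
    meanTotal π = mean π fun q => ENNReal.ofReal (∑ x, queueVec q x) := by
  rw [meanTotal_eq_mean]
  congr 1
  funext q
  rw [sum_queueVec, ENNReal.ofReal_natCast, totalQueue, Fintype.sum_prod_type]
  push_cast
  rfl

theorem satVariance_nonneg (hn : 0 < n) {ε : ℝ} (hε : 0 ≤ ε) (hε1 : ε ≤ 1) :
    0 ≤ satVariance n ε := by
  have hn' : (1 : ℝ) ≤ n := by exact_mod_cast hn
  have h1 : (1 - ε) / n ≤ 1 := (div_le_one (by linarith)).2 (by linarith)
  have h2 : 0 ≤ (1 - ε) / n := div_nonneg (by linarith) (by linarith)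
  exact mul_nonneg h2 (by linarith)

theorem netVariance_nonneg (hn : 0 < n) {ε : ℝ} (hε : 0 ≤ ε) (hε1 : ε ≤ 1) :
    0 ≤ netVariance n n₁ n₂ ε := by
  have := satVariance_nonneg hn hε hε1
  unfold netVariance
  positivity

/-- The uniform bound on the steady-state mean squared distance to the cone. -/
def collapseBound (n : ℕ) : ℝ :=
  ((3 / 2 * ((n : ℝ) ^ 2 + (n : ℝ) ^ 2)) ^ 2 / (2 * (1 / (2 * n ^ 2))) + (n : ℝ) ^ 3)
    / (1 / (2 * n ^ 2))

theorem collapseBound_nonneg (n : ℕ) : 0 ≤ collapseBound n := by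
  unfold collapseBound; positivity

/-- The error in the heavy-traffic approximation. -/
def heavyTrafficError (n n₁ n₂ : ℕ) (ε : ℝ) : ℝ :=
  Real.sqrt ε * collapseBound n + (1 / Real.sqrt ε + 1) * (ε * (n₁ + n₂))
    + 2 * ε * n * (1 + collapseBound n)

/-- The steady-state mean of the total queue length under MaxWeight, up to a vanishing error. -/
theorem steadyState_bounds (hn₁ : n₁ < n) (hn₂ : n₂ < n)
    {rule : QueueMatrix n → PMF (Schedule n)} (hrule : IsMaxWeightRule rule) {ε : ℝ} (hε : 0 < ε)
    (hε1 : ε ≤ 1 / (4 * n ^ 2)) {π : PMF (QueueMatrix n)}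
    (hπ : π.bind (ruleKernel rule (rate n n₁ n₂ ε)) = π)
    (hmom : ∀ (V f : QueueMatrix n → ℝ) (b : ℝ), (∀ q, 0 ≤ V q) → (∀ q, 0 ≤ f q) → 0 ≤ b →
      (∀ q, ∀ s ∈ (rule q).support,
        arrivalMean (rate n n₁ n₂ ε) (fun a => V (nextQueue q a s)) ≤ V q - f q + b) →
      mean π (fun q => ENNReal.ofReal (f q)) ≤ ENNReal.ofReal b) :
    ENNReal.ofReal (2 * ε / n) * meanTotal π
        ≤ ENNReal.ofReal (netVariance n n₁ n₂ ε + heavyTrafficError n n₁ n₂ ε) ∧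
      ENNReal.ofReal (netVariance n n₁ n₂ ε)
        ≤ ENNReal.ofReal (2 * ε / n) * meanTotal π
          + ENNReal.ofReal (heavyTrafficError n n₁ n₂ ε) := by
  have hn : 0 < n := by omega
  have hn' : (1 : ℝ) ≤ n := by exact_mod_cast hn
  have hε2 : ε ≤ 1 := hε1.trans ((div_le_one (by positivity)).2 (by nlinarith))
  set lam := rate n n₁ n₂ ε with hlam
  have h0 : ∀ i j, 0 ≤ lam i j := rate_nonneg hε2
  have h1 : ∀ i j, lam i j ≤ 1 := fun i j => (rate_le hε2 i j).trans (by linarith)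
  -- This balances `η` times the collapse bound against `1 / η` times the unused service, which is
  -- of order `ε`.
  set η := Real.sqrt ε with hη
  have hη0 : 0 < η := Real.sqrt_pos.2 hε
  set κ := netVariance n n₁ n₂ ε with hκ
  have hκ0 : 0 ≤ κ := netVariance_nonneg hn hε.le hε2
  set C := collapseBound n with hC
  have hC0 : 0 ≤ C := collapseBound_nonneg n
  set pm : (QueueMatrix n → ℝ) → ℝ≥0∞ := fun F => mean π fun q => ENNReal.ofReal (F q) with hpm
  -- second moments
  have hnorm : pm (fun q => ‖queueVec q‖ ^ 2) < ∞ := by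
    have h2 := hmom (fun q => ‖queueVec q‖ ^ 3) (fun q => ε / n * ‖queueVec q‖ ^ 2)
      ((3 / 2 * ((n : ℝ) ^ 2 + (n : ℝ) ^ 2)) ^ 2 / (2 * (ε / n)) + (n : ℝ) ^ 3)
      (fun q => by positivity) (fun q => by positivity) (by positivity) fun q s hs =>
        arrivalMean_pow_three_le h0 h1 (norm_nonneg _) (by positivity)
          (fun a => (abs_norm_sub_norm_le _ _).trans (norm_queueVec_nextQueue_sub_le q a s))
          (arrivalMean_norm_sq_le hn₁ hn₂ hε.le hε2 (hrule q s hs).2)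
    rw [mean_ofReal_const_mul π (by positivity)] at h2
    have h3 := h2.trans_lt ENNReal.ofReal_lt_top
    by_contra h4
    rw [not_lt, top_le_iff] at h4
    simp only [hpm] at h4
    rw [h4, ENNReal.mul_top (by simp; positivity)] at h3
    exact lt_irrefl _ h3
  -- The negative drift `1 / (2n²)` does not depend on `ε`, so neither does this bound.
  have hd2 : pm (fun q => coneDist n₁ n₂ q ^ 2) ≤ ENNReal.ofReal C := by
    have hδ : (0 : ℝ) < 1 / (2 * n ^ 2) := by positivity
    have h2 := hmom (fun q => coneDist n₁ n₂ q ^ 3) (fun q => 1 / (2 * n ^ 2) * coneDist n₁ n₂ q ^ 2)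
      ((3 / 2 * ((n : ℝ) ^ 2 + (n : ℝ) ^ 2)) ^ 2 / (2 * (1 / (2 * n ^ 2))) + (n : ℝ) ^ 3)
      (fun q => pow_nonneg (coneDist_nonneg q) 3) (fun q => by positivity) (by positivity)
      fun q s hs =>
        arrivalMean_pow_three_le h0 h1 (coneDist_nonneg _) (by positivity)
          (fun a => abs_coneDist_nextQueue_sub_le q a s)
          (arrivalMean_coneDist_sq_le hn₁ hn₂ hε.le hε1 (hrule q s hs).1 (hrule q s hs).2)
    rw [mean_ofReal_const_mul π hδ.le] at h2
    rw [hC, collapseBound, ENNReal.ofReal_div_of_pos hδ,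
      ENNReal.le_div_iff_mul_le (Or.inl (by simpa using hn.ne')) (Or.inl ENNReal.ofReal_ne_top),
      mul_comm]
    exact h2
  have hd1 : pm (fun q => coneDist n₁ n₂ q) ≤ ENNReal.ofReal (1 + C) := by
    calc pm (fun q => coneDist n₁ n₂ q) ≤ pm (fun q => 1 + coneDist n₁ n₂ q ^ 2) :=
          mean_mono fun q => ENNReal.ofReal_le_ofReal (by
            nlinarith [sq_nonneg (coneDist n₁ n₂ q - 1), coneDist_nonneg (n₁ := n₁) (n₂ := n₂) q])
      _ = 1 + pm (fun q => coneDist n₁ n₂ q ^ 2) := by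
          simp only [hpm]
          rw [mean_ofReal_add π (fun _ => zero_le_one) fun q => sq_nonneg _, mean_const,
            ENNReal.ofReal_one]
      _ ≤ 1 + ENNReal.ofReal C := by gcongr
      _ = _ := by rw [ENNReal.ofReal_add zero_le_one hC0, ENNReal.ofReal_one]
  -- unused service
  have hU : slotMean rule lam π (fun q s a => portUnused n₁ n₂ q a s)
      ≤ ENNReal.ofReal (ε * (n₁ + n₂)) := by
    have hL0 : ∀ q : QueueMatrix n, 0 ≤ inner ℝ (portSum n n₁ n₂) (queueVec q) := fun q => by
      rw [inner_vec]
      exact Finset.sum_nonneg fun x _ => mul_nonneg (portSum_nonneg x) (Nat.cast_nonneg _)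
    -- Finiteness permits the cancellation of this mean from both sides of the stationary balance.
    have hL : pm (fun q => inner ℝ (portSum n n₁ n₂) (queueVec q)) < ∞ := by
      refine (mean_mono fun q => ENNReal.ofReal_le_ofReal (q := ‖portSum n n₁ n₂‖ *
        (1 + ‖queueVec q‖ ^ 2)) ((real_inner_le_norm _ _).trans ?_)).trans_lt ?_
      · exact mul_le_mul_of_nonneg_left
          (by nlinarith [sq_nonneg (‖queueVec q‖ - 1), norm_nonneg (queueVec q)]) (norm_nonneg _)
      · rw [mean_ofReal_const_mul π (norm_nonneg _),
          mean_ofReal_add π (fun _ => zero_le_one) fun q => sq_nonneg _, mean_const]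
        exact ENNReal.mul_lt_top ENNReal.ofReal_lt_top
          (ENNReal.add_lt_top.2 ⟨ENNReal.ofReal_lt_top, hnorm⟩)
    have h2 := slotMean_le_slotMean h0 h1 hπ (F₁ := fun _ => 0)
      (F₂ := fun q => inner ℝ (portSum n n₁ n₂) (queueVec q))
      (G₁ := fun q => inner ℝ (portSum n n₁ n₂) (queueVec q)) (G₂ := fun _ => ε * (n₁ + n₂))
      (Φ₁ := fun q s a => portUnused n₁ n₂ q a s) (Φ₂ := fun _ _ _ => 0)
      (fun _ => le_rfl) hL0 hL0 (fun _ => by positivity) (fun q s a => portUnused_nonneg q a s)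
      (fun _ _ _ => le_rfl) fun q s hs => by
        simp only [zero_add, add_zero]
        rw [add_comm]
        exact (inner_portSum_add_arrivalMean_portUnused hn₁ hn₂ ε q (hrule q s hs).1).le
    simp only [slotMean_zero, mean_const, ENNReal.ofReal_zero, zero_add, add_zero] at h2
    rw [add_comm] at h2
    exact (ENNReal.add_le_add_iff_left hL.ne).1 h2
  -- error terms
  have herr : pm (fun q => η * coneDist n₁ n₂ q ^ 2)
      + slotMean rule lam π (fun q s a => (1 / η + 1) * portUnused n₁ n₂ q a s)
      + pm (fun q => 2 * ε * n * coneDist n₁ n₂ q)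
      ≤ ENNReal.ofReal (heavyTrafficError n n₁ n₂ ε) := by
    have h2 : ENNReal.ofReal (heavyTrafficError n n₁ n₂ ε) = ENNReal.ofReal η * ENNReal.ofReal C
        + ENNReal.ofReal (1 / η + 1) * ENNReal.ofReal (ε * (n₁ + n₂))
        + ENNReal.ofReal (2 * ε * n) * ENNReal.ofReal (1 + C) := by
      rw [← ENNReal.ofReal_mul hη0.le, ← ENNReal.ofReal_mul (by positivity),
        ← ENNReal.ofReal_mul (by positivity), ← ENNReal.ofReal_add (by positivity) (by positivity),
        ← ENNReal.ofReal_add (by positivity) (by positivity)]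
      rfl
    simp only [hpm] at hd1 hd2 ⊢
    rw [mean_ofReal_const_mul π hη0.le, slotMean_const_mul _ _ _ (by positivity),
      mean_ofReal_const_mul π (by positivity), h2]
    gcongr
  have hh0 : ∀ q : QueueMatrix n, 0 ≤ ‖portProj n n₁ n₂ (queueVec q)‖ ^ 2 := fun q => sq_nonneg _
  -- This mean occurs on both sides of both balances below. Only its finiteness is used, as the
  -- moment bound behind it blows up as `ε → 0`.
  have hh : pm (fun q => ‖portProj n n₁ n₂ (queueVec q)‖ ^ 2) < ∞ :=
    (mean_mono fun q => ENNReal.ofReal_le_ofReal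
      (pow_le_pow_left₀ (norm_nonneg _) (norm_portProj_le _) 2)).trans_lt hnorm
  have hsum0 : ∀ q : QueueMatrix n, 0 ≤ ∑ x, queueVec q x := fun q =>
    Finset.sum_nonneg fun x _ => Nat.cast_nonneg _
  have hηd0 : ∀ q : QueueMatrix n, 0 ≤ η * coneDist n₁ n₂ q ^ 2 := fun q => by positivity
  have hεd0 : ∀ q : QueueMatrix n, 0 ≤ 2 * ε * n * coneDist n₁ n₂ q := fun q =>
    mul_nonneg (by positivity) (coneDist_nonneg q)
  have hU0 : ∀ (q : QueueMatrix n) (s : Schedule n) (a : Fin n → Fin n → Bool),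
      0 ≤ (1 / η + 1) * portUnused n₁ n₂ q a s := fun q s a =>
    mul_nonneg (by positivity) (portUnused_nonneg q a s)
  have hM : pm (fun q => 2 * ε / n * ∑ x, queueVec q x)
      = ENNReal.ofReal (2 * ε / n) * meanTotal π := by
    rw [meanTotal_eq_mean_sum, ← mean_ofReal_const_mul π (by positivity)]
  have hdrift := fun (q : QueueMatrix n) (s : Schedule n) (hs : s ∈ (rule q).support) =>
    abs_le.1 (abs_drift_norm_portProj_sq_le (n₁ := n₁) (n₂ := n₂) hn₁ hn₂ hε.le hε2 hη0 q
      (hrule q s hs).1)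
  constructor
  · have h2 := slotMean_le_slotMean h0 h1 hπ
      (F₁ := fun q => ‖portProj n n₁ n₂ (queueVec q)‖ ^ 2)
      (F₂ := fun q => η * coneDist n₁ n₂ q ^ 2)
      (G₁ := fun q => 2 * ε / n * ∑ x, queueVec q x)
      (G₂ := fun q => (‖portProj n n₁ n₂ (queueVec q)‖ ^ 2 + κ) + 2 * ε * n * coneDist n₁ n₂ q)
      (Φ₁ := fun _ _ _ => 0) (Φ₂ := fun q s a => (1 / η + 1) * portUnused n₁ n₂ q a s)
      hh0 hηd0 (fun q => mul_nonneg (by positivity) (hsum0 q))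
      (fun q => add_nonneg (add_nonneg (hh0 q) hκ0) (hεd0 q)) (fun _ _ _ => le_rfl) hU0
      fun q s hs => by
        simp only [add_zero]
        linarith [(hdrift q s hs).2]
    rw [slotMean_zero, add_zero,
      mean_ofReal_add π (fun q => add_nonneg (hh0 q) hκ0) hεd0,
      mean_ofReal_add π hh0 fun _ => hκ0, mean_const] at h2
    rw [← hM, ENNReal.ofReal_add hκ0 (by unfold heavyTrafficError; positivity)]
    refine (ENNReal.add_le_add_iff_left hh.ne).1 (h2.trans ?_)
    calc _ = pm (fun q => ‖portProj n n₁ n₂ (queueVec q)‖ ^ 2) + (ENNReal.ofReal κ +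
          (pm (fun q => η * coneDist n₁ n₂ q ^ 2)
          + slotMean rule lam π (fun q s a => (1 / η + 1) * portUnused n₁ n₂ q a s)
          + pm (fun q => 2 * ε * n * coneDist n₁ n₂ q))) := by simp only [hpm]; ring
      _ ≤ _ := by gcongr
  · have h2 := slotMean_le_slotMean h0 h1 hπ
      (F₁ := fun _ => 0)
      (F₂ := fun q => ‖portProj n n₁ n₂ (queueVec q)‖ ^ 2 + η * coneDist n₁ n₂ q ^ 2)
      (G₁ := fun q => ‖portProj n n₁ n₂ (queueVec q)‖ ^ 2 + κ)
      (G₂ := fun q => 2 * ε / n * ∑ x, queueVec q x + 2 * ε * n * coneDist n₁ n₂ q)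
      (Φ₁ := fun _ _ _ => 0) (Φ₂ := fun q s a => (1 / η + 1) * portUnused n₁ n₂ q a s)
      (fun _ => le_rfl) (fun q => add_nonneg (hh0 q) (hηd0 q))
      (fun q => add_nonneg (hh0 q) hκ0)
      (fun q => add_nonneg (mul_nonneg (by positivity) (hsum0 q)) (hεd0 q))
      (fun _ _ _ => le_rfl) hU0
      fun q s hs => by
        have h3 : arrivalMean lam (fun a => ‖portProj n n₁ n₂ (queueVec (nextQueue q a s))‖ ^ 2
            + η * coneDist n₁ n₂ (nextQueue q a s) ^ 2 + (1 / η + 1) * portUnused n₁ n₂ q a s)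
            = arrivalMean lam (fun a => ‖portProj n n₁ n₂ (queueVec (nextQueue q a s))‖ ^ 2)
            + arrivalMean lam (fun a => η * coneDist n₁ n₂ (nextQueue q a s) ^ 2
              + (1 / η + 1) * portUnused n₁ n₂ q a s) := by
          rw [← map_add]
          congr 1
          funext a
          simp only [Pi.add_apply]
          ring
        rw [h3]
        simp only [add_zero, arrivalMean_const]
        linarith [(hdrift q s hs).1]
    rw [slotMean_zero, mean_const, ENNReal.ofReal_zero, add_zero, zero_add,
      mean_ofReal_add π hh0 fun _ => hκ0, mean_const, mean_ofReal_add π hh0 hηd0,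
      mean_ofReal_add π (fun q => mul_nonneg (by positivity) (hsum0 q)) hεd0] at h2
    rw [← hM]
    refine (ENNReal.add_le_add_iff_left hh.ne).1 (h2.trans ?_)
    calc _ = pm (fun q => ‖portProj n n₁ n₂ (queueVec q)‖ ^ 2) +
          (pm (fun q => 2 * ε / n * ∑ x, queueVec q x) +
          (pm (fun q => η * coneDist n₁ n₂ q ^ 2)
          + slotMean rule lam π (fun q s a => (1 / η + 1) * portUnused n₁ n₂ q a s)
          + pm (fun q => 2 * ε * n * coneDist n₁ n₂ q))) := by simp only [hpm]; ring
      _ ≤ _ := by gcongr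

theorem tendsto_heavyTrafficError (n n₁ n₂ : ℕ) :
    Tendsto (heavyTrafficError n n₁ n₂) (𝓝[>] 0) (𝓝 0) := by
  have h1 : Tendsto (fun ε : ℝ => Real.sqrt ε * collapseBound n
      + (Real.sqrt ε + ε) * (n₁ + n₂) + 2 * ε * n * (1 + collapseBound n)) (𝓝[>] 0) (𝓝 0) := by
    have h2 : Continuous (fun ε : ℝ => Real.sqrt ε * collapseBound n
      + (Real.sqrt ε + ε) * (n₁ + n₂) + 2 * ε * n * (1 + collapseBound n)) := by fun_prop
    have h3 := (h2.tendsto 0).mono_left (nhdsWithin_le_nhds (s := Set.Ioi 0))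
    simpa using h3
  refine h1.congr' ?_
  filter_upwards [self_mem_nhdsWithin] with ε hε
  have hs : 0 < Real.sqrt ε := Real.sqrt_pos.2 hε
  have hsq : Real.sqrt ε * Real.sqrt ε = ε := Real.mul_self_sqrt (le_of_lt hε)
  have h4 : 1 / Real.sqrt ε * ε = Real.sqrt ε := by
    rw [div_mul_eq_mul_div, one_mul, div_eq_iff hs.ne', hsq]
  unfold heavyTrafficError
  linear_combination (-(n₁ + n₂ : ℝ)) * h4

theorem continuous_satVariance (n : ℕ) : Continuous (satVariance n) := by
  unfold satVariance; fun_prop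

theorem tendsto_netVariance (n n₁ n₂ : ℕ) :
    Tendsto (netVariance n n₁ n₂) (𝓝[>] 0) (𝓝 (1 / n * (1 - 1 / n) * (n₁ + n₂))) := by
  have h1 : Continuous (netVariance n n₁ n₂) := by
    have := continuous_satVariance n
    unfold netVariance; fun_prop
  have h2 := (h1.tendsto 0).mono_left (nhdsWithin_le_nhds (s := Set.Ioi 0))
  simpa [netVariance, satVariance] using h2

theorem sum_subtype_le (p : Fin n → Prop) [DecidablePred p] (f : Fin n → ℝ≥0∞) :
    ∑ i : {i // p i}, f i ≤ ∑ i, f i :=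
  (Finset.sum_map Finset.univ (Function.Embedding.subtype p) f).symm.trans_le
    (Finset.sum_le_sum_of_subset (Finset.subset_univ _))

theorem ofReal_le_of_card_mul_le {m : ℕ} {ε x : ℝ} (hε : 0 < ε) {M : ℝ≥0∞}
    (h : (m : ℝ≥0∞) * ENNReal.ofReal (x / (2 * ε)) ≤ M) :
    ENNReal.ofReal (m * (x / 2)) ≤ ENNReal.ofReal ε * M := by
  refine le_trans (le_of_eq ?_) (mul_le_mul_right h (ENNReal.ofReal ε))
  rw [ENNReal.ofReal_mul (Nat.cast_nonneg m), ENNReal.ofReal_natCast, mul_left_comm,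
    ← ENNReal.ofReal_mul hε.le]
  congr 2
  field_simp

/-- The lower bound of the mean total queue length from the saturated inputs. -/
theorem le_meanTotal_of_rows {ε : ℝ} (hε : 0 < ε) (hε1 : ε ≤ 1) (hn₁ : n₁ < n)
    {P : Policy n} {init π : PMF (QueueMatrix n)}
    (hπ : ConvergesInLaw P (rate n n₁ n₂ ε) init π) :
    ENNReal.ofReal (n₁ * ((n * satVariance n ε - ε * (1 - ε)) / 2))
      ≤ ENNReal.ofReal ε * meanTotal π := by
  have h0 : ∀ i j, 0 ≤ rate n n₁ n₂ ε i j := rate_nonneg hε1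
  have h1 : ∀ i j, rate n n₁ n₂ ε i j ≤ 1 := fun i j => (rate_le hε1 i j).trans (by linarith)
  have hrow : ∀ i : {i : Fin n // i.val < n₁},
      ENNReal.ofReal ((n * satVariance n ε - ε * (1 - ε)) / (2 * ε))
        ≤ mean π fun q => ∑ j, (q i.1 j : ℝ≥0∞) := by
    intro i
    have h2 := le_mean_portQueue (p := fun k => (i.1, k)) h0 h1
      (fun k l h => (Prod.ext_iff.1 h).2) (fun s => s.2.1 i.1) hε
      (by simp only [rate_eq n n₁ n₂ ε, ← Finset.mul_sum, sum_rate_zero_row i.2, mul_one]) hπ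
    simp only [rate_mul_of_sat (Or.inl i.2), portQueue, Nat.cast_sum, Finset.sum_const,
      Finset.card_univ, Fintype.card_fin, nsmul_eq_mul] at h2
    exact h2
  have hsum : ∑ _i : {i : Fin n // i.val < n₁},
      ENNReal.ofReal ((n * satVariance n ε - ε * (1 - ε)) / (2 * ε)) ≤ meanTotal π := by
    -- Different rows share no queue, so the bounds of the ports add up.
    refine (Finset.sum_le_sum fun i _ => hrow i).trans ?_
    rw [meanTotal_eq_mean, ← mean_finset_sum]
    exact mean_mono fun q => sum_subtype_le _ fun i => ∑ j, (q i j : ℝ≥0∞)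
  rw [Finset.sum_const, Finset.card_univ, card_fin_val_lt hn₁, nsmul_eq_mul] at hsum
  exact ofReal_le_of_card_mul_le hε hsum

/-- The lower bound of the mean total queue length from the saturated outputs. -/
theorem le_meanTotal_of_cols {ε : ℝ} (hε : 0 < ε) (hε1 : ε ≤ 1) (hn₂ : n₂ < n)
    {P : Policy n} {init π : PMF (QueueMatrix n)}
    (hπ : ConvergesInLaw P (rate n n₁ n₂ ε) init π) :
    ENNReal.ofReal (n₂ * ((n * satVariance n ε - ε * (1 - ε)) / 2))
      ≤ ENNReal.ofReal ε * meanTotal π := by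
  have h0 : ∀ i j, 0 ≤ rate n n₁ n₂ ε i j := rate_nonneg hε1
  have h1 : ∀ i j, rate n n₁ n₂ ε i j ≤ 1 := fun i j => (rate_le hε1 i j).trans (by linarith)
  have hcol : ∀ j : {j : Fin n // j.val < n₂},
      ENNReal.ofReal ((n * satVariance n ε - ε * (1 - ε)) / (2 * ε))
        ≤ mean π fun q => ∑ i, (q i j.1 : ℝ≥0∞) := by
    intro j
    have h2 := le_mean_portQueue (p := fun k => (k, j.1)) h0 h1
      (fun k l h => (Prod.ext_iff.1 h).1) (fun s => s.2.2 j.1) hε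
      (by simp only [rate_eq n n₁ n₂ ε, ← Finset.mul_sum, sum_rate_zero_col j.2, mul_one]) hπ
    simp only [rate_mul_of_sat (Or.inr j.2), portQueue, Nat.cast_sum, Finset.sum_const,
      Finset.card_univ, Fintype.card_fin, nsmul_eq_mul] at h2
    exact h2
  have hsum : ∑ _j : {j : Fin n // j.val < n₂},
      ENNReal.ofReal ((n * satVariance n ε - ε * (1 - ε)) / (2 * ε)) ≤ meanTotal π := by
    refine (Finset.sum_le_sum fun j _ => hcol j).trans ?_
    rw [meanTotal_eq_mean, ← mean_finset_sum]
    refine mean_mono fun q => ?_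
    rw [Finset.sum_comm (f := fun i j => (q i j : ℝ≥0∞))]
    exact sum_subtype_le _ fun j => ∑ i, (q i j : ℝ≥0∞)
  rw [Finset.sum_const, Finset.card_univ, card_fin_val_lt hn₂, nsmul_eq_mul] at hsum
  exact ofReal_le_of_card_mul_le hε hsum

/-- The bound is continuous in `ε`, and at `ε = 0` the variance `n * satVariance` of a port equals
`1 - 1 / n`. -/
theorem le_liminf_of_le_on_Ioo {m : ℕ} (hn : 0 < n) {F : ℝ → ℝ≥0∞}
    (h : ∀ ε ∈ Set.Ioo (0 : ℝ) 1,
      ENNReal.ofReal (m * ((n * satVariance n ε - ε * (1 - ε)) / 2)) ≤ F ε) :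
    ENNReal.ofReal ((m : ℝ) / 2 * (1 - 1 / n)) ≤ liminf F (𝓝[>] 0) := by
  have hn' : (n : ℝ) ≠ 0 := by positivity
  have h1 : Continuous fun ε : ℝ => (m : ℝ) * ((n * satVariance n ε - ε * (1 - ε)) / 2) := by
    have := continuous_satVariance n
    fun_prop
  have h2 := ENNReal.tendsto_ofReal
    ((h1.tendsto 0).mono_left (nhdsWithin_le_nhds (s := Set.Ioi 0)))
  have h3 : (m : ℝ) * ((n * satVariance n 0 - 0 * (1 - 0)) / 2) = (m : ℝ) / 2 * (1 - 1 / n) := by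
    unfold satVariance; field_simp; ring
  rw [h3] at h2
  rw [← h2.liminf_eq]
  refine liminf_le_liminf ?_
  filter_upwards [Ioo_mem_nhdsGT (zero_lt_one' ℝ)] with ε hε using h ε hε

/-- The universal lower bound in heavy traffic. -/
theorem max_le_liminf_meanTotal (hn₁ : n₁ < n) (hn₂ : n₂ < n) {P : ℝ → Policy n}
    {init π : ℝ → PMF (QueueMatrix n)}
    (h : ∀ ε ∈ Set.Ioo (0 : ℝ) 1, ConvergesInLaw (P ε) (rate n n₁ n₂ ε) (init ε) (π ε)) :
    ENNReal.ofReal ((max n₁ n₂ : ℝ) / 2 * (1 - 1 / n))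
      ≤ liminf (fun ε : ℝ => ENNReal.ofReal ε * meanTotal (π ε)) (𝓝[>] 0) := by
  have hn : 0 < n := by omega
  rcases max_choice (n₁ : ℝ) n₂ with hm | hm <;> rw [hm]
  · exact le_liminf_of_le_on_Ioo hn fun ε hε =>
      le_meanTotal_of_rows hε.1 hε.2.le hn₁ (h ε hε)
  · exact le_liminf_of_le_on_Ioo hn fun ε hε =>
      le_meanTotal_of_cols hε.1 hε.2.le hn₂ (h ε hε)

/-- A squeeze between the net variance plus and minus the error, followed by multiplication by `n /
2`. -/
theorem tendsto_of_scaled_bounds (hn : 0 < n) {M : ℝ → ℝ≥0∞}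
    (h : ∀ᶠ ε : ℝ in 𝓝[>] 0, ENNReal.ofReal (2 * ε / n) * M ε
        ≤ ENNReal.ofReal (netVariance n n₁ n₂ ε + heavyTrafficError n n₁ n₂ ε) ∧
      ENNReal.ofReal (netVariance n n₁ n₂ ε)
        ≤ ENNReal.ofReal (2 * ε / n) * M ε + ENNReal.ofReal (heavyTrafficError n n₁ n₂ ε)) :
    Tendsto (fun ε : ℝ => ENNReal.ofReal ε * M ε) (𝓝[>] 0)
      (𝓝 (ENNReal.ofReal (((n₁ : ℝ) + n₂) / 2 * (1 - 1 / n)))) := by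
  have hn' : (0 : ℝ) < n := by positivity
  have hv := tendsto_netVariance n n₁ n₂
  have he := tendsto_heavyTrafficError n n₁ n₂
  set A : ℝ := 1 / n * (1 - 1 / n) * (n₁ + n₂) with hA
  have hup : Tendsto (fun ε => ENNReal.ofReal (netVariance n n₁ n₂ ε
      + heavyTrafficError n n₁ n₂ ε)) (𝓝[>] 0) (𝓝 (ENNReal.ofReal A)) := by
    simpa using ENNReal.tendsto_ofReal (hv.add he)
  have hlow : Tendsto (fun ε => ENNReal.ofReal (netVariance n n₁ n₂ ε)
      - ENNReal.ofReal (heavyTrafficError n n₁ n₂ ε)) (𝓝[>] 0) (𝓝 (ENNReal.ofReal A)) := by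
    have := ENNReal.Tendsto.sub (ENNReal.tendsto_ofReal hv) (ENNReal.tendsto_ofReal he)
      (Or.inl ENNReal.ofReal_ne_top)
    simpa using this
  have hmid : Tendsto (fun ε : ℝ => ENNReal.ofReal (2 * ε / n) * M ε) (𝓝[>] 0)
      (𝓝 (ENNReal.ofReal A)) :=
    tendsto_of_tendsto_of_tendsto_of_le_of_le' hlow hup
      (h.mono fun ε hε => tsub_le_iff_right.2 hε.2) (h.mono fun ε hε => hε.1)
  have hscaled := ENNReal.Tendsto.const_mul (a := ENNReal.ofReal (n / 2)) hmid
    (Or.inr ENNReal.ofReal_ne_top)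
  have hlim : ENNReal.ofReal (n / 2) * ENNReal.ofReal A
      = ENNReal.ofReal (((n₁ : ℝ) + n₂) / 2 * (1 - 1 / n)) := by
    rw [← ENNReal.ofReal_mul (by positivity), hA]
    congr 1
    field_simp
  rw [hlim] at hscaled
  refine hscaled.congr fun ε => ?_
  rw [← mul_assoc, ← ENNReal.ofReal_mul (by positivity)]
  congr 2
  field_simp

end HeavyTraffic

end

end SwitchModel

/-! ### The main theorem -/

theorem mainTheorem7 (n n₁ n₂ : ℕ) (hn₁ : n₁ < n) (hn₂ : n₂ < n)
    (MW : Policy n) (hMW : IsMaxWeight MW) :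
    ∃ qbar : ℝ → PMF (QueueMatrix n),
      -- under MaxWeight every system has a unique steady state, reached from every initial law
      (∀ ε ∈ Set.Ioo (0 : ℝ) 1,
        (∀ t, queueLaw MW (rate n n₁ n₂ ε) (qbar ε) t = qbar ε) ∧
        ∀ init, ConvergesInLaw MW (rate n n₁ n₂ ε) init (qbar ε)) ∧
      -- its heavy-traffic limit
      Tendsto (fun ε : ℝ => ENNReal.ofReal ε * meanTotal (qbar ε)) (𝓝[>] 0)
        (𝓝 (ENNReal.ofReal (((n₁ : ℝ) + n₂) / 2 * (1 - 1 / n)))) ∧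
      -- any stable policy (which may depend on `ε`), and the comparison with MaxWeight
      ∀ (P : ℝ → Policy n) (init π : ℝ → PMF (QueueMatrix n)),
        (∀ ε ∈ Set.Ioo (0 : ℝ) 1, ConvergesInLaw (P ε) (rate n n₁ n₂ ε) (init ε) (π ε)) →
        ENNReal.ofReal ((max n₁ n₂ : ℝ) / 2 * (1 - 1 / n)) ≤
            liminf (fun ε : ℝ => ENNReal.ofReal ε * meanTotal (π ε)) (𝓝[>] 0) ∧
          limsup (fun ε : ℝ => ENNReal.ofReal ε * meanTotal (qbar ε)) (𝓝[>] 0) ≤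
            2 * liminf (fun ε : ℝ => ENNReal.ofReal ε * meanTotal (π ε)) (𝓝[>] 0) := by
  obtain ⟨rule, hP, hrule⟩ := hMW
  have hn : 0 < n := by omega
  have hn' : (1 : ℝ) ≤ n := by exact_mod_cast hn
  have hex : ∀ ε : ℝ, ∃ π : PMF (QueueMatrix n), ε ∈ Set.Ioo (0 : ℝ) 1 →
      π.bind (ruleKernel rule (rate n n₁ n₂ ε)) = π ∧
      (∀ init, ConvergesInLaw MW (rate n n₁ n₂ ε) init π) ∧
      ∀ (V f : QueueMatrix n → ℝ) (b : ℝ), (∀ q, 0 ≤ V q) → (∀ q, 0 ≤ f q) → 0 ≤ b →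
        (∀ q, ∀ s ∈ (rule q).support,
          arrivalMean (rate n n₁ n₂ ε) (fun a => V (nextQueue q a s)) ≤ V q - f q + b) →
        mean π (fun q => ENNReal.ofReal (f q)) ≤ ENNReal.ofReal b := by
    intro ε
    by_cases hε : ε ∈ Set.Ioo (0 : ℝ) 1
    · obtain ⟨π, h1, h2, h3⟩ := exists_steadyState hn₁ hn₂ hrule hε.1 hε.2.le
      refine ⟨π, fun _ => ⟨h1, fun init => convergesInLaw_of_le_liminf fun f hf => ?_, h3⟩⟩
      simp only [queueLaw_eq_bind_kernelPow hP]
      exact h2 init f hf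
    -- An arbitrary value outside `(0, 1)`, so that the steady state is a function of all real `ε`.
    · exact ⟨PMF.pure fun _ _ => 0, fun h => absurd h hε⟩
  choose qbar hqbar using hex
  have hlim : Tendsto (fun ε : ℝ => ENNReal.ofReal ε * meanTotal (qbar ε)) (𝓝[>] 0)
      (𝓝 (ENNReal.ofReal (((n₁ : ℝ) + n₂) / 2 * (1 - 1 / n)))) := by
    refine tendsto_of_scaled_bounds hn ?_
    have hpos : (0 : ℝ) < 1 / (4 * n ^ 2) := by positivity
    -- The collapse estimates require `ε ≤ 1 / (4n²)`, which holds eventually.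
    filter_upwards [Ioo_mem_nhdsGT hpos] with ε hε
    have hε1 : ε < 1 := hε.2.trans_le ((div_le_one (by positivity)).2 (by nlinarith))
    obtain ⟨h1, -, h3⟩ := hqbar ε ⟨hε.1, hε1⟩
    exact steadyState_bounds hn₁ hn₂ hrule hε.1 hε.2.le h1 h3
  refine ⟨qbar, fun ε hε => ⟨fun t => ?_, (hqbar ε hε).2.1⟩, hlim, fun P init π hπ => ?_⟩
  · rw [queueLaw_eq_bind_kernelPow hP, bind_kernelPow_of_invariant _ (hqbar ε hε).1]
  · have hlow := max_le_liminf_meanTotal hn₁ hn₂ hπ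
    refine ⟨hlow, ?_⟩
    rw [hlim.limsup_eq]
    refine le_trans ?_ (mul_le_mul_right hlow 2)
    rw [← ENNReal.ofReal_ofNat, ← ENNReal.ofReal_mul (by norm_num)]
    refine ENNReal.ofReal_le_ofReal ?_
    have h1 : 0 ≤ 1 - 1 / (n : ℝ) := sub_nonneg.2 ((div_le_one (by linarith)).2 hn')
    have h2 : ((n₁ : ℝ) + n₂) / 2 ≤ 2 * (max (n₁ : ℝ) n₂ / 2) := by
      linarith [le_max_left (n₁ : ℝ) n₂, le_max_right (n₁ : ℝ) n₂]
    calc _ ≤ 2 * (max (n₁ : ℝ) n₂ / 2) * (1 - 1 / (n : ℝ)) := by gcongr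
      _ = _ := by ring
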